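/- **Setting.** An *orthogonal $\Omega$-spectrum* $\Theta_\bullet$ consists of based topological spaces $\Theta_n$ ($n\ge 0$; the base point is called the vacuum), each with a continuous, base-point-preserving action of $O(n)$, and based structure maps $\Theta_n\wedge S^1\to\Theta_{n+1}$, such that the iterated structure maps $\Theta_n\wedge S^k\to\Theta_{n+k}$ ($S^k=\mathbb R^k\cup\{\infty\}$) are $O(n)\times O(k)$-equivariant and the adjoint maps $\eta_n:\Theta_n\to\Omega\Theta_{n+1}$ are homotopy equivalences. For a space $B$, $h^n(B)=[B,\Theta_n]$ is the set of homotopy classes of maps, with the group structure given by concatenation of loops through $[B,\Theta_n]\cong[B,\Omega\Theta_{n+1}]$. Let $H$ be a topological group (for instance a discrete one), $EH\to BH=EH/H$ a numerable principal $H$-bundle with $EH$ contractible, and $\rho:H\to O(k)$ a continuous homomorphism ($k\ge 0$), through which $H$ acts on the closed unit ball $B^k\subset\mathbb R^k$. Let $B^k/\!/H=(B^k\times EH)/H$, let $T_HB^k=TB^k/\!/H\to B^k/\!/H$ be the vector bundle induced by the tangent bundle, with orthonormal frame bundle $O(T_HB^k)$. For $m=q+k$ with $q\ge 0$, let $O(k)$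 act on $\Theta_m$ through the block inclusion $O(k)\to O(m)$, and let $\mathfrak S_m\to B^k/\!/H$ be the associated state bundle, with fibres $(\mathfrak S_m)_b=\mathrm{Hom}_{O(k)}(O(T_HB^k)_b,\Theta_m)$; the loop state bundle $\Omega\mathfrak S_{m+1}$, with fibre $\Omega\Theta_{m+1}$, is defined in the same way. For a section $s_0$ of $\mathfrak S_m$ over $\partial B^k/\!/H$, let $\mathcal C(s_0)$ be the set of homotopy classes, relative to $\partial B^k/\!/H$, of continuous sections of $\mathfrak S_m$ over $B^k/\!/H$ that restrict to $s_0$. For $a:BH\to\Theta_{m-k}$ let $\mathrm{Th}(a)$ be the section of $\mathfrak S_m$ given in the standard frame by $[x,e]\mapsto a([e])\wedge c(x)$, where $c:B^k\to B^k/\partial B^k\cong S^k$ is the radial collapse map; it is the vacuum over $\partial B^k/\!/H$. **Lemma.** For every section $s_0$ over $\partial B^k/\!/H$ that extends to $B^k/\!/H$, the set $\mathcal C(s_0)$ is a torsor over the group $h^{m-k}(BH)$, as follows. The action of $[a]$ is addition of $\mathrm{Th}(a)$ with respect to the loop structure: $[a]+[s]=[s']$ if and only if there is a homotopy of sections of $\Omega\mathfrak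 S_{m+1}$ from the fibrewise concatenation $\eta_m\mathrm{Th}(a)*\eta_m s$ to $\eta_m s'$ which over $\partial B^k/\!/H$ is the standard homotopy $\mathrm{const}*\eta_m s_0\simeq\eta_m s_0$. If $s_0$ is constant, that is, given in all standard frames by one point $\theta\in\Theta_m$ fixed by $\rho(H)$, then the class of the constant section $\theta$ is a natural identity element of $\mathcal C(s_0)$, so that acting on it is a bijection $h^{m-k}(BH)\to\mathcal C(s_0)$. If $\theta$ is the vacuum, this bijection is the Thom map $[a]\mapsto[\mathrm{Th}(a)]$. -/

import Mathlib

open scoped unitInterval Topology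

universe u v w

noncomputable section

namespace ThomTorsor

/-! ## Orthogonal groups, balls and spheres -/

/-- The orthogonal group `O(n)`, with the topology of a space of real matrices. -/
abbrev O (n : ℕ) : Type := ↥(Matrix.orthogonalGroup (Fin n) ℝ)

/-- The block inclusion `O(n) × O(k) → O(n + k)`, `(A, B) ↦ diag(A, B)`. -/
def blockSum (n k : ℕ) : O n × O k →* O (n + k) where
  toFun p := ⟨Matrix.reindex finSumFinEquiv finSumFinEquiv
      (Matrix.fromBlocks p.1.1 0 0 p.2.1), by
    have h1 := (Matrix.mem_orthogonalGroup_iff _ _).1 p.1.2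
    have h2 := (Matrix.mem_orthogonalGroup_iff _ _).1 p.2.2
    rw [Matrix.mem_orthogonalGroup_iff]
    rw [Matrix.transpose_reindex, Matrix.fromBlocks_transpose, Matrix.reindex_apply,
      Matrix.reindex_apply, Matrix.submatrix_mul_equiv, Matrix.fromBlocks_multiply]
    simp [h1, h2]⟩
  map_one' := by
    apply Subtype.ext
    simp
  map_mul' p q := by
    apply Subtype.ext
    simp [Matrix.submatrix_mul_equiv, Matrix.fromBlocks_multiply]

theorem continuous_blockSum (n k : ℕ) : Continuous (blockSum n k) := by
  apply Continuous.subtype_mk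
  apply Continuous.matrix_reindex
  apply Continuous.matrix_fromBlocks <;> fun_prop

/-- The closed unit ball `B^k` in Euclidean space. -/
abbrev Ball (k : ℕ) : Type := ↥(Metric.closedBall (0 : EuclideanSpace ℝ (Fin k)) 1)

theorem norm_mulVec {k : ℕ} (A : O k) (x : EuclideanSpace ℝ (Fin k)) :
    ‖WithLp.toLp 2 (A.1.mulVec x.ofLp)‖ = ‖x‖ := by
  have h := (Matrix.mem_orthogonalGroup_iff' _ _).1 A.2
  have key : A.1.mulVec x.ofLp ⬝ᵥ A.1.mulVec x.ofLp = x.ofLp ⬝ᵥ x.ofLp := by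
    rw [Matrix.dotProduct_mulVec, Matrix.vecMul_mulVec, h, Matrix.vecMul_one]
  rw [EuclideanSpace.norm_eq, EuclideanSpace.norm_eq]
  congr 1
  simpa [dotProduct, sq_abs, pow_two] using key

/-- `O(k)` acts on the ball by matrix multiplication. -/
instance (k : ℕ) : MulAction (O k) (Ball k) where
  smul A x := ⟨WithLp.toLp 2 (A.1.mulVec x.1.ofLp), by
    have := x.2
    rw [mem_closedBall_zero_iff] at *
    rwa [norm_mulVec]⟩
  one_smul x := Subtype.ext (by
    change WithLp.toLp 2 ((1 : Matrix (Fin k) (Fin k) ℝ).mulVec x.1.ofLp) = x.1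
    simp)
  mul_smul A B x := Subtype.ext (by
    change WithLp.toLp 2 ((A.1 * B.1).mulVec x.1.ofLp) =
      WithLp.toLp 2 (A.1.mulVec (B.1.mulVec x.1.ofLp))
    rw [Matrix.mulVec_mulVec])

theorem coe_smul_ball {k : ℕ} (A : O k) (x : Ball k) :
    (A • x).1 = WithLp.toLp 2 (A.1.mulVec x.1.ofLp) := rfl

theorem norm_smul_ball {k : ℕ} (A : O k) (x : Ball k) : ‖(A • x).1‖ = ‖x.1‖ :=
  norm_mulVec A x.1

/-- The collapse map `B^k → B^k/∂B^k ≅ S^k`, where `S^k` is the one-point compactification of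
`ℝ^k`: `x ↦ x / (1 - ‖x‖)` in the interior, and the boundary goes to `∞`. -/
def collapse (k : ℕ) (x : Ball k) : OnePoint (EuclideanSpace ℝ (Fin k)) :=
  if ‖x.1‖ < 1 then (((1 - ‖x.1‖)⁻¹ • x.1 : EuclideanSpace ℝ (Fin k)) : OnePoint _)
  else OnePoint.infty

/-- The same map for `k = 1`, written on the unit interval: `[0,1] → [0,1]/{0,1} ≅ S^1`. -/
def collapseI (t : I) : OnePoint ℝ :=
  if |2 * (t : ℝ) - 1| < 1 then (((1 - |2 * (t : ℝ) - 1|)⁻¹ * (2 * (t : ℝ) - 1) : ℝ) : OnePoint ℝ)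
  else OnePoint.infty

/-! ## Orthogonal Ω-spectra -/

/-- The iterated structure map `X_n × (S^1)^k → X_{n+k}` of a sequence of maps
`X_n × S^1 → X_{n+1}`. -/
def iter {X : ℕ → Type u} (str : ∀ n, X n × OnePoint ℝ → X (n + 1)) (n : ℕ) :
    ∀ k : ℕ, X n → (Fin k → OnePoint ℝ) → X (n + k)
  | 0, x, _ => x
  | k + 1, x, z => str (n + k) (iter str n k x (fun i => z i.castSucc), z (Fin.last k))

/-- An orthogonal spectrum (of topological spaces): based `O(n)`-spaces `Θ_n`, and based structure
maps `Θ_n ∧ S^1 → Θ_{n+1}` (where `S^1` is the one-point compactification of `ℝ`), such that the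
iterated structure maps `Θ_n ∧ S^k → Θ_{n+k}` are `O(n) × O(k)`-equivariant. -/
structure OrthogonalSpectrum where
  space : ℕ → Type u
  [top : ∀ n, TopologicalSpace (space n)]
  [act : ∀ n, MulAction (O n) (space n)]
  [cont : ∀ n, ContinuousSMul (O n) (space n)]
  /-- the base point (the vacuum) -/
  pt : ∀ n, space n
  smul_pt : ∀ n (A : O n), A • pt n = pt n
  str : ∀ n, C(space n × OnePoint ℝ, space (n + 1))
  str_pt : ∀ n z, str n (pt n, z) = pt (n + 1)
  str_infty : ∀ n x, str n (x, OnePoint.infty) = pt (n + 1)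
  iter_smul : ∀ n k (A : O n) (B : O k) (x : space n) (y : Fin k → ℝ),
    iter (fun n => str n) n k (A • x) (fun i => ((B.1.mulVec y i : ℝ) : OnePoint ℝ)) =
      blockSum n k (A, B) • iter (fun n => str n) n k x (fun i => ((y i : ℝ) : OnePoint ℝ))

attribute [instance] OrthogonalSpectrum.top OrthogonalSpectrum.act OrthogonalSpectrum.cont

namespace OrthogonalSpectrum

variable (Θ : OrthogonalSpectrum.{u})

/-- The based loop space `ΩΘ_n`, with the compact-open topology. -/
abbrev Loops (n : ℕ) : Type u := Path (Θ.pt n) (Θ.pt n)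

/-- The iterated structure map `Θ_n × S^k → Θ_{n+k}` on the sphere `S^k = ℝ^k ∪ {∞}`. -/
def sphereMap (n k : ℕ) (x : Θ.space n) (z : OnePoint (EuclideanSpace ℝ (Fin k))) :
    Θ.space (n + k) :=
  z.elim (Θ.pt (n + k))
    (fun y => iter (fun n => Θ.str n) n k x (fun i => ((y i : ℝ) : OnePoint ℝ)))


theorem continuous_iter (n k : ℕ) :
    Continuous fun p : Θ.space n × (Fin k → OnePoint ℝ) =>
      iter (fun n => Θ.str n) n k p.1 p.2 := by
  induction k with
  | zero => exact continuous_fst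
  | succ k ih =>
    have h : Continuous fun p : Θ.space n × (Fin (k + 1) → OnePoint ℝ) =>
        (p.1, fun i : Fin k => p.2 i.castSucc) := by fun_prop
    exact (Θ.str (n + k)).continuous.comp
      ((ih.comp h).prodMk ((continuous_apply (Fin.last k)).comp continuous_snd))

theorem iter_pt (n k : ℕ) (z : Fin k → OnePoint ℝ) :
    iter (fun n => Θ.str n) n k (Θ.pt n) z = Θ.pt (n + k) := by
  induction k with
  | zero => rfl
  | succ k ih =>
    change Θ.str (n + k) (iter _ n k _ _, _) = _
    rw [ih, Θ.str_pt]
    rfl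

theorem iter_infty (n k : ℕ) (x : Θ.space n) (z : Fin k → OnePoint ℝ) (i : Fin k)
    (hi : z i = OnePoint.infty) : iter (fun n => Θ.str n) n k x z = Θ.pt (n + k) := by
  induction k with
  | zero => exact i.elim0
  | succ k ih =>
    change Θ.str (n + k) (iter _ n k _ _, _) = _
    induction i using Fin.lastCases with
    | last => rw [hi, Θ.str_infty]; rfl
    | cast i => rw [ih _ i hi, Θ.str_pt]; rfl

theorem tendsto_iter (n k : ℕ) (x : Θ.space n) (i : Fin k) :
    Filter.Tendsto (fun p : Θ.space n × (Fin k → OnePoint ℝ) =>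
      iter (fun n => Θ.str n) n k p.1 p.2)
      (𝓝 x ×ˢ Filter.comap (fun z => z i) (𝓝 OnePoint.infty)) (𝓝 (Θ.pt (n + k))) := by
  have hc : IsClosedMap (fun z : Fin k → OnePoint ℝ => z i) :=
    (continuous_apply i).isClosedMap
  rw [hc.comap_nhds_eq (continuous_apply i), ← nhdsSet_singleton,
    ← IsCompact.nhdsSet_prod_eq isCompact_singleton
      ((isClosed_singleton.preimage (continuous_apply i)).isCompact),
    ← nhdsSet_singleton (x := Θ.pt (n + k))]
  apply (Θ.continuous_iter n k).tendsto_nhdsSet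
  rintro ⟨y, z⟩ ⟨-, hz⟩
  exact Θ.iter_infty n k y z i hz

end OrthogonalSpectrum

theorem tendsto_infty_of_ratio {α : Type*} {l : Filter α} {g r : α → ℝ} {g₀ : ℝ}
    (hg : Filter.Tendsto g l (𝓝 g₀)) (h₀ : g₀ ≠ 0) (hr : Filter.Tendsto r l (𝓝[>] 0)) :
    Filter.Tendsto (fun a => (((r a)⁻¹ * g a : ℝ) : OnePoint ℝ)) l (𝓝 OnePoint.infty) := by
  refine OnePoint.tendsto_coe_infty.comp ?_
  rw [Filter.coclosedCompact_eq_cocompact, ← Metric.cobounded_eq_cocompact,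
    ← tendsto_norm_atTop_iff_cobounded]
  have h1 : Filter.Tendsto (fun a => (r a)⁻¹) l Filter.atTop := tendsto_inv_nhdsGT_zero.comp hr
  have h2 := (Filter.tendsto_abs_atTop_atTop.comp h1).atTop_mul_pos (abs_pos.2 h₀) hg.abs
  simpa [Function.comp_def, abs_mul] using h2

theorem continuousAt_coe_ratio {α : Type*} [TopologicalSpace α] {g r : α → ℝ} {a : α}
    (hg : ContinuousAt g a) (hr : ContinuousAt r a) (h : r a ≠ 0) :
    ContinuousAt (fun a => (((r a)⁻¹ * g a : ℝ) : OnePoint ℝ)) a :=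
  (OnePoint.continuous_coe.tendsto _).comp ((hr.inv₀ h).mul hg)

theorem continuous_collapseI : Continuous collapseI := by
  rw [continuous_iff_continuousAt]
  intro t₀
  have hf : Continuous fun t : I => 2 * (t : ℝ) - 1 := by fun_prop
  have hr : Continuous fun t : I => 1 - |2 * (t : ℝ) - 1| := by fun_prop
  rcases lt_or_ge |2 * (t₀ : ℝ) - 1| 1 with h | h
  · have hev : ∀ᶠ t : I in 𝓝 t₀, |2 * (t : ℝ) - 1| < 1 :=
      hf.abs.continuousAt.eventually_lt continuousAt_const h
    have : ContinuousAt (fun t : I =>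
        (((1 - |2 * (t : ℝ) - 1|)⁻¹ * (2 * (t : ℝ) - 1) : ℝ) : OnePoint ℝ)) t₀ :=
      continuousAt_coe_ratio hf.continuousAt hr.continuousAt (by linarith)
    refine this.congr (hev.mono fun t ht => ?_)
    simp only [collapseI, if_pos ht]
  · have hle : ∀ t : I, |2 * (t : ℝ) - 1| ≤ 1 := fun t => by
      rw [abs_le]; constructor <;> linarith [t.2.1, t.2.2]
    have h1 : |2 * (t₀ : ℝ) - 1| = 1 := le_antisymm (hle _) h
    have hval : collapseI t₀ = OnePoint.infty := by simp [collapseI, h1]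
    rw [ContinuousAt, hval]
    refine Filter.Tendsto.if (p := fun t : I => |2 * (t : ℝ) - 1| < 1) ?_ (tendsto_const_nhds.mono_left inf_le_left)
    refine tendsto_infty_of_ratio (g := fun t : I => 2 * (t : ℝ) - 1)
      (r := fun t : I => 1 - |2 * (t : ℝ) - 1|) (g₀ := 2 * (t₀ : ℝ) - 1)
      (hf.continuousAt.tendsto.mono_left inf_le_left) (by intro h; rw [h] at h1; simp at h1) ?_
    refine tendsto_nhdsWithin_iff.2 ⟨?_, ?_⟩
    · have := hr.continuousAt (x := t₀)
      rw [ContinuousAt, h1, sub_self] at this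
      exact this.mono_left inf_le_left
    · filter_upwards [Filter.mem_inf_of_right (Filter.mem_principal_self _)] with t ht
      exact sub_pos.2 ht

theorem continuous_sphereMap_collapse (Θ : OrthogonalSpectrum.{u}) (n k : ℕ) :
    Continuous fun p : Θ.space n × Ball k => Θ.sphereMap n k p.1 (collapse k p.2) := by
  rw [continuous_iff_continuousAt]
  rintro ⟨θ, x⟩
  have hn : Continuous fun p : Θ.space n × Ball k => 1 - ‖p.2.1‖ := by fun_prop
  have hc : ∀ i, Continuous fun p : Θ.space n × Ball k => p.2.1 i := fun i => by fun_prop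
  have heq : ∀ p : Θ.space n × Ball k, ‖p.2.1‖ < 1 → Θ.sphereMap n k p.1 (collapse k p.2) =
      iter (fun n => Θ.str n) n k p.1
        (fun i => (((1 - ‖p.2.1‖)⁻¹ * p.2.1 i : ℝ) : OnePoint ℝ)) := fun p hp => by
    simp only [collapse, if_pos hp]
    rfl
  rcases lt_or_ge ‖x.1‖ 1 with h | h
  · have hev : ∀ᶠ p : Θ.space n × Ball k in 𝓝 (θ, x), ‖p.2.1‖ < 1 :=
      ContinuousAt.eventually_lt (by fun_prop) continuousAt_const h
    have h1 : ContinuousAt (fun p : Θ.space n × Ball k => (p.1, fun i =>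
        (((1 - ‖p.2.1‖)⁻¹ * p.2.1 i : ℝ) : OnePoint ℝ))) (θ, x) := by
      refine continuousAt_fst.prodMk (continuousAt_pi.2 fun i => ?_)
      exact continuousAt_coe_ratio (hc i).continuousAt hn.continuousAt (sub_pos.2 h).ne'
    have h2 : ContinuousAt (fun p : Θ.space n × Ball k => iter (fun n => Θ.str n) n k p.1
        (fun i => (((1 - ‖p.2.1‖)⁻¹ * p.2.1 i : ℝ) : OnePoint ℝ))) (θ, x) :=
      ((Θ.continuous_iter n k).tendsto _).comp h1
    exact h2.congr (hev.mono fun p hp => (heq p hp).symm)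
  · have h1 : ‖x.1‖ = 1 := le_antisymm (mem_closedBall_zero_iff.1 x.2) h
    have hval : ∀ p : Θ.space n × Ball k, ¬ ‖p.2.1‖ < 1 →
        Θ.sphereMap n k p.1 (collapse k p.2) = Θ.pt (n + k) := fun p hp => by
      simp only [collapse, if_neg hp]
      rfl
    obtain ⟨i, hi⟩ : ∃ i, x.1 i ≠ 0 := by
      by_contra hcon
      push Not at hcon
      have : x.1 = 0 := by ext i; exact hcon i
      rw [this, norm_zero] at h1
      exact zero_ne_one h1
    have hgoal : Filter.Tendsto (fun p : Θ.space n × Ball k =>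
        if ‖p.2.1‖ < 1 then iter (fun n => Θ.str n) n k p.1
        (fun i => (((1 - ‖p.2.1‖)⁻¹ * p.2.1 i : ℝ) : OnePoint ℝ)) else Θ.pt (n + k))
        (𝓝 (θ, x)) (𝓝 (Θ.pt (n + k))) := by
      refine Filter.Tendsto.if ?_ (tendsto_const_nhds.mono_left inf_le_left)
      refine (Θ.tendsto_iter n k θ i).comp (f := fun p : Θ.space n × Ball k => (p.1, fun i =>
        (((1 - ‖p.2.1‖)⁻¹ * p.2.1 i : ℝ) : OnePoint ℝ))) ?_
      refine Filter.Tendsto.prodMk (continuousAt_fst.tendsto.mono_left inf_le_left) ?_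
      rw [Filter.tendsto_comap_iff]
      refine tendsto_infty_of_ratio (g := fun p : Θ.space n × Ball k => p.2.1 i)
        (r := fun p : Θ.space n × Ball k => 1 - ‖p.2.1‖) (g₀ := x.1 i)
        ((hc i).continuousAt.tendsto.mono_left inf_le_left) hi ?_
      refine tendsto_nhdsWithin_iff.2 ⟨?_, ?_⟩
      · have := hn.continuousAt (x := (θ, x))
        rw [ContinuousAt, h1, sub_self] at this
        exact this.mono_left inf_le_left
      · filter_upwards [Filter.mem_inf_of_right (Filter.mem_principal_self _)] with p hp
        exact sub_pos.2 hp
    rw [ContinuousAt, hval (θ, x) h.not_gt]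
    refine hgoal.congr fun p => ?_
    split_ifs with hp
    · exact (heq p hp).symm
    · exact (hval p hp).symm

/-- The adjoint `Θ_n → ΩΘ_{n+1}`, `x ↦ (t ↦ x ∧ t)`, of the structure map `Θ_n ∧ S^1 → Θ_{n+1}`. -/
def OrthogonalSpectrum.adjoint (Θ : OrthogonalSpectrum.{u}) (n : ℕ) :
    C(Θ.space n, Θ.Loops (n + 1)) where
  toFun x :=
    { toFun := fun t => Θ.str n (x, collapseI t)
      continuous_toFun := (Θ.str n).continuous.comp
        (continuous_const.prodMk continuous_collapseI)
      source' := by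
        have : collapseI 0 = OnePoint.infty := by simp [collapseI]
        rw [this, Θ.str_infty]
      target' := by
        have : collapseI 1 = OnePoint.infty := by norm_num [collapseI]
        rw [this, Θ.str_infty] }
  continuous_toFun := Path.continuous_uncurry_iff.1 ((Θ.str n).continuous.comp
    (continuous_fst.prodMk (continuous_collapseI.comp continuous_snd)))

/-- An orthogonal Ω-spectrum: the adjoint structure maps `Θ_n → ΩΘ_{n+1}` are homotopy
equivalences. -/
structure OrthogonalOmegaSpectrum extends OrthogonalSpectrum.{u} where
  omega : ∀ n, ∃ e : ContinuousMap.HomotopyEquiv (space n) (toOrthogonalSpectrum.Loops (n + 1)),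
    e.toFun = toOrthogonalSpectrum.adjoint n

/-! ## Homotopy classes of maps and the generalized cohomology groups -/

/-- The set `[B, Y]` of (free) homotopy classes of continuous maps. -/
def HomotopyClasses (B : Type v) (Y : Type u) [TopologicalSpace B] [TopologicalSpace Y] :
    Type (max v u) :=
  Quotient (⟨ContinuousMap.Homotopic, ContinuousMap.Homotopic.equivalence⟩ : Setoid C(B, Y))

/-- The homotopy class of a map. -/
def HomotopyClasses.mk {B : Type v} {Y : Type u} [TopologicalSpace B] [TopologicalSpace Y]
    (f : C(B, Y)) : HomotopyClasses B Y :=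
  Quotient.mk _ f

/-- Homotopy equivalent targets have the same homotopy classes of maps into them. -/
def HomotopyClasses.congr (B : Type v) {Y : Type u} {Z : Type w} [TopologicalSpace B]
    [TopologicalSpace Y] [TopologicalSpace Z] (f : C(Y, Z))
    (hf : ∃ e : ContinuousMap.HomotopyEquiv Y Z, e.toFun = f) :
    HomotopyClasses B Y ≃ HomotopyClasses B Z :=
  Equiv.ofBijective
    (Quotient.map (fun a => f.comp a) fun _ _ h => (ContinuousMap.Homotopic.refl f).comp h) <| by
    obtain ⟨e, rfl⟩ := hf
    constructor
    · rintro ⟨a⟩ ⟨b⟩ hab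
      have h1 : (e.toFun.comp a).Homotopic (e.toFun.comp b) := Quotient.exact hab
      have h2 := (ContinuousMap.Homotopic.refl e.invFun).comp h1
      exact Quotient.sound (((e.left_inv.comp (ContinuousMap.Homotopic.refl a)).symm.trans h2).trans
        (e.left_inv.comp (ContinuousMap.Homotopic.refl b)))
    · rintro ⟨b⟩
      exact ⟨Quotient.mk _ (e.invFun.comp b),
        Quotient.sound (e.right_inv.comp (ContinuousMap.Homotopic.refl b))⟩

section LoopGroup

variable {B : Type v} {Y : Type u} [TopologicalSpace B] [TopologicalSpace Y] {y : Y}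

/-- The pointwise concatenation of two maps into a loop space. -/
def loopAdd (f g : C(B, Path y y)) : C(B, Path y y) :=
  ⟨fun b => (f b).trans (g b), by fun_prop⟩

/-- The pointwise reversal of a map into a loop space. -/
def loopNeg (f : C(B, Path y y)) : C(B, Path y y) :=
  ⟨fun b => (f b).symm, Path.continuous_symm.comp f.continuous⟩

theorem loop_homotopic_of_reparam (f g g' : C(B, Path y y)) (Φ : I × I → I) (hΦ : Continuous Φ)
    (h0 : ∀ b s, f b (Φ (0, s)) = g b s) (h1 : ∀ b s, f b (Φ (1, s)) = g' b s)
    (hs : ∀ t, Φ (t, 0) = 0) (he : ∀ t, Φ (t, 1) = 0 ∨ Φ (t, 1) = 1) : g.Homotopic g' :=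
  ⟨{ toFun := fun p =>
      { toFun := fun s => f p.2 (Φ (p.1, s))
        continuous_toFun := by fun_prop
        source' := by simp [hs]
        target' := by rcases he p.1 with h | h <;> simp [h] }
     continuous_toFun := Path.continuous_uncurry_iff.1 <| by
      change Continuous fun q : (I × B) × I => f q.1.2 (Φ (q.1.1, q.2))
      fun_prop
     map_zero_left := fun b => Path.ext (funext fun s => h0 b s)
     map_one_left := fun b => Path.ext (funext fun s => h1 b s) }⟩

theorem loop_homotopic_reparam (f g : C(B, Path y y)) (φ : I → I) (hφ : Continuous φ)
    (h0 : φ 0 = 0) (h1 : φ 1 = 1) (h : ∀ b, g b = (f b).reparam φ hφ h0 h1) :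
    g.Homotopic f := by
  refine ContinuousMap.Homotopic.symm (loop_homotopic_of_reparam f f g
    (fun p => ⟨(1 - (p.1 : ℝ)) * p.2 + p.1 * φ p.2, ?_⟩) ?_ ?_ ?_ ?_ ?_)
  · exact (convex_Icc (0 : ℝ) 1) p.2.2 (φ p.2).2 (by linarith [p.1.2.2]) p.1.2.1 (by ring)
  · fun_prop
  · intro b s
    simp
  · intro b s
    simp [h]
  · intro t
    apply Subtype.ext
    simp [h0]
  · intro t
    right
    apply Subtype.ext
    simp [h1]

instance : Add (HomotopyClasses B (Path y y)) where
  add := Quotient.map₂ loopAdd fun f f' ⟨F⟩ g g' ⟨G⟩ =>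
    ⟨{ toFun := fun p => (F p).trans (G p)
       continuous_toFun := by fun_prop
       map_zero_left := fun b => by simp [loopAdd]
       map_one_left := fun b => by simp [loopAdd] }⟩

instance : Zero (HomotopyClasses B (Path y y)) where
  zero := HomotopyClasses.mk (ContinuousMap.const B (Path.refl y))

instance : Neg (HomotopyClasses B (Path y y)) where
  neg := Quotient.map loopNeg fun f f' ⟨F⟩ =>
    ⟨{ toFun := fun p => (F p).symm
       continuous_toFun := Path.continuous_symm.comp F.continuous
       map_zero_left := fun b => by simp [loopNeg]
       map_one_left := fun b => by simp [loopNeg] }⟩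

/-- Homotopy classes of maps into a based loop space form a group under concatenation of loops. -/
instance : AddGroup (HomotopyClasses B (Path y y)) where
  nsmul := nsmulRec
  zsmul := zsmulRec
  add_assoc := by
    rintro ⟨f⟩ ⟨g⟩ ⟨h⟩
    exact Quotient.sound (loop_homotopic_reparam _ _ _ _ _ _
      fun b => Path.Homotopy.trans_assoc_reparam (f b) (g b) (h b))
  add_zero := by
    rintro ⟨f⟩
    exact Quotient.sound (loop_homotopic_reparam _ _ _ _ _ _
      fun b => Path.Homotopy.trans_refl_reparam (f b))
  zero_add := by
    rintro ⟨f⟩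
    refine Quotient.sound (loop_homotopic_reparam _ _
      (fun s => unitInterval.symm ⟨Path.Homotopy.transReflReparamAux (unitInterval.symm s),
        Path.Homotopy.transReflReparamAux_mem_I _⟩) (by fun_prop) ?_ ?_ fun b => ?_)
    · simp [Path.Homotopy.transReflReparamAux_one]
    · simp [Path.Homotopy.transReflReparamAux_zero]
    · have h := congrArg Path.symm (Path.Homotopy.trans_refl_reparam (f b).symm)
      rw [Path.trans_symm, Path.refl_symm, Path.symm_symm] at h
      refine h.trans ?_
      ext s
      simp
  neg_add_cancel := by
    rintro ⟨f⟩
    refine Quotient.sound (ContinuousMap.Homotopic.symm (loop_homotopic_of_reparam (loopNeg f) _ _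
      (fun p => ⟨Path.Homotopy.reflTransSymmAux p, Path.Homotopy.reflTransSymmAux_mem_I p⟩)
      (by fun_prop) ?_ ?_ ?_ ?_))
    · intro b s
      exact (Path.Homotopy.reflTransSymm (f b).symm).apply_zero s
    · intro b s
      refine ((Path.Homotopy.reflTransSymm (f b).symm).apply_one s).trans ?_
      change ((f b).symm.trans (f b).symm.symm) s = ((f b).symm.trans (f b)) s
      rw [Path.symm_symm]
    · intro t
      apply Subtype.ext
      simp [Path.Homotopy.reflTransSymmAux]
    · intro t
      left
      apply Subtype.ext
      norm_num [Path.Homotopy.reflTransSymmAux]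

end LoopGroup

/-- The generalized cohomology `h^q(B) = [B, Θ_q]` of an Ω-spectrum. -/
def OrthogonalOmegaSpectrum.Cohomology (Θ : OrthogonalOmegaSpectrum.{u}) (q : ℕ) (B : Type v)
    [TopologicalSpace B] : Type (max v u) :=
  HomotopyClasses B (Θ.space q)

/-- The group structure of `h^q(B)` is given by concatenation of loops, through the bijection
`[B, Θ_q] ≃ [B, ΩΘ_{q+1}]`. -/
instance (Θ : OrthogonalOmegaSpectrum.{u}) (q : ℕ) (B : Type v) [TopologicalSpace B] :
    AddGroup (Θ.Cohomology q B) :=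
  (HomotopyClasses.congr B (Θ.adjoint q) (Θ.omega q)).addGroup

/-! ## The actions of `O(k)` on `Θ_{q+k}` and on `ΩΘ_{q+k+1}` -/

/-- The space `Θ_{q+k}`, with `O(k)` acting through the inclusion `O(k) → O(q+k)` as the last
block. -/
def OrthogonalSpectrum.Twisted (Θ : OrthogonalSpectrum.{u}) (q k : ℕ) : Type u := Θ.space (q + k)

instance (Θ : OrthogonalSpectrum.{u}) (q k : ℕ) : TopologicalSpace (Θ.Twisted q k) :=
  inferInstanceAs (TopologicalSpace (Θ.space (q + k)))

instance (Θ : OrthogonalSpectrum.{u}) (q k : ℕ) : MulAction (O k) (Θ.Twisted q k) where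
  smul g x := (blockSum q k (1, g) • (show Θ.space (q + k) from x) : Θ.space (q + k))
  one_smul x := by
    change blockSum q k 1 • (show Θ.space (q + k) from x) = x
    rw [map_one, one_smul]
  mul_smul g g' x := by
    change blockSum q k (1, g * g') • (show Θ.space (q + k) from x) =
      blockSum q k (1, g) • blockSum q k (1, g') • (show Θ.space (q + k) from x)
    rw [← mul_smul, ← map_mul, Prod.mk_mul_mk, one_mul]

theorem OrthogonalSpectrum.twisted_smul_def (Θ : OrthogonalSpectrum.{u}) (q k : ℕ) (g : O k)
    (x : Θ.Twisted q k) :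
    g • x = (blockSum q k (1, g) • (show Θ.space (q + k) from x) : Θ.space (q + k)) := rfl

instance (Θ : OrthogonalSpectrum.{u}) (q k : ℕ) : ContinuousSMul (O k) (Θ.Twisted q k) where
  continuous_smul := by
    change Continuous fun p : O k × Θ.space (q + k) => blockSum q k (1, p.1) • p.2
    have h := continuous_blockSum q k
    fun_prop

/-- The loop space `ΩΘ_{q+k+1}`, with `O(k)` acting pointwise on loops, through the inclusions
`O(k) → O(q+k) → O(q+k+1)` (as the last block, and then as the first block). -/
def OrthogonalSpectrum.LoopTwisted (Θ : OrthogonalSpectrum.{u}) (q k : ℕ) : Type u :=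
  Θ.Loops (q + k + 1)

instance (Θ : OrthogonalSpectrum.{u}) (q k : ℕ) : TopologicalSpace (Θ.LoopTwisted q k) :=
  inferInstanceAs (TopologicalSpace (Θ.Loops (q + k + 1)))

instance (Θ : OrthogonalSpectrum.{u}) (q k : ℕ) : MulAction (O k) (Θ.LoopTwisted q k) where
  smul g γ := ({
    toFun := fun t =>
      blockSum (q + k) 1 (blockSum q k (1, g), 1) • (show Θ.Loops (q + k + 1) from γ) t
    continuous_toFun := by fun_prop
    source' := by rw [Path.source, Θ.smul_pt]
    target' := by rw [Path.target, Θ.smul_pt] } : Θ.Loops (q + k + 1))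
  one_smul γ := Path.ext <| funext fun t => by
    change blockSum (q + k) 1 (blockSum q k 1, 1) • (show Θ.Loops (q + k + 1) from γ) t = _
    rw [map_one, ← Prod.one_eq_mk, map_one, one_smul]
  mul_smul g g' γ := Path.ext <| funext fun t => by
    change blockSum (q + k) 1 (blockSum q k (1, g * g'), 1) •
        (show Θ.Loops (q + k + 1) from γ) t =
      blockSum (q + k) 1 (blockSum q k (1, g), 1) •
        blockSum (q + k) 1 (blockSum q k (1, g'), 1) • (show Θ.Loops (q + k + 1) from γ) t
    rw [← mul_smul, ← map_mul, Prod.mk_mul_mk, ← map_mul, Prod.mk_mul_mk, one_mul, one_mul]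

/-! ## Classifying spaces and homotopy quotients -/

/-- The base `BH = EH/H`. -/
abbrev ClassifyingSpace (H : Type v) [Group H] (EH : Type w) [MulAction H EH] : Type w :=
  MulAction.orbitRel.Quotient H EH

/-- `EH → EH/H` is a universal principal `H`-bundle: `EH` is contractible, and the action of `H` is
free and locally trivial over a numerable cover of `EH/H`. Here an equivariant continuous map to `H`
from the preimage of an open set `U` is the same as a trivialization over `U`; its existence forces
the action over `U` to be free. -/
structure IsUniversalBundle (H : Type v) [Group H] [TopologicalSpace H] (EH : Type w)
    [TopologicalSpace EH] [MulAction H EH] : Prop where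
  contractible : ContractibleSpace EH
  numerable : ∃ (ι : Type w) (f : PartitionOfUnity ι (ClassifyingSpace H EH)),
    ∀ i, ∃ τ : EH → H,
      ContinuousOn τ {e | 0 < f i (Quotient.mk _ e)} ∧
      ∀ (h : H) (e : EH), 0 < f i (Quotient.mk _ e) → τ (h • e) = h * τ e

section Bundle

variable {H : Type v} [Group H] {k : ℕ} (ρ : H →* O k) (EH : Type w) [MulAction H EH]

/-- The diagonal action of `H` on `B^k × EH`. -/
def ballSetoid : Setoid (Ball k × EH) where
  r p p' := ∃ h : H, p' = (ρ h • p.1, h • p.2)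
  iseqv := ⟨fun p => ⟨1, by simp⟩,
    fun {p p'} ⟨h, e⟩ => ⟨h⁻¹, by simp [e]⟩,
    fun {p p' p''} ⟨h, e⟩ ⟨h', e'⟩ => ⟨h' * h, by simp [e, e', mul_smul]⟩⟩

/-- The homotopy quotient `B^k//H = (B^k × EH)/H`, where `H` acts on `B^k` through `ρ`. -/
abbrev BallQuotient : Type w := Quotient (ballSetoid ρ EH)

/-- The subspace `∂B^k//H`. -/
def boundary : Set (BallQuotient ρ EH) :=
  {b | ∃ (x : Ball k) (e : EH), ‖x.1‖ = 1 ∧ b = Quotient.mk _ (x, e)}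

/-- The action of `H` on the orthonormal frames `(x, u)` of the tangent bundle `B^k × ℝ^k` of `B^k`,
times `EH`. A frame at `x` is given as the orthogonal map `u : T_x B^k = ℝ^k → ℝ^k` that sends it to
the standard basis; an element `h` moves it by the derivative `ρ h` of its action on `B^k`. -/
def frameSetoid : Setoid (Ball k × O k × EH) where
  r p p' := ∃ h : H, p' = (ρ h • p.1, p.2.1 * (ρ h)⁻¹, h • p.2.2)
  iseqv := ⟨fun p => ⟨1, by simp⟩,
    fun {p p'} ⟨h, e⟩ => ⟨h⁻¹, by simp [e]⟩,
    fun {p p' p''} ⟨h, e⟩ ⟨h', e'⟩ => ⟨h' * h, by simp [e, e', mul_smul, mul_assoc]⟩⟩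

/-- The total space of the orthonormal frame bundle `O(T_H B^k) → B^k//H` of the vector bundle
`T_H B^k = TB^k//H` over `B^k//H`. -/
abbrev FrameBundle : Type w := Quotient (frameSetoid ρ EH)

variable {ρ EH}

/-- The projection `O(T_H B^k) → B^k//H`. -/
def FrameBundle.proj : FrameBundle ρ EH → BallQuotient ρ EH :=
  Quotient.map (fun p => (p.1, p.2.2)) fun p p' ⟨h, e⟩ => ⟨h, by simp [e]⟩

/-- `O(k)` acts on frames `u : T_x B^k → ℝ^k` by composition. -/
instance : MulAction (O k) (FrameBundle ρ EH) where
  smul g := Quotient.map (fun p => (p.1, g * p.2.1, p.2.2))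
    fun p p' ⟨h, e⟩ => ⟨h, by simp [e, mul_assoc]⟩
  one_smul := by
    rintro ⟨p⟩
    exact congrArg (Quotient.mk _) (by simp)
  mul_smul g g' := by
    rintro ⟨p⟩
    exact congrArg (Quotient.mk _) (by simp [mul_assoc])

theorem FrameBundle.proj_smul (g : O k) (p : FrameBundle ρ EH) : (g • p).proj = p.proj := by
  obtain ⟨p⟩ := p
  rfl

variable (ρ EH) (Y : Type u) [MulAction (O k) Y]

/-- The associated state bundle of `T_H B^k` with fibre an `O(k)`-space `Y`. Its fibre over `b` is
`Hom_{O(k)}(O(T_H B^k)_b, Y)`, the space of `O(k)`-equivariant maps from the space of frames at `b`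
to `Y`. -/
structure StateBundle : Type (max u w) where
  base : BallQuotient ρ EH
  state : {p : FrameBundle ρ EH // p.proj = base} → Y
  equivariant : ∀ (g : O k) (p : {p : FrameBundle ρ EH // p.proj = base}),
    state ⟨g • p.1, (FrameBundle.proj_smul g p.1).trans p.2⟩ = g • state p

variable {ρ EH Y} in
theorem StateBundle.ext {a b : StateBundle ρ EH Y} (h : a.base = b.base)
    (h' : ∀ (p : FrameBundle ρ EH) (hp : p.proj = a.base),
      a.state ⟨p, hp⟩ = b.state ⟨p, hp.trans h⟩) : a = b := by
  obtain ⟨a, f, hf⟩ := a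
  obtain ⟨b, g, hg⟩ := b
  obtain rfl : a = b := h
  have : f = g := funext fun p => h' p.1 p.2
  subst this
  rfl

/-- Pairs of a frame and a point of the state bundle over the same point of `B^k//H`. -/
structure FramedState : Type (max u w) where
  frame : FrameBundle ρ EH
  point : StateBundle ρ EH Y
  proj_eq : frame.proj = point.base

variable [TopologicalSpace EH] [TopologicalSpace Y]

/-- A pair of a frame `p` and a state `f` is determined by `p` and `f p`: pulled back to the frame
bundle, the state bundle is the product with `Y`. -/
instance : TopologicalSpace (FramedState ρ EH Y) :=
  .induced (fun z => (z.frame, z.point.state ⟨z.frame, z.proj_eq⟩)) inferInstance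

/-- The topology of the associated bundle: the quotient topology of its pull-back to the frame
bundle. -/
instance : TopologicalSpace (StateBundle ρ EH Y) :=
  .coinduced (fun z : FramedState ρ EH Y => z.point) inferInstance

/-- The continuous sections of the state bundle over `B^k//H`. -/
abbrev StateSection : Type (max u w) :=
  {s : C(BallQuotient ρ EH, StateBundle ρ EH Y) // ∀ b, (s b).base = b}

/-- The continuous sections of the state bundle over `∂B^k//H`. -/
abbrev BoundarySection : Type (max u w) :=
  {s : C(boundary ρ EH, StateBundle ρ EH Y) // ∀ b, (s b).base = b.1}

variable {ρ EH Y}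

/-- The restriction of a section to `∂B^k//H`. -/
def StateSection.restrict (s : StateSection ρ EH Y) : BoundarySection ρ EH Y :=
  ⟨s.1.restrict (boundary ρ EH), fun b => s.2 b.1⟩

/-- The value in `Y` of a section with respect to a frame. -/
def StateSection.value (s : StateSection ρ EH Y) (p : FrameBundle ρ EH) : Y :=
  (s.1 p.proj).state ⟨p, (s.2 p.proj).symm⟩

/-- The sections over `B^k//H` with given restriction to `∂B^k//H`. -/
abbrev Extension (s₀ : BoundarySection ρ EH Y) : Type (max u w) :=
  {s : StateSection ρ EH Y // StateSection.restrict s = s₀}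

/-- Homotopy of sections through sections with the same restriction to `∂B^k//H`. -/
def extensionSetoid (s₀ : BoundarySection ρ EH Y) : Setoid (Extension s₀) where
  r s s' := ContinuousMap.HomotopicWith s.1.1 s'.1.1 fun g => ∃ s'' : Extension s₀, s''.1.1 = g
  iseqv := ⟨fun s => .refl _ ⟨s, rfl⟩, fun h => h.symm, fun h h' => h.trans h'⟩

/-- The set of homotopy classes of sections with fixed restriction to `∂B^k//H`. -/
def ExtensionClasses (s₀ : BoundarySection ρ EH Y) : Type (max u w) :=
  Quotient (extensionSetoid s₀)

/-- The homotopy class of a section with fixed restriction to `∂B^k//H`. -/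
def Extension.toClass {s₀ : BoundarySection ρ EH Y} (s : Extension s₀) : ExtensionClasses s₀ :=
  Quotient.mk _ s

/-! ### Sections from equivariant functions on frames -/

/-- The section of the state bundle given by an `H`-invariant, `O(k)`-equivariant function of a
point of `B^k`, a frame at it, and a point of `EH`. -/
def StateSection.ofFun (F : Ball k × O k × EH → Y) (hF : Continuous F)
    (hH : ∀ (h : H) p, F (ρ h • p.1, p.2.1 * (ρ h)⁻¹, h • p.2.2) = F p)
    (hO : ∀ (g : O k) p, F (p.1, g * p.2.1, p.2.2) = g • F p) : StateSection ρ EH Y :=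
  let F' : FrameBundle ρ EH → Y := Quotient.lift F fun p p' ⟨h, e⟩ => by rw [e]; exact (hH h p).symm
  have hF' : Continuous F' := hF.quotient_lift _
  let s : BallQuotient ρ EH → StateBundle ρ EH Y := fun b =>
    ⟨b, fun p => F' p.1, fun g ⟨p, _⟩ => by obtain ⟨p⟩ := p; exact hO g p⟩
  ⟨⟨s, by
    have h1 : Continuous fun p : FrameBundle ρ EH => s p.proj := by
      have h2 : Continuous fun p : FrameBundle ρ EH =>
          (⟨p, s p.proj, rfl⟩ : FramedState ρ EH Y) :=
        continuous_induced_rng.2 (continuous_id.prodMk hF')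
      have h4 : Continuous fun z : FramedState ρ EH Y => z.point := continuous_coinduced_rng
      exact h4.comp h2
    have h3 : Continuous fun z : Ball k × EH =>
        s (FrameBundle.proj (Quotient.mk (frameSetoid ρ EH) (z.1, 1, z.2))) :=
      h1.comp (continuous_quotient_mk'.comp (by fun_prop))
    exact continuous_coinduced_dom.2 h3⟩, fun _ => rfl⟩

theorem StateSection.value_ofFun (F : Ball k × O k × EH → Y) (hF : Continuous F)
    (hH : ∀ (h : H) p, F (ρ h • p.1, p.2.1 * (ρ h)⁻¹, h • p.2.2) = F p)
    (hO : ∀ (g : O k) p, F (p.1, g * p.2.1, p.2.2) = g • F p) (p : Ball k × O k × EH) :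
    (StateSection.ofFun (ρ := ρ) F hF hH hO).value (Quotient.mk _ p) = F p := rfl

theorem StateSection.restrict_eq {s s' : StateSection ρ EH Y}
    (h : ∀ (x : Ball k) (u : O k) (e : EH), ‖x.1‖ = 1 →
      s.value (Quotient.mk _ (x, u, e)) = s'.value (Quotient.mk _ (x, u, e))) :
    s.restrict = s'.restrict := by
  apply Subtype.ext
  ext1 b
  refine StateBundle.ext ((s.2 b.1).trans (s'.2 b.1).symm) fun p hp => ?_
  have hb : p.proj = b.1 := hp.trans (s.2 b.1)
  obtain ⟨b, x, e, hx, rfl⟩ := b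
  obtain ⟨⟨y, u, e'⟩⟩ := p
  obtain ⟨h', he⟩ := Quotient.exact hb
  have hy : ‖y.1‖ = 1 := by
    have hxy : x = ρ h' • y := (Prod.ext_iff.1 he).1
    rw [hxy, norm_smul_ball] at hx
    exact hx
  have key := h y u e' hy
  simp only [StateSection.value] at key
  have aux : ∀ (t : StateSection ρ EH Y) (c : BallQuotient ρ EH) (p : FrameBundle ρ EH)
      (hc : p.proj = c), (t.1 c).state ⟨p, hc.trans (t.2 c).symm⟩ = t.value p := by
    rintro t c p rfl
    rfl
  exact (aux s _ _ hb).trans (key.trans (aux s' _ _ hb).symm)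

end Bundle

/-! ## Constant sections, the Thom map, and the action -/

section Thom

variable (Θ : OrthogonalSpectrum.{u}) {H : Type v} [Group H] {k : ℕ} (ρ : H →* O k)
  (EH : Type w) [MulAction H EH] [TopologicalSpace EH] (q : ℕ)

/-- The constant section of the state bundle with fibre `Θ_{q+k}` at an `H`-fixed point `θ`. -/
def constSection (θ : Θ.Twisted q k) (hθ : ∀ h, ρ h • θ = θ) :
    StateSection ρ EH (Θ.Twisted q k) :=
  .ofFun (fun p => p.2.1 • θ) (by fun_prop)
    (fun h p => by
      rw [mul_smul, inv_smul_eq_iff.2 (hθ h).symm])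
    (fun g p => mul_smul g p.2.1 θ)

theorem twisted_smul_pt (g : O k) :
    g • (show Θ.Twisted q k from Θ.pt (q + k)) = Θ.pt (q + k) :=
  Θ.smul_pt (q + k) _

/-- The constant section at the base point. -/
def vacuumSection : StateSection ρ EH (Θ.Twisted q k) :=
  constSection Θ ρ EH q (Θ.pt (q + k)) fun h => twisted_smul_pt Θ q (ρ h)

theorem sphereMap_smul (x : Θ.space q) (g : O k) (y : Ball k) :
    Θ.sphereMap q k x (collapse k (g • y)) =
      g • (show Θ.Twisted q k from Θ.sphereMap q k x (collapse k y)) := by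
  by_cases h : ‖y.1‖ < 1
  · have h' : ‖(g • y).1‖ < 1 := by rwa [norm_smul_ball]
    rw [collapse, collapse, if_pos h, if_pos h', norm_smul_ball]
    have := Θ.iter_smul q k 1 g x (((1 - ‖y.1‖)⁻¹ • y.1 : EuclideanSpace ℝ (Fin k))).ofLp
    rw [one_smul] at this
    refine Eq.trans ?_ this
    change iter _ q k x _ = iter _ q k x _
    congr 1
    funext i
    rw [coe_smul_ball, WithLp.ofLp_smul, WithLp.ofLp_smul, Matrix.mulVec_smul]
  · have h' : ¬ ‖(g • y).1‖ < 1 := by rwa [norm_smul_ball]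
    rw [collapse, collapse, if_neg h, if_neg h']
    exact (twisted_smul_pt Θ q g).symm

/-- The function `(x, u, e) ↦ u • (a[e] ∧ x)`, where `x` is read in `B^k/∂B^k ≅ S^k`. -/
def thomFun (a : C(ClassifyingSpace H EH, Θ.space q)) (p : Ball k × O k × EH) : Θ.Twisted q k :=
  p.2.1 • (show Θ.Twisted q k from Θ.sphereMap q k (a (Quotient.mk _ p.2.2)) (collapse k p.1))

theorem continuous_thomFun (a : C(ClassifyingSpace H EH, Θ.space q)) :
    Continuous (thomFun Θ (k := k) EH q a) := by
  have h0 : Continuous fun e : EH => (Quotient.mk _ e : ClassifyingSpace H EH) :=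
    continuous_quotient_mk'
  have h1 : Continuous fun p : Ball k × O k × EH =>
      (a (Quotient.mk _ p.2.2 : ClassifyingSpace H EH), p.1) :=
    (a.continuous.comp (h0.comp (continuous_snd.comp continuous_snd))).prodMk continuous_fst
  have h2 := (continuous_sphereMap_collapse Θ q k).comp h1
  exact Continuous.smul (M := O k) (X := Θ.Twisted q k)
    (continuous_fst.comp continuous_snd) h2

/-- The Thom map: a map `a : BH → Θ_q` goes to the section of the state bundle over `B^k//H` with
fibre `Θ_{q+k}` whose value at `[x, e]`, in the standard frame at `x`, is `a[e] ∧ x`, where `x` is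
read in `B^k/∂B^k ≅ S^k`. It is the base point over `∂B^k//H`. -/
def thomSection (a : C(ClassifyingSpace H EH, Θ.space q)) : StateSection ρ EH (Θ.Twisted q k) :=
  .ofFun (thomFun Θ EH q a) (continuous_thomFun Θ EH q a)
    (fun h p => by
      have h1 : (Quotient.mk _ (h • p.2.2) : ClassifyingSpace H EH) = Quotient.mk _ p.2.2 :=
        Quotient.sound ⟨h, rfl⟩
      simp only [thomFun]
      rw [h1, sphereMap_smul, mul_smul, inv_smul_smul])
    (fun g p => mul_smul _ _ _)

/-- The constant section, as an extension of its restriction to `∂B^k//H`. -/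
def constExtension (θ : Θ.Twisted q k) (hθ : ∀ h, ρ h • θ = θ) :
    Extension (constSection Θ ρ EH q θ hθ).restrict :=
  ⟨constSection Θ ρ EH q θ hθ, rfl⟩

/-- The vacuum section, as an extension of its restriction to `∂B^k//H`. -/
def vacuumExtension : Extension (vacuumSection Θ ρ EH q).restrict :=
  ⟨vacuumSection Θ ρ EH q, rfl⟩

theorem restrict_thomSection (a : C(ClassifyingSpace H EH, Θ.space q)) :
    (thomSection Θ ρ EH q a).restrict = (vacuumSection Θ ρ EH q).restrict := by
  refine StateSection.restrict_eq fun x u e hx => ?_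
  change u • (show Θ.Twisted q k from Θ.sphereMap q k _ (collapse k x)) =
    u • (show Θ.Twisted q k from Θ.pt (q + k))
  rw [collapse, if_neg hx.not_lt]
  rfl

/-- The Thom section of `a`, as an extension of the vacuum over `∂B^k//H`. -/
def thomExtension (a : C(ClassifyingSpace H EH, Θ.space q)) :
    Extension (vacuumSection Θ ρ EH q).restrict :=
  ⟨thomSection Θ ρ EH q a, restrict_thomSection Θ ρ EH q a⟩

variable {Θ ρ EH q}

/-- The section `s'` is a loop sum `α + s`, where `α` is a section that is the base point over
`∂B^k//H`, and `s` and `s'` have the same restriction to `∂B^k//H`: after `Θ_{q+k} → ΩΘ_{q+k+1}` is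
applied fibrewise, the fibrewise concatenation of the loops of `α` and `s` is homotopic to the loops
of `s'`, through sections of the state bundle with fibre `ΩΘ_{q+k+1}`. Over `∂B^k//H`, where
the concatenation is that of a constant loop and the loop `γ` of `s`, the homotopy is the standard
one from `const * γ` to `γ`. -/
def IsLoopSum (α s s' : StateSection ρ EH (Θ.Twisted q k)) : Prop :=
  ∃ K : I → StateSection ρ EH (Θ.LoopTwisted q k),
    Continuous (fun z : I × BallQuotient ρ EH => (K z.1).1 z.2) ∧
    (∀ p, (K 0).value p =
      (Θ.adjoint (q + k) (α.value p)).trans (Θ.adjoint (q + k) (s.value p))) ∧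
    (∀ p, (K 1).value p = Θ.adjoint (q + k) (s'.value p)) ∧
    ∀ t p, p.proj ∈ boundary ρ EH → (K t).value p =
      (Path.Homotopy.reflTrans (Θ.adjoint (q + k) (s.value p))).eval t

end Thom

end ThomTorsor

end

open ThomTorsor

/-!
# Sections of a state bundle over a disk bundle form a torsor

In the standard frame, a section of the state bundle over `B^k//H` is an `H`-equivariant map
`B^k × EH → Y` (`StateSection.continuous_std`), and homotopies relative to the boundary become
equivariant homotopies relative to `∂B^k × EH`. The argument takes place among such maps.

The adjoint structure map `η` is a homotopy equivalence, but not an equivariant one, so it need not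
have an equivariant inverse `Z → Y`. It does have one that is parametrized by `EH`
(`nonempty_equivariantInverse`): the mapping path space of `η` contracts, over `Z`, to a section
(`MappingPathSpace.exists_contraction`), and over a numerable principal bundle such contractions can
be made equivariant by a partition of unity (`IsNumerable.exists_equivariant_contraction`).
Consequently sections of the loop state bundle lift through `η`, relative to the boundary
(`EquivariantInverse.exists_lift`), and `η` detects homotopy of sections
(`EquivariantInverse.relHomotopic_of_comp`).

The loops over the boundary are not constant, and homotopies of loop sections have to follow there
a prescribed reparametrization of `η s₀`. This is recorded by a label, a path of loop parameters in
the unit interval: over the boundary, a loop section with label `φ` is `η s₀` composed with `φ`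
(`LoopHomotopic`). Since the unit interval is convex, only the ends of a homotopy of labels matter
(`LoopHomotopic.exists_relabel`), and the group laws of loops hold for labelled loop sections. So two sections
with the same boundary values have a difference, unique up to homotopy, which is a section that is
the vacuum over the boundary (`EquivariantInverse.exists_difference`,
`EquivariantInverse.difference_unique`).

It remains to identify the classes of sections with vacuum boundary values with `[BH, Θ_q]`.
Without group action, the Thom map `Θ_q → Map((B^k, ∂B^k), (Θ_{q+k}, pt))` is a homotopy equivalence
by induction on `k`, because `S^{k+1}` is a quotient both of the ball `B^{k+1}` and of the cylinder
`B^k × [0,1]` (`exists_relHomotopic_thomMap`, `homotopic_of_relHomotopic_thomMap`,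
`exists_homotopyEquiv_thomFamily`). It is `O(k)`-equivariant for the trivial action on `Θ_q`, and
its equivariant inverse over `EH` gives the identification (`EquivariantInverse.exists_thomStd`,
`EquivariantInverse.homotopic_of_thomStd`). It is additive (`loopSum_thomStd`): smashing a loop in
`Θ_{q+1}` with a point of the sphere `S^k` puts the loop coordinate before the sphere coordinates,
and an element of `O(q+k+1)` moves it to the end.
-/

noncomputable section

namespace ThomTorsor

/-! ### The mapping path space of a homotopy equivalence -/

section MappingPathSpace

variable {A : Type*} {Y : Type u} {Z : Type v} [TopologicalSpace A] [TopologicalSpace Y]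
  [TopologicalSpace Z]

theorem continuous_splice {r : A → I} {β ω : A → C(I, Z)} (hr : Continuous r) (hβ : Continuous β)
    (hω : Continuous ω) (h : ∀ a, β a (r a) = ω a 0) :
    Continuous fun z : A × I => if (z.2 : ℝ) ≤ r z.1 / 2
      then β z.1 (Set.projIcc 0 1 zero_le_one (2 * z.2))
      else ω z.1 (Set.projIcc 0 1 zero_le_one ((z.2 - r z.1 / 2) / (1 - r z.1 / 2))) := by
  have hd : ∀ z : A × I, 1 - (r z.1 : ℝ) / 2 ≠ 0 := fun z => by
    have := (r z.1).2.2
    linarith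
  refine Continuous.if_le ?_ ?_ (by fun_prop) (by fun_prop) ?_
  · fun_prop
  · have : Continuous fun z : A × I => ((z.2 : ℝ) - r z.1 / 2) / (1 - r z.1 / 2) :=
      Continuous.div (by fun_prop) (by fun_prop) hd
    fun_prop
  · intro z hz
    have h1 : 2 * (z.2 : ℝ) = r z.1 := by linarith
    rw [h1, hz, sub_self, zero_div, Set.projIcc_val, h]
    congr 1
    exact (Set.projIcc_left zero_le_one).symm

/-- The path that runs through the initial piece `β|[0,r]`, and then through `ω`. The piece takes
the time `r / 2`, so that for `r = 0` the result is `ω` itself. -/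
def splice (r : A → I) (β ω : A → C(I, Z)) (hr : Continuous r) (hβ : Continuous β)
    (hω : Continuous ω) (h : ∀ a, β a (r a) = ω a 0) : C(A, C(I, Z)) :=
  ContinuousMap.curry ⟨_, continuous_splice hr hβ hω h⟩

variable {r : A → I} {β ω : A → C(I, Z)} (hr : Continuous r) (hβ : Continuous β)
    (hω : Continuous ω) (h : ∀ a, β a (r a) = ω a 0)

theorem splice_apply (a : A) (s : I) : splice r β ω hr hβ hω h a s = if (s : ℝ) ≤ r a / 2
      then β a (Set.projIcc 0 1 zero_le_one (2 * s))
      else ω a (Set.projIcc 0 1 zero_le_one ((s - r a / 2) / (1 - r a / 2))) := rfl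

theorem splice_zero (a : A) : splice r β ω hr hβ hω h a 0 = β a 0 := by
  rw [splice_apply, if_pos]
  · simp
  · exact div_nonneg (r a).2.1 zero_le_two

theorem splice_one (a : A) : splice r β ω hr hβ hω h a 1 = ω a 1 := by
  have := (r a).2.2
  rw [splice_apply, if_neg, Set.Icc.coe_one, div_self (by linarith), Set.projIcc_right]
  · rfl
  · simp only [Set.Icc.coe_one]; linarith

theorem splice_eq_of_zero (a : A) (ha : r a = 0) : splice r β ω hr hβ hω h a = ω a := by
  ext s
  rw [splice_apply]
  simp only [ha, Set.Icc.coe_zero, zero_div, sub_zero, div_one, Set.projIcc_val]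
  split_ifs with hs
  · have : s = 0 := le_antisymm hs s.2.1
    subst this
    have := h a
    rw [ha] at this
    simpa using this
  · rfl

/-- The mapping path space of `η : Y → Z`: a point `y` of `Y`, and a path in `Z` that ends at
`η y`. It is fibred over `Z` by the starting point of the path. -/
abbrev MappingPathSpace (η : C(Y, Z)) : Type (max u v) :=
  {n : Y × C(I, Z) // n.2 1 = η n.1}

namespace MappingPathSpace

variable {η : C(Y, Z)}

/-- The projection of the mapping path space to `Z`. -/
def start (η : C(Y, Z)) : C(MappingPathSpace η, Z) :=
  ⟨fun n => n.1.2 0, by fun_prop⟩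

/-- The inclusion of `Y` as the constant paths. -/
def const (η : C(Y, Z)) : C(Y, MappingPathSpace η) :=
  ⟨fun y => ⟨(y, ContinuousMap.const I (η y)), rfl⟩, by
    refine Continuous.subtype_mk (continuous_id.prodMk ?_) _
    exact ContinuousMap.continuous_const'.comp η.continuous⟩

/-- The projection of the mapping path space to `Y`. -/
def point (η : C(Y, Z)) : C(MappingPathSpace η, Y) :=
  ⟨fun n => n.1.1, by fun_prop⟩

theorem homotopic_const_comp_point :
    (ContinuousMap.id (MappingPathSpace η)).Homotopic ((const η).comp (point η)) :=
  ⟨{ toFun := fun z => ⟨(z.2.1.1, ContinuousMap.curry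
        ⟨fun w : (I × MappingPathSpace η) × I => w.1.2.1.2 (max w.2 w.1.1), by fun_prop⟩ z), by
          have : max (1 : I) z.1 = 1 := max_eq_left z.1.2.2
          simpa [this] using z.2.2⟩
     continuous_toFun := by fun_prop
     map_zero_left := fun n => Subtype.ext (Prod.ext rfl (by
        ext s
        simp))
     map_one_left := fun n => Subtype.ext (Prod.ext rfl (by
        ext s
        have : max s (1 : I) = 1 := max_eq_right s.2.2
        simpa [this, const, point] using n.2)) }⟩

/-- For a homotopy equivalence, the projection of the mapping path space to `Z` has a section that
is also a homotopy inverse. -/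
theorem exists_section_homotopic (hη : ∃ e : ContinuousMap.HomotopyEquiv Y Z, e.toFun = η) :
    ∃ j : C(Z, MappingPathSpace η), (∀ z, start η (j z) = z) ∧
      (ContinuousMap.id (MappingPathSpace η)).Homotopic (j.comp (start η)) := by
  obtain ⟨e, rfl⟩ := hη
  set g := e.invFun with hg
  obtain ⟨ε⟩ : (ContinuousMap.id Z).Homotopic (e.toFun.comp g) := e.right_inv.symm
  have hl : (ContinuousMap.id Y).Homotopic (g.comp e.toFun) := e.left_inv.symm
  generalize e.toFun = η at *
  let j : C(Z, MappingPathSpace η) := ⟨fun z => ⟨(g z, ContinuousMap.curry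
      ⟨fun w : Z × I => ε (w.2, w.1), by fun_prop⟩ z), by simp⟩, by fun_prop⟩
  refine ⟨j, fun z => by simp [j, start], ?_⟩
  have h1 := homotopic_const_comp_point (η := η)
  have h2 : ((const η).comp (point η)).Homotopic
      ((const η).comp ((g.comp η).comp (point η))) :=
    (ContinuousMap.Homotopic.refl (const η)).comp
      (hl.comp (ContinuousMap.Homotopic.refl (point η)))
  have h3 : (η.comp (point η)).Homotopic (start η) :=
    ⟨{ toFun := fun z => z.2.1.2 (unitInterval.symm z.1)
       continuous_toFun := by fun_prop
       map_zero_left := fun n => by simpa [point] using n.2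
       map_one_left := fun n => by simp [start] }⟩
  have h4 : ((const η).comp ((g.comp η).comp (point η))).Homotopic
      ((const η).comp (g.comp (start η))) :=
    (ContinuousMap.Homotopic.refl (const η)).comp ((ContinuousMap.Homotopic.refl g).comp h3)
  have h5 : ((const η).comp (g.comp (start η))).Homotopic (j.comp (start η)) :=
    (h1.comp (ContinuousMap.Homotopic.refl (j.comp (start η)))).symm
  exact ((h1.trans h2).trans h4).trans h5

/-- A homotopy `G` of maps from the mapping path space to itself, whose projection to `Z` follows
given paths `β n` from the projection of `n`, is transported back along these paths to a homotopy
of maps over `Z`. -/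
def transport (β : C(MappingPathSpace η, C(I, Z)))
    (G : C(I × MappingPathSpace η, MappingPathSpace η))
    (hG : ∀ z, start η (G z) = β z.2 z.1) : C(I × MappingPathSpace η, MappingPathSpace η) :=
  ⟨fun z => ⟨((G z).1.1, splice (fun z : I × MappingPathSpace η => z.1) (fun z => β z.2)
      (fun z => (G z).1.2) (by fun_prop) (by fun_prop) (by fun_prop) (fun z => (hG z).symm) z),
      (splice_one _ _ _ _ z).trans (G z).2⟩, by fun_prop⟩

theorem transport_zero (β : C(MappingPathSpace η, C(I, Z)))
    (G : C(I × MappingPathSpace η, MappingPathSpace η))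
    (hG : ∀ z, start η (G z) = β z.2 z.1) (n : MappingPathSpace η) :
    transport β G hG (0, n) = G (0, n) :=
  Subtype.ext (Prod.ext rfl (splice_eq_of_zero _ _ _ _ _ rfl))

theorem start_transport (β : C(MappingPathSpace η, C(I, Z)))
    (G : C(I × MappingPathSpace η, MappingPathSpace η))
    (hG : ∀ z, start η (G z) = β z.2 z.1) (z : I × MappingPathSpace η) :
    start η (transport β G hG z) = β z.2 0 :=
  splice_zero (r := fun z : I × MappingPathSpace η => z.1) (β := fun z => β z.2)
    (ω := fun z => (G z).1.2) (by fun_prop) (by fun_prop) (by fun_prop) (fun z => (hG z).symm) z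

theorem transport_congr (β : C(MappingPathSpace η, C(I, Z)))
    {G G' : C(I × MappingPathSpace η, MappingPathSpace η)}
    (hG : ∀ z, start η (G z) = β z.2 z.1) (hG' : ∀ z, start η (G' z) = β z.2 z.1)
    {z : I × MappingPathSpace η} (h : G z = G' z) : transport β G hG z = transport β G' hG' z := by
  refine Subtype.ext (Prod.ext (by simp [transport, h]) ?_)
  ext s
  have key : ∀ g g' : MappingPathSpace η, g = g' →
      (if (s : ℝ) ≤ z.1 / 2 then β z.2 (Set.projIcc 0 1 zero_le_one (2 * s))
        else g.1.2 (Set.projIcc 0 1 zero_le_one ((s - z.1 / 2) / (1 - z.1 / 2)))) =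
      if (s : ℝ) ≤ z.1 / 2 then β z.2 (Set.projIcc 0 1 zero_le_one (2 * s))
        else g'.1.2 (Set.projIcc 0 1 zero_le_one ((s - z.1 / 2) / (1 - z.1 / 2))) := by
    rintro g g' rfl
    rfl
  exact key _ _ h

/-- The mapping path space of a homotopy equivalence contracts to a section through maps
over `Z`. -/
theorem exists_contraction (hη : ∃ e : ContinuousMap.HomotopyEquiv Y Z, e.toFun = η) :
    ∃ (j : C(Z, MappingPathSpace η)) (F : C(I × MappingPathSpace η, MappingPathSpace η)),
      (∀ z, start η (j z) = z) ∧ (∀ n, F (0, n) = n) ∧ (∀ n, F (1, n) = j (start η n)) ∧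
      ∀ t n, start η (F (t, n)) = start η n := by
  obtain ⟨j, hj, ⟨F⟩⟩ := exists_section_homotopic hη
  -- the track of `n` under the homotopy `F`, projected to `Z`
  let β : C(MappingPathSpace η, C(I, Z)) :=
    ContinuousMap.curry ⟨fun w : MappingPathSpace η × I => start η (F (w.2, w.1)), by fun_prop⟩
  have hβ0 : ∀ n, β n 0 = start η n := fun n => by simp [β]
  have hβ1 : ∀ n, β n 1 = start η n := fun n => by simp [β, hj]
  let G : C(I × MappingPathSpace η, MappingPathSpace η) :=
    ⟨fun z => j (β z.2 z.1), by fun_prop⟩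
  have hF : ∀ z, start η (F.toContinuousMap z) = β z.2 z.1 := fun z => rfl
  have hG : ∀ z, start η (G z) = β z.2 z.1 := fun z => hj _
  have h1 : ∀ n, transport β F.toContinuousMap hF (1, n) = transport β G hG (1, n) := fun n =>
    transport_congr β hF hG (by simp [G, hβ1])
  -- The tracks of `F` and of `j ∘ β` transport to vertical homotopies with the same end.
  let P : C(MappingPathSpace η, MappingPathSpace η) → Prop :=
    fun f => ∀ n, start η (f n) = start η n
  let f₁ : C(MappingPathSpace η, MappingPathSpace η) :=
    ⟨fun n => transport β G hG (1, n), by fun_prop⟩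
  have hA : ContinuousMap.HomotopicWith (ContinuousMap.id _) f₁ P :=
    ⟨{ toContinuousMap := transport β F.toContinuousMap hF
       map_zero_left := fun n => by
        simpa using transport_zero β F.toContinuousMap hF n
       map_one_left := fun n => h1 n
       prop' := fun t n => by
        simpa [hβ0] using start_transport β F.toContinuousMap hF (t, n) }⟩
  have hB : ContinuousMap.HomotopicWith (j.comp (start η)) f₁ P :=
    ⟨{ toContinuousMap := transport β G hG
       map_zero_left := fun n => by
        simpa [G, hβ0] using transport_zero β G hG n
       map_one_left := fun n => rfl
       prop' := fun t n => by
        simpa [hβ0] using start_transport β G hG (t, n) }⟩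
  obtain ⟨C⟩ := hA.trans hB.symm
  exact ⟨j, C.toContinuousMap, hj, C.map_zero_left, C.map_one_left, fun t n => C.prop t n⟩

end MappingPathSpace

end MappingPathSpace

/-! ### Equivariant contractions over a numerable principal bundle -/

section Numerable

variable (H : Type v) [Group H] [TopologicalSpace H] (EH : Type w) [TopologicalSpace EH]
  [MulAction H EH]

/-- The action of `H` on `EH` is free and locally trivial over a numerable cover of `EH/H`: the
local triviality part of `IsUniversalBundle`. -/
def IsNumerable : Prop :=
  ∃ (ι : Type w) (f : PartitionOfUnity ι (ClassifyingSpace H EH)),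
    ∀ i, ∃ τ : EH → H,
      ContinuousOn τ {e | 0 < f i (Quotient.mk _ e)} ∧
      ∀ (h : H) (e : EH), 0 < f i (Quotient.mk _ e) → τ (h • e) = h * τ e

variable {H EH}

/-- Invariant functions `s i` on `EH` with values in `[0,1]` and locally finite supports, such that
at every point some `s i` is equal to `1`, and trivializations `τ i` near the support of `s i`. -/
theorem IsNumerable.exists_plateau (hE : IsNumerable H EH) :
    ∃ (ι : Type w) (s : ι → C(EH, I)) (τ : ι → EH → H),
      (∀ i (h : H) e, s i (h • e) = s i e) ∧
      LocallyFinite (fun i => {e | s i e ≠ 0}) ∧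
      (∀ e, ∃ i, s i e = 1) ∧
      (∀ i e, ContinuousAt (τ i) e ∨ ∀ᶠ e' in 𝓝 e, s i e' = 0) ∧
      ∀ i (h : H) e, s i e ≠ 0 → τ i (h • e) = h * τ i e := by
  obtain ⟨ι, f, hf⟩ := hE
  choose τ hτ hτ' using hf
  have hq : Continuous fun e : EH => (Quotient.mk _ e : ClassifyingSpace H EH) :=
    continuous_quotient_mk'
  -- `M` is positive, and at most the largest of the values `f i`
  let M : ClassifyingSpace H EH → ℝ := fun b => ∑ᶠ i, (f i b) ^ 2
  have hMc : Continuous M := by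
    refine continuous_finsum (fun i => by fun_prop) ?_
    refine f.locallyFinite.subset fun i b hb => ?_
    simpa using hb
  have hM : ∀ b, M b = ∑ i ∈ f.finsupport b, (f i b) ^ 2 := fun b => by
    refine finsum_eq_sum_of_support_subset _ fun i hi => ?_
    rw [PartitionOfUnity.coe_finsupport]
    simpa using hi
  have hsum : ∀ b, ∑ i ∈ f.finsupport b, f i b = 1 := fun b => f.sum_finsupport (Set.mem_univ b)
  have hpos : ∀ b, ∃ i ∈ f.finsupport b, 0 < f i b := fun b => by
    by_contra! hcon
    have := Finset.sum_nonpos hcon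
    rw [hsum] at this
    linarith
  have hM0 : ∀ b, 0 < M b := fun b => by
    obtain ⟨i, hi, hib⟩ := hpos b
    rw [hM]
    exact Finset.sum_pos' (fun _ _ => sq_nonneg _) ⟨i, hi, by positivity⟩
  have hMle : ∀ b, ∃ i, M b ≤ f i b := fun b => by
    by_contra! hcon
    obtain ⟨i, hi, hib⟩ := hpos b
    have h1 : ∑ i ∈ f.finsupport b, (f i b) ^ 2 < ∑ i ∈ f.finsupport b, M b * f i b := by
      refine Finset.sum_lt_sum (fun j _ => ?_) ⟨i, hi, ?_⟩
      · rw [pow_two]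
        exact mul_le_mul_of_nonneg_right (hcon j).le (f.nonneg j b)
      · rw [pow_two]
        exact mul_lt_mul_of_pos_right (hcon i) hib
    rw [← hM, ← Finset.mul_sum, hsum, mul_one] at h1
    exact lt_irrefl _ h1
  let s : ι → C(EH, I) := fun i =>
    ⟨fun e => Set.projIcc 0 1 zero_le_one (2 * f i (Quotient.mk _ e) / M (Quotient.mk _ e) - 1), by
      refine continuous_projIcc.comp (Continuous.sub (Continuous.div ?_ (hMc.comp hq)
        fun e => (hM0 _).ne') continuous_const)
      exact continuous_const.mul ((f i).continuous.comp hq)⟩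
  have hs0 : ∀ i e, 2 * f i (Quotient.mk _ e) ≤ M (Quotient.mk _ e) → s i e = 0 := fun i e h => by
    refine Set.projIcc_of_le_left zero_le_one ?_
    rw [sub_nonpos, div_le_one (hM0 _)]
    exact h
  have hpos' : ∀ i e, s i e ≠ 0 → 0 < f i (Quotient.mk _ e) := fun i e h => by
    by_contra! hcon
    exact h (hs0 i e (by linarith [hM0 (Quotient.mk _ e)]))
  refine ⟨ι, s, τ, fun i h e => ?_, ?_, fun e => ?_, fun i e => ?_, fun i h e he =>
    hτ' i h e (hpos' i e he)⟩
  · have : (Quotient.mk _ (h • e) : ClassifyingSpace H EH) = Quotient.mk _ e :=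
      Quotient.sound ⟨h, rfl⟩
    simp only [s, ContinuousMap.coe_mk, this]
  · exact (f.locallyFinite.preimage_continuous hq).subset fun i e he => (hpos' i e he).ne'
  · obtain ⟨i, hi⟩ := hMle (Quotient.mk _ e)
    refine ⟨i, Set.projIcc_of_right_le zero_le_one ?_⟩
    rw [le_sub_iff_add_le, le_div_iff₀ (hM0 _)]
    linarith
  · rcases lt_or_ge 0 (f i (Quotient.mk _ e)) with h | h
    · left
      refine (hτ i).continuousAt (IsOpen.mem_nhds ?_ h)
      exact isOpen_lt continuous_const ((f i).continuous.comp hq)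
    · right
      have : ∀ᶠ e' in 𝓝 e, 2 * f i (Quotient.mk _ e') < M (Quotient.mk _ e') := by
        refine ContinuousAt.eventually_lt (f := fun e' => 2 * f i (Quotient.mk _ e'))
          (g := fun e' => M (Quotient.mk _ e')) ?_ ?_ ?_
        · exact (continuous_const.mul ((f i).continuous.comp hq)).continuousAt
        · exact (hMc.comp hq).continuousAt
        · have h0 := hM0 (Quotient.mk _ e)
          linarith
      exact this.mono fun e' he' => hs0 i e' he'.le

theorem List.foldr_sort_eq {ι : Type*} [LinearOrder ι] {N : Type*} (g : ι → N → N)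
    {S S' : Finset ι} (hS : S ⊆ S') (hg : ∀ i ∈ S', i ∉ S → ∀ n, g i n = n) (n : N) :
    (S.sort).foldr g n = (S'.sort).foldr g n := by
  classical
  have h1 : S.sort = S'.sort.filter (fun i => i ∈ S) := by
    refine List.Perm.eq_of_pairwise (le := (· ≤ ·)) (fun a b _ _ h h' => le_antisymm h h')
      (S.pairwise_sort _) ((S'.pairwise_sort _).filter _) ?_
    refine (List.perm_ext_iff_of_nodup (S.sort_nodup _) ((S'.sort_nodup _).filter _)).2 fun a => ?_
    simp only [Finset.mem_sort, List.mem_filter, decide_eq_true_eq]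
    exact ⟨fun h => ⟨hS h, h⟩, fun h => h.2⟩
  rw [h1, List.foldr_filter]
  refine List.foldr_ext _ _ _ fun i hi m => ?_
  by_cases h : i ∈ S
  · simp [h]
  · simp [h, hg i (by simpa using hi) h m]

variable {G : Type*} [Group G] [TopologicalSpace G] [IsTopologicalGroup G] {ρ : H →* G}
  {N : Type*} [TopologicalSpace N] [MulAction G N] [ContinuousSMul G N] {Z : Type*} [MulAction G Z]

/-- Dold's theorem in equivariant form. Suppose that `p : N → Z` is equivariant, and that `N`
contracts over `Z` to a section of `p`, not necessarily equivariantly. Then there is an equivariant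
family of such contractions that is parametrized by `EH`. Near a point of `EH` it is the
composition, in a fixed order, of the given contraction in finitely many local trivializations, each
carried out only as far as a cut-off function tells. -/
theorem IsNumerable.exists_equivariant_contraction (hE : IsNumerable H EH) (hρ : Continuous ρ)
    {p : N → Z} (hp : ∀ (g : G) n, p (g • n) = g • p n) (j : Z → N) (C : C(I × N, N))
    (h0 : ∀ n, C (0, n) = n) (h1 : ∀ n, C (1, n) = j (p n)) (hC : ∀ t n, p (C (t, n)) = p n) :
    ∃ F : I → EH → N → N, (Continuous fun z : I × EH × N => F z.1 z.2.1 z.2.2) ∧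
      (∀ e n, F 0 e n = n) ∧ (∀ e n n', p n = p n' → F 1 e n = F 1 e n') ∧
      (∀ t e n, p (F t e n) = p n) ∧
      ∀ t (h : H) e n, F t (h • e) (ρ h • n) = ρ h • F t e n := by
  classical
  obtain ⟨ι, s, τ, hinv, hfin, hone, hcont, hτ⟩ := hE.exists_plateau
  let _ : LinearOrder ι := linearOrderOfSTO WellOrderingRel
  let step : I → EH → ι → N → N := fun t e i n =>
    ρ (τ i e) • C (t * s i e, (ρ (τ i e))⁻¹ • n)
  have step_id : ∀ t e i n, t * s i e = 0 → step t e i n = n := fun t e i n h => by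
    simp only [step, h, h0, smul_inv_smul]
  have step_cont : ∀ i, Continuous fun z : I × EH × N => step z.1 z.2.1 i z.2.2 := fun i => by
    rw [continuous_iff_continuousAt]
    rintro ⟨t, e, n⟩
    rcases hcont i e with h | h
    · have hτc : ContinuousAt (fun z : I × EH × N => ρ (τ i z.2.1)) (t, e, n) :=
        (hρ.continuousAt).comp (ContinuousAt.comp (f := fun z : I × EH × N => z.2.1) h
          (by fun_prop))
      refine hτc.smul (C.continuous.continuousAt.comp (ContinuousAt.prodMk (by fun_prop) ?_))
      exact hτc.inv.smul (by fun_prop)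
    · have h' : ∀ᶠ z : I × EH × N in 𝓝 (t, e, n), s i z.2.1 = 0 :=
        (Continuous.tendsto (f := fun z : I × EH × N => z.2.1) (by fun_prop) (t, e, n)).eventually h
      have h2 : ContinuousAt (fun z : I × EH × N => z.2.2) (t, e, n) := by fun_prop
      refine h2.congr (h'.mono fun z hz => (step_id _ _ _ _ ?_).symm)
      rw [hz, mul_zero]
  have fold_cont : ∀ l : List ι,
      Continuous fun z : I × EH × N => l.foldr (step z.1 z.2.1) z.2.2 := fun l => by
    induction l with
    | nil => exact continuous_snd.snd
    | cons i l ih =>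
      exact (step_cont i).comp (continuous_fst.prodMk (continuous_snd.fst.prodMk ih))
  have step_p : ∀ t e i n, p (step t e i n) = p n := fun t e i n => by
    simp only [step, hp, hC, smul_inv_smul]
  have fold_p : ∀ t e (l : List ι) n, p (l.foldr (step t e) n) = p n := fun t e l n => by
    induction l with
    | nil => rfl
    | cons i l ih => exact (step_p _ _ _ _).trans ih
  have hS : ∀ e, {i | s i e ≠ 0}.Finite := fun e => hfin.point_finite e
  let F : I → EH → N → N := fun t e n => (hS e).toFinset.sort.foldr (step t e) n
  refine ⟨F, ?_, fun e n => ?_, fun e n n' hn => ?_, fun t e n => fold_p _ _ _ _,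
    fun t h e n => ?_⟩
  · rw [continuous_iff_continuousAt]
    rintro ⟨t, e, n⟩
    obtain ⟨U, hU, hUfin⟩ := hfin e
    refine (fold_cont hUfin.toFinset.sort).continuousAt.congr ?_
    have hU' : ∀ᶠ z : I × EH × N in 𝓝 (t, e, n), z.2.1 ∈ U :=
      (Continuous.tendsto (f := fun z : I × EH × N => z.2.1) (by fun_prop) (t, e, n)) hU
    refine hU'.mono fun z hz => (List.foldr_sort_eq _ (fun i hi => ?_) (fun i _ hi n => ?_) _).symm
    · rw [Set.Finite.mem_toFinset] at hi ⊢
      exact ⟨z.2.1, hi, hz⟩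
    · rw [Set.Finite.mem_toFinset, Set.mem_ofPred_eq, not_not] at hi
      exact step_id _ _ _ _ (by rw [hi, mul_zero])
  · change List.foldr (step 0 e) n _ = n
    generalize (hS e).toFinset.sort = l
    induction l with
    | nil => rfl
    | cons i l ih =>
      rw [List.foldr_cons, step_id _ _ _ _ (zero_mul _), ih]
  · obtain ⟨i, hi⟩ := hone e
    have hi' : i ∈ (hS e).toFinset.sort := by
      simp [hi]
    change List.foldr (step 1 e) n _ = List.foldr (step 1 e) n' _
    generalize (hS e).toFinset.sort = l at hi'
    -- the step with `s i e = 1` forgets everything but the point of `Z`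
    induction l with
    | nil => simp at hi'
    | cons a l ih =>
      rw [List.foldr_cons, List.foldr_cons]
      by_cases ha : a = i
      · subst ha
        simp only [step, hi, mul_one, h1, hp, fold_p, hn]
      · rw [ih ((List.mem_cons.1 hi').resolve_left (Ne.symm ha))]
  · have hS' : (hS (h • e)).toFinset = (hS e).toFinset := by
      ext i
      simp [hinv]
    have hl : ∀ i ∈ (hS e).toFinset.sort, s i e ≠ 0 := fun i hi => by simpa using hi
    change List.foldr (step t (h • e)) _ ((hS (h • e)).toFinset.sort) = ρ h • List.foldr (step t e) n _
    rw [hS']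
    generalize (hS e).toFinset.sort = l at hl
    induction l with
    | nil => rfl
    | cons i l ih =>
      rw [List.foldr_cons, List.foldr_cons, ih fun j hj => hl j (List.mem_cons_of_mem _ hj)]
      simp only [step, hinv, hτ i h e (hl i List.mem_cons_self), map_mul, mul_inv_rev, mul_smul,
        inv_smul_smul]

end Numerable

/-! ### Equivariant homotopy inverses -/

section EquivariantInverse

variable {H : Type v} [Group H] [TopologicalSpace H] (EH : Type w) [TopologicalSpace EH]
  [MulAction H EH] {G : Type*} [Group G] [TopologicalSpace G] [IsTopologicalGroup G] (ρ : H →* G)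
  {Y : Type*} [TopologicalSpace Y] [MulAction G Y] {Z : Type*} [TopologicalSpace Z] [MulAction G Z]

/-- An equivariant homotopy inverse of `η : Y → Z`, parametrized by `EH`: maps `inv e : Z → Y`, with
homotopies `counit` from the identity to `η ∘ inv e` and `unit` from the identity to `inv e ∘ η`,
and, for every `y`, a square in `Z` that compares `η ∘ unit` with `counit ∘ η`. -/
structure EquivariantInverse (η : Y → Z) where
  inv : EH → Z → Y
  counit : I → EH → Z → Z
  unit : I → EH → Y → Y
  filler : I → I → EH → Y → Z
  continuous_inv : Continuous fun z : EH × Z => inv z.1 z.2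
  continuous_counit : Continuous fun z : I × EH × Z => counit z.1 z.2.1 z.2.2
  continuous_unit : Continuous fun z : I × EH × Y => unit z.1 z.2.1 z.2.2
  continuous_filler : Continuous fun z : I × I × EH × Y => filler z.1 z.2.1 z.2.2.1 z.2.2.2
  inv_smul : ∀ (h : H) e z, inv (h • e) (ρ h • z) = ρ h • inv e z
  counit_smul : ∀ t (h : H) e z, counit t (h • e) (ρ h • z) = ρ h • counit t e z
  unit_smul : ∀ t (h : H) e y, unit t (h • e) (ρ h • y) = ρ h • unit t e y
  filler_smul : ∀ t s (h : H) e y, filler t s (h • e) (ρ h • y) = ρ h • filler t s e y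
  counit_zero : ∀ e z, counit 0 e z = z
  counit_one : ∀ e z, counit 1 e z = η (inv e z)
  unit_zero : ∀ e y, unit 0 e y = y
  unit_one : ∀ e y, unit 1 e y = inv e (η y)
  filler_left : ∀ t e y, filler t 0 e y = η y
  filler_right : ∀ t e y, filler t 1 e y = η (unit t e y)
  filler_zero : ∀ s e y, filler 0 s e y = η y
  filler_one : ∀ s e y, filler 1 s e y = counit s e (η y)

variable {ρ EH} [ContinuousSMul G Y] [ContinuousSMul G Z]

/-- The action on the mapping path space of an equivariant map. -/
@[reducible]
def MappingPathSpace.mulAction (η : C(Y, Z)) (hη : ∀ (g : G) y, η (g • y) = g • η y) :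
    MulAction G (MappingPathSpace η) where
  smul g n := ⟨(g • n.1.1, g • n.1.2), by
    rw [hη, ← n.2]
    rfl⟩
  one_smul n := Subtype.ext (one_smul G n.1)
  mul_smul g g' n := Subtype.ext (mul_smul g g' n.1)

/-- An equivariant map that is a homotopy equivalence, not necessarily equivariantly, has an
equivariant homotopy inverse over a numerable principal bundle. -/
theorem nonempty_equivariantInverse (hE : IsNumerable H EH) (hρ : Continuous ρ) (η : C(Y, Z))
    (hη : ∀ (g : G) y, η (g • y) = g • η y)
    (he : ∃ e : ContinuousMap.HomotopyEquiv Y Z, e.toFun = η) :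
    Nonempty (EquivariantInverse EH ρ η) := by
  obtain ⟨j, C, hj, h0, h1, hC⟩ := MappingPathSpace.exists_contraction he
  let _ : MulAction G (MappingPathSpace η) := MappingPathSpace.mulAction η hη
  have smul_def : ∀ (g : G) (n : MappingPathSpace η), (g • n).1 = g • n.1 := fun g n => rfl
  have : ContinuousSMul G (MappingPathSpace η) := ⟨by
    refine Continuous.subtype_mk (f := fun z : G × MappingPathSpace η => z.1 • z.2.1) ?_ _
    fun_prop⟩
  have hp : ∀ (g : G) n, MappingPathSpace.start η (g • n) = g • MappingPathSpace.start η n :=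
    fun g n => rfl
  obtain ⟨F, hFc, hF0, hF1, hFp, hFe⟩ :=
    hE.exists_equivariant_contraction hρ hp j C h0 h1 hC
  have hF1' : ∀ e y, F 1 e (j (η y)) = F 1 e (MappingPathSpace.const η y) := fun e y => by
    refine hF1 _ _ _ ?_
    rw [hj]
    rfl
  have hFj : ∀ (h : H) e z, F 1 (h • e) (j (ρ h • z)) = ρ h • F 1 e (j z) := fun h e z => by
    rw [← hFe]
    refine hF1 _ _ _ ?_
    rw [hp, hj, hj]
  have hFy : ∀ t (h : H) e y, F t (h • e) (MappingPathSpace.const η (ρ h • y)) =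
      ρ h • F t e (MappingPathSpace.const η y) := fun t h e y => by
    rw [← hFe]
    congr 1
    refine Subtype.ext (Prod.ext rfl ?_)
    ext s
    exact hη _ _
  have hjc : Continuous fun z : EH × Z => F 1 z.1 (j z.2) :=
    hFc.comp (f := fun z : EH × Z => (1, z.1, j z.2)) (by fun_prop)
  have hyc : Continuous fun z : I × EH × Y => F z.1 z.2.1 (MappingPathSpace.const η z.2.2) :=
    hFc.comp (f := fun z : I × EH × Y => (z.1, z.2.1, MappingPathSpace.const η z.2.2))
      (by fun_prop)
  exact ⟨{
    inv := fun e z => (F 1 e (j z)).1.1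
    counit := fun t e z => (F 1 e (j z)).1.2 t
    unit := fun t e y => (F t e (MappingPathSpace.const η y)).1.1
    filler := fun t s e y => (F t e (MappingPathSpace.const η y)).1.2 s
    continuous_inv := by fun_prop
    continuous_counit := by
      have h := hjc.comp (continuous_snd : Continuous (Prod.snd : I × EH × Z → EH × Z))
      exact (continuous_subtype_val.comp h).snd.eval continuous_fst
    continuous_unit := by fun_prop
    continuous_filler := by
      have h := hyc.comp (f := fun z : I × I × EH × Y => (z.1, z.2.2)) (by fun_prop)
      exact (continuous_subtype_val.comp h).snd.eval continuous_snd.fst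
    inv_smul := fun h e z => by rw [hFj, smul_def, Prod.smul_fst]
    counit_smul := fun t h e z => by
      rw [hFj, smul_def, Prod.smul_snd, ContinuousMap.smul_apply]
    unit_smul := fun t h e y => by rw [hFy, smul_def, Prod.smul_fst]
    filler_smul := fun t s h e y => by
      rw [hFy, smul_def, Prod.smul_snd, ContinuousMap.smul_apply]
    counit_zero := fun e z => (hFp 1 e (j z)).trans (hj z)
    counit_one := fun e z => (F 1 e (j z)).2
    unit_zero := fun e y => by rw [hF0]; rfl
    unit_one := fun e y => by rw [hF1']
    filler_left := fun t e y => hFp t e _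
    filler_right := fun t e y => (F t e (MappingPathSpace.const η y)).2
    filler_zero := fun s e y => by rw [hF0]; rfl
    filler_one := fun s e y => by rw [hF1'] }⟩

end EquivariantInverse

/-! ### Collars of the ball -/

section Collar

variable {k : ℕ}

/-- For `0 ≤ l ≤ 1`, the map of the ball to itself that stretches the ball of radius `1 - l/2` to
the whole ball, and projects its complement to the boundary. -/
def stretch (l : I) (x : Ball k) : Ball k :=
  ⟨(max (1 - (l : ℝ) / 2) ‖x.1‖)⁻¹ • x.1, by
    have h0 : (0 : ℝ) < max (1 - (l : ℝ) / 2) ‖x.1‖ :=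
      lt_max_of_lt_left (by linarith [l.2.2])
    rw [mem_closedBall_zero_iff, norm_smul, norm_inv, Real.norm_of_nonneg h0.le,
      inv_mul_le_iff₀ h0, mul_one]
    exact le_max_right _ _⟩

/-- The depth of a point in the collar `1 - l/2 ≤ ‖x‖ ≤ 1`, normalized to run from `0` to `l`. -/
def depth (l : I) (x : Ball k) : I :=
  Set.projIcc 0 1 zero_le_one (2 * ‖x.1‖ - (2 - l))

theorem continuous_stretch : Continuous fun z : I × Ball k => stretch z.1 z.2 := by
  have h1 : Continuous fun z : I × Ball k => max (1 - (z.1 : ℝ) / 2) ‖z.2.1‖ := by fun_prop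
  have h2 : Continuous fun z : I × Ball k => z.2.1 := by fun_prop
  refine ((h1.inv₀ fun z => ?_).smul h2).subtype_mk _
  exact (lt_max_of_lt_left (by linarith [z.1.2.2])).ne'

theorem continuous_depth : Continuous fun z : I × Ball k => depth z.1 z.2 :=
  continuous_projIcc.comp
    (f := fun z : I × Ball k => 2 * ‖z.2.1‖ - (2 - (z.1 : ℝ))) (by fun_prop)

theorem norm_ball_le (x : Ball k) : ‖x.1‖ ≤ 1 := mem_closedBall_zero_iff.1 x.2

theorem stretch_zero (x : Ball k) : stretch 0 x = x := by
  apply Subtype.ext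
  simp [stretch, max_eq_left (norm_ball_le x)]

theorem stretch_of_norm_eq_one (l : I) {x : Ball k} (hx : ‖x.1‖ = 1) : stretch l x = x := by
  apply Subtype.ext
  have : max (1 - (l : ℝ) / 2) 1 = 1 := max_eq_right (by linarith [l.2.1])
  simp [stretch, hx, this]

theorem norm_stretch {l : I} {x : Ball k} (hx : 1 - (l : ℝ) / 2 ≤ ‖x.1‖) :
    ‖(stretch l x).1‖ = 1 := by
  have h0 : (0 : ℝ) < ‖x.1‖ := lt_of_lt_of_le (by linarith [l.2.2]) hx
  simp only [stretch, max_eq_right hx]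
  rw [norm_smul, norm_inv, norm_norm, inv_mul_cancel₀ h0.ne']

theorem stretch_smul (l : I) (A : O k) (x : Ball k) : stretch l (A • x) = A • stretch l x := by
  apply Subtype.ext
  simp only [stretch]
  rw [norm_smul_ball, coe_smul_ball, coe_smul_ball, WithLp.ofLp_smul, Matrix.mulVec_smul,
    WithLp.toLp_smul]

theorem depth_smul (l : I) (A : O k) (x : Ball k) : depth l (A • x) = depth l x := by
  simp only [depth, norm_smul_ball]

theorem depth_eq_zero {l : I} {x : Ball k} (hx : ‖x.1‖ ≤ 1 - (l : ℝ) / 2) : depth l x = 0 :=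
  Set.projIcc_of_le_left zero_le_one (by linarith)

theorem depth_of_norm_eq_one (l : I) {x : Ball k} (hx : ‖x.1‖ = 1) : depth l x = l := by
  have : 2 * ‖x.1‖ - (2 - (l : ℝ)) = l := by rw [hx]; ring
  rw [depth, this, Set.projIcc_val]

variable {Y Y' : Type*}

/-- The function `f` on the ball of radius `1 - l/2`, with a collar in which `b` takes place. -/
def withCollar (l : I) (f : Ball k → Y) (b : I → Ball k → Y) (x : Ball k) : Y :=
  if ‖x.1‖ ≤ 1 - (l : ℝ) / 2 then f (stretch l x) else b (depth l x) (stretch l x)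

theorem withCollar_zero (f : Ball k → Y) (b : I → Ball k → Y) (x : Ball k) :
    withCollar 0 f b x = f x := by
  rw [withCollar, if_pos (by simpa using norm_ball_le x), stretch_zero]

theorem withCollar_of_norm_eq_one (l : I) {f : Ball k → Y} {b : I → Ball k → Y}
    (h : ∀ x, ‖x.1‖ = 1 → b 0 x = f x) {x : Ball k} (hx : ‖x.1‖ = 1) :
    withCollar l f b x = b l x := by
  rw [withCollar, stretch_of_norm_eq_one l hx, depth_of_norm_eq_one l hx]
  split_ifs with hl
  · have : l = 0 := le_antisymm (Subtype.coe_le_coe.1 (by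
      rw [hx] at hl
      simp only [Set.Icc.coe_zero]
      linarith)) l.2.1
    rw [this, h x hx]
  · rfl

theorem withCollar_const (l : I) {f : Ball k → Y} {b : I → Ball k → Y}
    (h : ∀ r x, ‖x.1‖ = 1 → b r x = f x) (x : Ball k) :
    withCollar l f b x = f (stretch l x) := by
  rw [withCollar]
  split_ifs with hl
  · rfl
  · exact h _ _ (norm_stretch (le_of_not_ge hl))

theorem withCollar_congr (l : I) {f f' : Ball k → Y} {b b' : I → Ball k → Y}
    (hf : ∀ x, f x = f' x) (hb : ∀ r x, ‖x.1‖ = 1 → b r x = b' r x) (x : Ball k) :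
    withCollar l f b x = withCollar l f' b' x := by
  rw [withCollar, withCollar]
  split_ifs with hl
  · exact hf _
  · exact hb _ _ (norm_stretch (le_of_not_ge hl))

theorem withCollar_smul (l : I) {f : Ball k → Y} {f' : Ball k → Y'} {b : I → Ball k → Y}
    {b' : I → Ball k → Y'} (A : O k) (φ : Y → Y') (hf : ∀ x, f' (A • x) = φ (f x))
    (hb : ∀ r x, b' r (A • x) = φ (b r x)) (x : Ball k) :
    withCollar l f' b' (A • x) = φ (withCollar l f b x) := by
  rw [withCollar, withCollar, norm_smul_ball, stretch_smul, depth_smul, hf, hb]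
  split_ifs <;> rfl

theorem map_withCollar (l : I) {f : Ball k → Y} {b : I → Ball k → Y} (φ : Y → Y') (x : Ball k) :
    φ (withCollar l f b x) = withCollar l (fun y => φ (f y)) (fun r y => φ (b r y)) x := by
  rw [withCollar, withCollar]
  split_ifs <;> rfl

theorem continuous_withCollar [TopologicalSpace Y] {A : Type*} [TopologicalSpace A]
    {l : A → I} {x : A → Ball k} {f : A → Ball k → Y} {b : A → I → Ball k → Y} (hl : Continuous l)
    (hx : Continuous x) (hf : Continuous fun z : A × Ball k => f z.1 z.2)
    (hb : Continuous fun z : A × I × Ball k => b z.1 z.2.1 z.2.2)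
    (h : ∀ a x, ‖x.1‖ = 1 → b a 0 x = f a x) :
    Continuous fun a => withCollar (l a) (f a) (b a) (x a) := by
  have h1 : Continuous fun a => stretch (l a) (x a) :=
    continuous_stretch.comp (f := fun a => (l a, x a)) (hl.prodMk hx)
  have h2 : Continuous fun a => depth (l a) (x a) :=
    continuous_depth.comp (f := fun a => (l a, x a)) (hl.prodMk hx)
  have h3 : Continuous fun a => f a (stretch (l a) (x a)) := hf.comp (continuous_id.prodMk h1)
  have h4 : Continuous fun a => b a (depth (l a) (x a)) (stretch (l a) (x a)) :=
    hb.comp (f := fun a => (a, depth (l a) (x a), stretch (l a) (x a)))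
      (continuous_id.prodMk (h2.prodMk h1))
  have h5 : Continuous fun a => ‖(x a).1‖ := by fun_prop
  have h6 : Continuous fun a => 1 - (l a : ℝ) / 2 := by fun_prop
  refine Continuous.if_le h3 h4 h5 h6 fun a ha => ?_
  rw [depth_eq_zero ha.le]
  exact (h a _ (norm_stretch ha.ge)).symm

end Collar

/-! ### Equivariant maps on the ball relative to its boundary -/

section Relative

variable {H : Type v} [Group H] {k : ℕ} (ρ : H →* O k) {EH : Type w} [MulAction H EH]
  {Y : Type*} [MulAction (O k) Y] {Z : Type*} [MulAction (O k) Z]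

/-- Equivariant functions on `B^k × EH` that agree with `s` on `∂B^k × EH`. -/
structure IsExtension (s f : Ball k × EH → Y) : Prop where
  smul : ∀ h x e, f (ρ h • x, h • e) = ρ h • f (x, e)
  boundary : ∀ x e, ‖x.1‖ = 1 → f (x, e) = s (x, e)

variable {ρ} in
theorem IsExtension.congr {s s' f : Ball k × EH → Y} (hf : IsExtension ρ s f)
    (h : ∀ x e, ‖x.1‖ = 1 → s (x, e) = s' (x, e)) : IsExtension ρ s' f :=
  ⟨hf.smul, fun x e hx => (hf.boundary x e hx).trans (h x e hx)⟩

variable {ρ} in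
theorem IsExtension.comp {s f : Ball k × EH → Y} (hf : IsExtension ρ s f) (η : Y → Z)
    (hη : ∀ (g : O k) y, η (g • y) = g • η y) :
    IsExtension ρ (fun p => η (s p)) (fun p => η (f p)) :=
  ⟨fun h x e => by rw [hf.smul, hη], fun x e hx => by rw [hf.boundary x e hx]⟩

variable [TopologicalSpace EH] [TopologicalSpace Y] [TopologicalSpace Z]

/-- Homotopy through equivariant maps on `B^k × EH` that agree with `s` on `∂B^k × EH`. -/
def RelHomotopic (s : Ball k × EH → Y) (f g : C(Ball k × EH, Y)) : Prop :=
  ContinuousMap.HomotopicWith f g fun φ => IsExtension ρ s φ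

variable {ρ}

theorem RelHomotopic.mk {s : Ball k × EH → Y} {f g : C(Ball k × EH, Y)}
    (F : I → Ball k × EH → Y) (hF : Continuous fun z : I × Ball k × EH => F z.1 z.2)
    (hs : ∀ t, IsExtension ρ s (F t)) (h0 : ∀ p, F 0 p = f p) (h1 : ∀ p, F 1 p = g p) :
    RelHomotopic ρ s f g :=
  ⟨{ toFun := fun z => F z.1 z.2
     continuous_toFun := hF
     map_zero_left := h0
     map_one_left := h1
     prop' := hs }⟩

theorem RelHomotopic.exists {s : Ball k × EH → Y} {f g : C(Ball k × EH, Y)}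
    (h : RelHomotopic ρ s f g) : ∃ F : I → Ball k × EH → Y,
      (Continuous fun z : I × Ball k × EH => F z.1 z.2) ∧ (∀ t, IsExtension ρ s (F t)) ∧
      (∀ p, F 0 p = f p) ∧ ∀ p, F 1 p = g p := by
  obtain ⟨F⟩ := h
  exact ⟨fun t p => F (t, p), F.continuous, F.prop', F.map_zero_left, F.map_one_left⟩

theorem RelHomotopic.congr {s s' : Ball k × EH → Y} {f g : C(Ball k × EH, Y)}
    (h : ∀ x e, ‖x.1‖ = 1 → s (x, e) = s' (x, e)) (hf : RelHomotopic ρ s f g) :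
    RelHomotopic ρ s' f g := by
  obtain ⟨F, h1, h2, h3, h4⟩ := hf.exists
  exact .mk F h1 (fun t => (h2 t).congr h) h3 h4

theorem RelHomotopic.symm {s : Ball k × EH → Y} {f g : C(Ball k × EH, Y)}
    (h : RelHomotopic ρ s f g) : RelHomotopic ρ s g f :=
  ContinuousMap.HomotopicWith.symm h

theorem RelHomotopic.trans {s : Ball k × EH → Y} {f g f' : C(Ball k × EH, Y)}
    (h : RelHomotopic ρ s f g) (h' : RelHomotopic ρ s g f') : RelHomotopic ρ s f f' :=
  ContinuousMap.HomotopicWith.trans h h'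

theorem RelHomotopic.refl {s : Ball k × EH → Y} {f : C(Ball k × EH, Y)}
    (h : IsExtension ρ s f) : RelHomotopic ρ s f f :=
  ContinuousMap.HomotopicWith.refl f h

theorem RelHomotopic.left {s : Ball k × EH → Y} {f g : C(Ball k × EH, Y)}
    (h : RelHomotopic ρ s f g) : IsExtension ρ s f := by
  obtain ⟨F, h1, h2, h3, h4⟩ := h.exists
  simpa [funext h3] using h2 0

theorem RelHomotopic.comp {s : Ball k × EH → Y} {f g : C(Ball k × EH, Y)}
    (h : RelHomotopic ρ s f g) (η : C(Y, Z)) (hη : ∀ (g : O k) y, η (g • y) = g • η y) :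
    RelHomotopic ρ (fun p => η (s p)) (η.comp f) (η.comp g) := by
  obtain ⟨F, h1, h2, h3, h4⟩ := h.exists
  exact .mk (fun t p => η (F t p)) (by fun_prop) (fun t => (h2 t).comp η hη)
    (fun p => congrArg η (h3 p)) (fun p => congrArg η (h4 p))

/-- A map on `B^k × EH` stretched over the ball. -/
def stretched (f : C(Ball k × EH, Y)) : C(Ball k × EH, Y) :=
  ⟨fun p => f (stretch 1 p.1, p.2), f.continuous.comp
    ((continuous_stretch.comp (continuous_const.prodMk continuous_fst)).prodMk continuous_snd)⟩

theorem relHomotopic_stretched {s : Ball k × EH → Y} {f : C(Ball k × EH, Y)}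
    (hf : IsExtension ρ s f) : RelHomotopic ρ s f (stretched f) := by
  refine .mk (fun t p => f (stretch t p.1, p.2)) ?_ (fun t => ⟨fun h x e => ?_, fun x e hx => ?_⟩)
    (fun p => by rw [stretch_zero]) (fun p => rfl)
  · exact f.continuous.comp
      ((continuous_stretch.comp (continuous_fst.prodMk continuous_snd.fst)).prodMk
        continuous_snd.snd)
  · change f (stretch t (ρ h • x), h • e) = _
    rw [stretch_smul, hf.smul]
  · change f (stretch t x, e) = _
    rw [stretch_of_norm_eq_one t hx, hf.boundary x e hx]

section Lifting

variable {η : C(Y, Z)}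

theorem EquivariantInverse.continuous_lift (𝓔 : EquivariantInverse EH ρ η) {A : Type*}
    [TopologicalSpace A] {x : A → Ball k} {e : A → EH} (hx : Continuous x) (he : Continuous e)
    (s : C(Ball k × EH, Y)) {z : A → Ball k → Z} (hz : Continuous fun q : A × Ball k => z q.1 q.2)
    (h : ∀ a x, ‖x.1‖ = 1 → z a x = η (s (x, e a))) :
    Continuous fun a => withCollar 1 (fun x => 𝓔.inv (e a) (z a x))
      (fun r x => 𝓔.unit (σ r) (e a) (s (x, e a))) (x a) := by
  refine continuous_withCollar continuous_const hx ?_ ?_ fun a x hx => ?_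
  · exact 𝓔.continuous_inv.comp (f := fun q : A × Ball k => (e q.1, z q.1 q.2)) (by fun_prop)
  · exact 𝓔.continuous_unit.comp (f := fun q : A × I × Ball k =>
        (σ q.2.1, e q.1, s (q.2.2, e q.1))) (by fun_prop)
  · simp only [unitInterval.symm_zero, 𝓔.unit_one, h a x hx]

/-- The lift of `z` along `η` with the boundary values of `s`: it is `inv ∘ z` in the interior, and
`unit` in a collar. -/
def EquivariantInverse.lift (𝓔 : EquivariantInverse EH ρ η) (s : C(Ball k × EH, Y))
    (z : C(Ball k × EH, Z)) (h : ∀ x e, ‖x.1‖ = 1 → z (x, e) = η (s (x, e))) :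
    C(Ball k × EH, Y) :=
  ⟨fun p => withCollar 1 (fun x => 𝓔.inv p.2 (z (x, p.2)))
      (fun r x => 𝓔.unit (σ r) p.2 (s (x, p.2))) p.1,
    𝓔.continuous_lift continuous_fst continuous_snd s (by fun_prop) fun p x hx => h x p.2 hx⟩

theorem EquivariantInverse.lift_apply (𝓔 : EquivariantInverse EH ρ η) (s : C(Ball k × EH, Y))
    (z : C(Ball k × EH, Z)) (h : ∀ x e, ‖x.1‖ = 1 → z (x, e) = η (s (x, e))) (p : Ball k × EH) :
    𝓔.lift s z h p = withCollar 1 (fun x => 𝓔.inv p.2 (z (x, p.2)))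
      (fun r x => 𝓔.unit (σ r) p.2 (s (x, p.2))) p.1 := rfl

theorem EquivariantInverse.isExtension_lift (𝓔 : EquivariantInverse EH ρ η)
    {s : C(Ball k × EH, Y)} (hs : IsExtension ρ s s) {z : Ball k × EH → Z}
    (hz : IsExtension ρ (fun p => η (s p)) z) :
    IsExtension ρ s fun p => withCollar 1 (fun x => 𝓔.inv p.2 (z (x, p.2)))
      (fun r x => 𝓔.unit (σ r) p.2 (s (x, p.2))) p.1 := by
  refine ⟨fun h x e => ?_, fun x e hx => ?_⟩
  · refine withCollar_smul 1 (f := fun x => 𝓔.inv e (z (x, e)))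
      (b := fun r x => 𝓔.unit (σ r) e (s (x, e))) (ρ h) (fun y : Y => ρ h • y) (fun x => ?_)
      (fun r x => ?_) x
    · simp only [hz.smul, 𝓔.inv_smul]
    · simp only [hs.smul, 𝓔.unit_smul]
  · refine (withCollar_of_norm_eq_one 1 (fun x hx => ?_) hx).trans ?_
    · simp only [unitInterval.symm_zero, 𝓔.unit_one, hz.boundary x e hx]
    · simp only [unitInterval.symm_one, 𝓔.unit_zero]

/-- Lifting along a homotopy equivalence relative to the boundary: existence. -/
theorem EquivariantInverse.exists_lift (𝓔 : EquivariantInverse EH ρ η) {s : C(Ball k × EH, Y)}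
    (hs : IsExtension ρ s s) {z : C(Ball k × EH, Z)}
    (hz : IsExtension ρ (fun p => η (s p)) z) :
    ∃ y : C(Ball k × EH, Y), IsExtension ρ s y ∧
      RelHomotopic ρ (fun p => η (s p)) (η.comp y) z := by
  refine ⟨𝓔.lift s z hz.boundary, 𝓔.isExtension_lift hs hz,
    ((relHomotopic_stretched hz).trans (.mk (fun t p => withCollar 1
    (fun x => 𝓔.counit t p.2 (z (x, p.2)))
    (fun r x => 𝓔.filler (σ r) t p.2 (s (x, p.2))) p.1) ?_ (fun t => ⟨fun h x e => ?_,
      fun x e hx => ?_⟩) (fun p => ?_) fun p => ?_)).symm⟩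
  · refine continuous_withCollar continuous_const continuous_snd.fst ?_ ?_ fun p x hx => ?_
    · exact 𝓔.continuous_counit.comp (f := fun q : (I × Ball k × EH) × Ball k =>
        (q.1.1, q.1.2.2, z (q.2, q.1.2.2))) (by fun_prop)
    · exact 𝓔.continuous_filler.comp (f := fun q : (I × Ball k × EH) × I × Ball k =>
        (σ q.2.1, q.1.1, q.1.2.2, s (q.2.2, q.1.2.2))) (by fun_prop)
    · simp only [unitInterval.symm_zero, 𝓔.filler_one, hz.boundary x _ hx]
  · refine withCollar_smul 1 (f := fun x => 𝓔.counit t e (z (x, e)))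
      (b := fun r x => 𝓔.filler (σ r) t e (s (x, e))) (ρ h) (fun y : Z => ρ h • y) (fun x => ?_)
      (fun r x => ?_) x
    · simp only [hz.smul, 𝓔.counit_smul]
    · simp only [hs.smul, 𝓔.filler_smul]
  · refine (withCollar_of_norm_eq_one 1 (fun x hx => ?_) hx).trans ?_
    · simp only [unitInterval.symm_zero, 𝓔.filler_one, hz.boundary x e hx]
    · simp only [unitInterval.symm_one, 𝓔.filler_zero]
  · refine (withCollar_const 1 (fun r x hx => ?_) p.1).trans (𝓔.counit_zero _ _)
    simp only [𝓔.filler_left, 𝓔.counit_zero, hz.boundary x p.2 hx]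
  · refine (withCollar_congr 1 (fun x => 𝓔.counit_one _ _)
      (fun r x _ => 𝓔.filler_right _ _ _) _).trans (map_withCollar 1 η p.1).symm

theorem EquivariantInverse.relHomotopic_lift (𝓔 : EquivariantInverse EH ρ η)
    {y : C(Ball k × EH, Y)} (hy : IsExtension ρ y y) :
    RelHomotopic ρ y y (𝓔.lift y (η.comp y) fun _ _ _ => rfl) := by
  refine (relHomotopic_stretched hy).trans (.mk (fun t p => withCollar 1
    (fun x => 𝓔.unit t p.2 (y (x, p.2))) (fun r x => 𝓔.unit (t * σ r) p.2 (y (x, p.2))) p.1)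
    ?_ (fun t => ⟨fun h x e => ?_, fun x e hx => ?_⟩) (fun p => ?_) fun p => ?_)
  · refine continuous_withCollar continuous_const continuous_snd.fst ?_ ?_ fun p x hx => ?_
    · exact 𝓔.continuous_unit.comp (f := fun q : (I × Ball k × EH) × Ball k =>
        (q.1.1, q.1.2.2, y (q.2, q.1.2.2))) (by fun_prop)
    · exact 𝓔.continuous_unit.comp (f := fun q : (I × Ball k × EH) × I × Ball k =>
        (q.1.1 * σ q.2.1, q.1.2.2, y (q.2.2, q.1.2.2))) (by fun_prop)
    · simp only [unitInterval.symm_zero, mul_one]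
  · refine withCollar_smul 1 (f := fun x => 𝓔.unit t e (y (x, e)))
      (b := fun r x => 𝓔.unit (t * σ r) e (y (x, e))) (ρ h) (fun y : Y => ρ h • y) (fun x => ?_)
      (fun r x => ?_) x
    · simp only [hy.smul, 𝓔.unit_smul]
    · simp only [hy.smul, 𝓔.unit_smul]
  · refine (withCollar_of_norm_eq_one 1 (fun x hx => ?_) hx).trans ?_
    · simp only [unitInterval.symm_zero, mul_one]
    · simp only [unitInterval.symm_one, mul_zero, 𝓔.unit_zero]
  · refine (withCollar_const 1 (fun r x hx => ?_) p.1).trans (𝓔.unit_zero _ _)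
    simp only [zero_mul]
  · rw [𝓔.lift_apply]
    exact withCollar_congr 1 (fun x => 𝓔.unit_one _ _) (fun r x _ => by rw [one_mul]) _

/-- Lifting along a homotopy equivalence relative to the boundary: uniqueness. -/
theorem EquivariantInverse.relHomotopic_of_comp (𝓔 : EquivariantInverse EH ρ η)
    {s y y' : C(Ball k × EH, Y)} (hy : IsExtension ρ s y) (hy' : IsExtension ρ s y')
    (h : RelHomotopic ρ (fun p => η (s p)) (η.comp y) (η.comp y')) : RelHomotopic ρ s y y' := by
  have hyy : IsExtension ρ y y := ⟨hy.smul, fun _ _ _ => rfl⟩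
  have hyy' : IsExtension ρ y' y' := ⟨hy'.smul, fun _ _ _ => rfl⟩
  have e1 := (𝓔.relHomotopic_lift hyy).congr hy.boundary
  have e2 := (𝓔.relHomotopic_lift hyy').congr hy'.boundary
  obtain ⟨W, hW, hWs, hW0, hW1⟩ := h.exists
  have hWy : ∀ t, IsExtension ρ (fun p => η (y p)) (W t) := fun t =>
    (hWs t).congr fun x e hx => by rw [hy.boundary x e hx]
  refine (e1.trans (.mk (fun t p => withCollar 1 (fun x => 𝓔.inv p.2 (W t (x, p.2)))
      (fun r x => 𝓔.unit (σ r) p.2 (y (x, p.2))) p.1) ?_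
      (fun t => (𝓔.isExtension_lift hyy (hWy t)).congr hy.boundary) (fun p => ?_)
      fun p => ?_)).trans e2.symm
  · exact 𝓔.continuous_lift (A := I × Ball k × EH) continuous_snd.fst continuous_snd.snd y
      (hW.comp (f := fun q : (I × Ball k × EH) × Ball k => (q.1.1, q.2, q.1.2.2)) (by fun_prop))
      fun q x hx => (hWy q.1).boundary x _ hx
  · rw [𝓔.lift_apply]
    exact withCollar_congr 1 (fun x => by rw [hW0]) (fun r x _ => rfl) _
  · rw [𝓔.lift_apply]
    exact withCollar_congr 1 (fun x => by rw [hW1])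
      (fun r x hx => by rw [hy.boundary x _ hx, hy'.boundary x _ hx]) _

end Lifting

end Relative

/-! ### Sections of the state bundle as equivariant maps -/

section Standard

variable {H : Type v} [Group H] {k : ℕ} {ρ : H →* O k} {EH : Type w} [MulAction H EH]

theorem mk_mem_boundary_iff {x : Ball k} {e : EH} :
    (Quotient.mk _ (x, e) : BallQuotient ρ EH) ∈ boundary ρ EH ↔ ‖x.1‖ = 1 := by
  refine ⟨?_, fun h => ⟨x, e, h, rfl⟩⟩
  rintro ⟨x', e', hx', he'⟩
  obtain ⟨h, hh⟩ := Quotient.exact he'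
  have : x' = ρ h • x := (Prod.ext_iff.1 hh).1
  rwa [this, norm_smul_ball] at hx'

variable [TopologicalSpace EH] {Y : Type u} [MulAction (O k) Y] [TopologicalSpace Y]

/-- The value of a section at `[x, e]`, in the standard frame at `x`. -/
def StateSection.std (s : StateSection ρ EH Y) (p : Ball k × EH) : Y :=
  s.value (Quotient.mk _ (p.1, 1, p.2))

theorem StateSection.value_smul (s : StateSection ρ EH Y) (g : O k) (p : FrameBundle ρ EH) :
    s.value (g • p) = g • s.value p := by
  have aux : ∀ (c : BallQuotient ρ EH) (p : FrameBundle ρ EH) (hc : p.proj = c),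
      (s.1 c).state ⟨p, hc.trans (s.2 c).symm⟩ = s.value p := by
    rintro c p rfl
    rfl
  rw [← aux p.proj (g • p) (FrameBundle.proj_smul g p)]
  exact (s.1 p.proj).equivariant g ⟨p, (s.2 p.proj).symm⟩

theorem StateSection.value_mk (s : StateSection ρ EH Y) (x : Ball k) (u : O k) (e : EH) :
    s.value (Quotient.mk _ (x, u, e)) = u • s.std (x, e) := by
  rw [StateSection.std, ← s.value_smul]
  congr 1
  exact congrArg (Quotient.mk _) (by simp)

theorem StateSection.std_smul (s : StateSection ρ EH Y) (h : H) (x : Ball k) (e : EH) :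
    s.std (ρ h • x, h • e) = ρ h • s.std (x, e) := by
  rw [← s.value_mk, StateSection.std]
  congr 1
  exact (Quotient.sound ⟨h, by simp⟩ :
    (Quotient.mk (frameSetoid ρ EH) (x, ρ h, e)) = Quotient.mk _ (ρ h • x, 1, h • e)).symm

theorem StateSection.isExtension_std (s s₀ : StateSection ρ EH Y)
    (h : ∀ x e, ‖x.1‖ = 1 → s.std (x, e) = s₀.std (x, e)) : IsExtension ρ s₀.std s.std :=
  ⟨s.std_smul, h⟩

theorem StateSection.eq_of_std_eq {s s' : StateSection ρ EH Y} (h : s.std = s'.std) : s = s' := by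
  apply Subtype.ext
  ext1 b
  refine StateBundle.ext ((s.2 b).trans (s'.2 b).symm) fun p hp => ?_
  have hb : p.proj = b := hp.trans (s.2 b)
  subst hb
  obtain ⟨x, u, e⟩ := p
  change s.value (Quotient.mk _ (x, u, e)) = s'.value (Quotient.mk _ (x, u, e))
  rw [s.value_mk, s'.value_mk, h]

theorem StateSection.restrict_eq_iff {s s' : StateSection ρ EH Y} :
    s.restrict = s'.restrict ↔ ∀ x e, ‖x.1‖ = 1 → s.std (x, e) = s'.std (x, e) := by
  refine ⟨fun h x e hx => ?_, fun h => StateSection.restrict_eq fun x u e hx => ?_⟩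
  · have hb : (Quotient.mk _ (x, e) : BallQuotient ρ EH) ∈ boundary ρ EH :=
      mk_mem_boundary_iff.2 hx
    have h1 : s.1 (Quotient.mk _ (x, e)) = s'.1 (Quotient.mk _ (x, e)) :=
      congrArg (fun t : BoundarySection ρ EH Y => t.1 ⟨_, hb⟩) h
    have aux : ∀ (a b : StateBundle ρ EH Y), a = b → ∀ (p : FrameBundle ρ EH)
        (ha : p.proj = a.base) (hb : p.proj = b.base), a.state ⟨p, ha⟩ = b.state ⟨p, hb⟩ := by
      rintro a b rfl p ha hb
      rfl
    exact aux _ _ h1 _ _ _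
  · rw [s.value_mk, s'.value_mk, h x e hx]

theorem isOpenQuotientMap_ballQuotient [ContinuousConstSMul H EH] :
    IsOpenQuotientMap (Quotient.mk (ballSetoid ρ EH)) := by
  refine ⟨Quotient.mk_surjective, continuous_quotient_mk', fun U hU => ?_⟩
  change IsOpen (Quotient.mk (ballSetoid ρ EH) ⁻¹' (Quotient.mk _ '' U))
  have : Quotient.mk (ballSetoid ρ EH) ⁻¹' (Quotient.mk _ '' U) =
      ⋃ h : H, (fun p : Ball k × EH => (ρ h • p.1, h • p.2)) ⁻¹' U := by
    ext p
    simp only [Set.mem_preimage, Set.mem_image, Set.mem_iUnion]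
    constructor
    · rintro ⟨p', hp', he⟩
      obtain ⟨h, hh⟩ := Quotient.exact he.symm
      exact ⟨h, hh ▸ hp'⟩
    · rintro ⟨h, hh⟩
      exact ⟨_, hh, (Quotient.sound ⟨h, rfl⟩ : (Quotient.mk (ballSetoid ρ EH) p) = _).symm⟩
  rw [this]
  refine isOpen_iUnion fun h => hU.preimage (Continuous.prodMk ?_ (by fun_prop))
  refine Continuous.subtype_mk (f := fun p : Ball k × EH =>
    WithLp.toLp 2 ((ρ h).1.mulVec p.1.1.ofLp)) ?_ _
  exact (PiLp.continuous_toLp 2 _).comp (Continuous.matrix_mulVec continuous_const (by fun_prop))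

variable [ContinuousSMul (O k) Y]

/-- The section with a given equivariant function as values in the standard frames. -/
def StateSection.ofStd (f : Ball k × EH → Y) (hf : Continuous f)
    (hH : ∀ h x e, f (ρ h • x, h • e) = ρ h • f (x, e)) : StateSection ρ EH Y :=
  .ofFun (fun p => p.2.1 • f (p.1, p.2.2)) (by fun_prop)
    (fun h p => by rw [hH, smul_smul, mul_assoc, inv_mul_cancel, mul_one])
    (fun g p => mul_smul _ _ _)

theorem StateSection.std_ofStd (f : Ball k × EH → Y) (hf : Continuous f)
    (hH : ∀ h x e, f (ρ h • x, h • e) = ρ h • f (x, e)) :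
    (StateSection.ofStd (ρ := ρ) f hf hH).std = f :=
  funext fun _ => one_smul _ _

/-- A continuous family of equivariant functions gives a continuous family of sections. -/
theorem StateSection.continuous_ofStd [ContinuousConstSMul H EH] {T : Type*} [TopologicalSpace T]
    (f : T → Ball k × EH → Y) (hf : Continuous fun z : T × Ball k × EH => f z.1 z.2)
    (hH : ∀ t h x e, f t (ρ h • x, h • e) = ρ h • f t (x, e)) :
    Continuous fun z : T × BallQuotient ρ EH =>
      (StateSection.ofStd (ρ := ρ) (f z.1) (by fun_prop) (hH z.1)).1 z.2 := by
  rw [(IsOpenQuotientMap.id.prodMap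
    (isOpenQuotientMap_ballQuotient (ρ := ρ) (EH := EH))).isQuotientMap.continuous_iff]
  have h1 : Continuous fun z : T × Ball k × EH =>
      (⟨Quotient.mk _ (z.2.1, 1, z.2.2), (StateSection.ofStd (ρ := ρ) (f z.1) (by fun_prop)
        (hH z.1)).1 (Quotient.mk _ z.2), rfl⟩ : FramedState ρ EH Y) := by
    refine continuous_induced_rng.2 (Continuous.prodMk ?_ ?_)
    · exact continuous_quotient_mk'.comp (by fun_prop)
    · change Continuous fun z : T × Ball k × EH => (1 : O k) • f z.1 z.2
      simpa using hf
  have h2 : Continuous fun z : FramedState ρ EH Y => z.point := continuous_coinduced_rng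
  exact h2.comp h1

/-- A continuous family of sections has continuous values in the standard frames. This is where the
local trivializations of the bundle are used. -/
theorem StateSection.continuous_std [TopologicalSpace H] (hE : IsNumerable H EH)
    (hρ : Continuous ρ) {T : Type*} [TopologicalSpace T] (S : T → StateSection ρ EH Y)
    (hS : Continuous fun z : T × BallQuotient ρ EH => (S z.1).1 z.2) :
    Continuous fun z : T × Ball k × EH => (S z.1).std z.2 := by
  classical
  obtain ⟨ι, s, τ, hinv, -, hone, hcont, hτ⟩ := hE.exists_plateau
  rw [continuous_iff_continuousAt]
  rintro ⟨t₀, x₀, e₀⟩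
  obtain ⟨i, hi⟩ := hone e₀
  have hτc : ∀ e, s i e ≠ 0 → ContinuousAt (τ i) e := fun e he =>
    (hcont i e).resolve_right fun h => he h.self_of_nhds
  have hV : IsOpen {e | s i e ≠ 0} := isOpen_ne.preimage (s i).continuous
  -- the frames, relative to the local trivialization
  let w : FrameBundle ρ EH → O k := Quotient.lift
    (fun p => if s i p.2.2 ≠ 0 then p.2.1 * ρ (τ i p.2.2) else 1) fun p p' ⟨h, hp⟩ => by
      subst hp
      simp only [hinv]
      split_ifs with hs
      · rw [hτ i h _ hs, map_mul, mul_assoc, inv_mul_cancel_left]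
      · rfl
  let V : Set (BallQuotient ρ EH) := {b | ∀ x e, b = Quotient.mk _ (x, e) → s i e ≠ 0}
  have hVmk : ∀ x e, (Quotient.mk _ (x, e) : BallQuotient ρ EH) ∈ V ↔ s i e ≠ 0 := fun x e => by
    refine ⟨fun h => h x e rfl, fun h x' e' he => ?_⟩
    obtain ⟨g, hg⟩ := Quotient.exact he
    have : e' = g • e := (Prod.ext_iff.1 hg).2
    rwa [this, hinv]
  have hVF : IsOpen (FrameBundle.proj ⁻¹' V : Set (FrameBundle ρ EH)) := by
    have hq : Topology.IsQuotientMap (Quotient.mk (frameSetoid ρ EH)) := isQuotientMap_quotient_mk'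
    have : Quotient.mk (frameSetoid ρ EH) ⁻¹' (FrameBundle.proj ⁻¹' V) =
        {p : Ball k × O k × EH | s i p.2.2 ≠ 0} := by
      ext ⟨x, u, e⟩
      exact hVmk x e
    rw [← hq.isOpen_preimage, this]
    exact hV.preimage (continuous_snd.comp continuous_snd)
  have hw : ContinuousOn w (FrameBundle.proj ⁻¹' V) := by
    have hq : Topology.IsQuotientMap (Quotient.mk (frameSetoid ρ EH)) := isQuotientMap_quotient_mk'
    rw [hq.continuousOn_isOpen_iff hVF]
    rintro ⟨x, u, e⟩ he
    have he' : s i e ≠ 0 := (hVmk x e).1 he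
    refine ContinuousAt.continuousWithinAt ?_
    have h1 : ContinuousAt (fun p : Ball k × O k × EH => p.2.1 * ρ (τ i p.2.2)) (x, u, e) :=
      ContinuousAt.mul (by fun_prop) (hρ.continuousAt.comp
        (ContinuousAt.comp (f := fun p : Ball k × O k × EH => p.2.2) (hτc e he') (by fun_prop)))
    refine h1.congr ?_
    have h2 : ∀ᶠ p : Ball k × O k × EH in 𝓝 (x, u, e), s i p.2.2 ≠ 0 :=
      (Continuous.tendsto (f := fun p : Ball k × O k × EH => p.2.2) (by fun_prop) (x, u, e))
        (hV.mem_nhds he')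
    refine h2.mono fun p hp => ?_
    exact (if_pos hp).symm
  -- the local trivialization of the state bundle
  let frame : ∀ f : StateBundle ρ EH Y, {p : FrameBundle ρ EH // p.proj = f.base} := fun f =>
    ⟨Quotient.mk _ (f.base.out.1, 1, f.base.out.2), Quotient.out_eq f.base⟩
  let Ψ : StateBundle ρ EH Y → Y := fun f => (w (frame f).1)⁻¹ • f.state (frame f)
  have hΨ : ∀ z : FramedState ρ EH Y, z.frame.proj ∈ V →
      Ψ z.point = (w z.frame)⁻¹ • z.point.state ⟨z.frame, z.proj_eq⟩ := by
    rintro ⟨p, f, hp⟩ hpV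
    have key : ∀ p' : {p : FrameBundle ρ EH // p.proj = f.base},
        (w p'.1)⁻¹ • f.state p' = (w p)⁻¹ • f.state ⟨p, hp⟩ := by
      rintro ⟨p', hp'⟩
      obtain ⟨x, u, e⟩ := p
      obtain ⟨x', u', e'⟩ := p'
      have he : s i e ≠ 0 := (hVmk x e).1 hpV
      obtain ⟨h, hh⟩ := Quotient.exact (hp.trans hp'.symm)
      obtain rfl : x' = ρ h • x := (Prod.ext_iff.1 hh).1
      obtain rfl : e' = h • e := (Prod.ext_iff.1 hh).2
      have hfr : (Quotient.mk _ (ρ h • x, u', h • e) : FrameBundle ρ EH) =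
          (u' * ρ h * u⁻¹) • (Quotient.mk _ (x, u, e) : FrameBundle ρ EH) := by
        refine (Quotient.sound ⟨h, ?_⟩ : (Quotient.mk (frameSetoid ρ EH)
          (x, u' * ρ h * u⁻¹ * u, e)) = _).symm
        simp
      have h1 := f.equivariant (u' * ρ h * u⁻¹) ⟨Quotient.mk _ (x, u, e), hp⟩
      have h2 : f.state ⟨Quotient.mk _ (ρ h • x, u', h • e), hp'⟩ =
          (u' * ρ h * u⁻¹) • f.state ⟨Quotient.mk _ (x, u, e), hp⟩ := by
        rw [← h1]
        congr 1
        exact Subtype.ext hfr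
      have hw1 : w (Quotient.mk _ (x, u, e)) = u * ρ (τ i e) := if_pos he
      have hw2 : w (Quotient.mk _ (ρ h • x, u', h • e)) = u' * ρ (τ i (h • e)) :=
        if_pos (by rwa [hinv])
      change (w (Quotient.mk _ (ρ h • x, u', h • e)))⁻¹ • f.state _ =
        (w (Quotient.mk _ (x, u, e)))⁻¹ • f.state _
      refine (congrArg _ h2).trans ?_
      rw [hw1, hw2, hτ i h e he, map_mul, smul_smul]
      congr 1
      group
    exact key _
  have hq : Topology.IsQuotientMap (fun z : FramedState ρ EH Y => z.point) :=
    ⟨⟨rfl⟩, fun f => ⟨⟨(frame f).1, f, (frame f).2⟩, rfl⟩⟩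
  have hpair : Continuous fun z : FramedState ρ EH Y =>
    (z.frame, z.point.state ⟨z.frame, z.proj_eq⟩) := continuous_induced_dom
  have hVSo : IsOpen ((fun z : FramedState ρ EH Y => z.frame.proj) ⁻¹' V) :=
    hVF.preimage (continuous_fst.comp hpair)
  have hVSe : (fun z : FramedState ρ EH Y => z.point) ⁻¹' (StateBundle.base ⁻¹' V) =
      (fun z : FramedState ρ EH Y => z.frame.proj) ⁻¹' V := by
    ext z
    simp only [Set.mem_preimage, z.proj_eq]
  have hVS : IsOpen (StateBundle.base ⁻¹' V : Set (StateBundle ρ EH Y)) := by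
    rw [← hq.isOpen_preimage, hVSe]
    exact hVSo
  have hΨc : ContinuousOn Ψ (StateBundle.base ⁻¹' V) := by
    rw [hq.continuousOn_isOpen_iff hVS, hVSe]
    have h1 : ContinuousOn (fun z : FramedState ρ EH Y =>
        (w z.frame)⁻¹ • z.point.state ⟨z.frame, z.proj_eq⟩)
        ((fun z : FramedState ρ EH Y => z.frame.proj) ⁻¹' V) := by
      have h2 : ContinuousOn (fun z : FramedState ρ EH Y => w z.frame)
          ((fun z : FramedState ρ EH Y => z.frame.proj) ⁻¹' V) :=
        hw.comp hpair.fst.continuousOn fun z hz => hz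
      exact h2.inv.smul hpair.snd.continuousOn
    exact h1.congr fun z hz => hΨ z hz
  -- the value of a section in the local trivialization
  have hval : ∀ t x e, s i e ≠ 0 →
      ρ (τ i e) • Ψ ((S t).1 (Quotient.mk _ (x, e))) = (S t).std (x, e) := fun t x e he => by
    have h1 := hΨ ⟨Quotient.mk _ (x, 1, e), (S t).1 (Quotient.mk _ (x, e)), ((S t).2 _).symm⟩
      ((hVmk x e).2 he)
    have h2 : w (Quotient.mk _ (x, 1, e)) = ρ (τ i e) := (if_pos he).trans (one_mul _)
    rw [h1, h2, smul_inv_smul]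
    rfl
  have he₀ : s i e₀ ≠ 0 := by rw [hi]; exact one_ne_zero
  have h1 : ContinuousAt (fun z : T × Ball k × EH => ρ (τ i z.2.2)) (t₀, x₀, e₀) :=
    hρ.continuousAt.comp (ContinuousAt.comp (f := fun z : T × Ball k × EH => z.2.2)
      (hτc e₀ he₀) (by fun_prop))
  have h2 : ContinuousAt (fun z : T × Ball k × EH => Ψ ((S z.1).1 (Quotient.mk _ z.2)))
      (t₀, x₀, e₀) := by
    refine ContinuousAt.comp (g := Ψ)
      (f := fun z : T × Ball k × EH => (S z.1).1 (Quotient.mk _ z.2)) ?_ ?_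
    · refine hΨc.continuousAt (hVS.mem_nhds ?_)
      change ((S t₀).1 _).base ∈ V
      rw [(S t₀).2]
      exact (hVmk x₀ e₀).2 he₀
    · exact (hS.comp (continuous_fst.prodMk
        (continuous_quotient_mk'.comp continuous_snd))).continuousAt
  have h3 : ∀ᶠ z : T × Ball k × EH in 𝓝 (t₀, x₀, e₀), s i z.2.2 ≠ 0 :=
    (Continuous.tendsto (f := fun z : T × Ball k × EH => z.2.2) (by fun_prop) (t₀, x₀, e₀))
      (hV.mem_nhds he₀)
  exact (h1.smul h2).congr (h3.mono fun z hz => hval z.1 z.2.1 z.2.2 hz)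

end Standard

/-! ### Homotopies of loop-valued maps that reparametrize the boundary loops -/

section Label

variable {X : Type u} [TopologicalSpace X] {pt : X} {a b : I}

/-- The loop `γ`, run through according to a path of parameters with ends in `{0, 1}`. -/
def relabel (γ : Path pt pt) (φ : Path a b) (ha : a = 0 ∨ a = 1) (hb : b = 0 ∨ b = 1) :
    Path pt pt where
  toFun τ := γ (φ τ)
  continuous_toFun := by fun_prop
  source' := by rcases ha with rfl | rfl <;> simp
  target' := by rcases hb with rfl | rfl <;> simp

theorem continuous_relabel {A : Type*} [TopologicalSpace A] {γ : A → Path pt pt} {φ : A → Path a b}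
    (ha : a = 0 ∨ a = 1) (hb : b = 0 ∨ b = 1) (hγ : Continuous γ) (hφ : Continuous φ) :
    Continuous fun q => relabel (γ q) (φ q) ha hb := by
  refine Path.continuous_uncurry_iff.1 ?_
  change Continuous fun q : A × I => γ q.1 (φ q.1 q.2)
  fun_prop

/-- The path `φ'`, kept within distance `r` of `φ`. -/
def clampPath (φ φ' : Path a b) (r : I) : Path a b where
  toFun τ := ⟨max ((φ τ : ℝ) - r) (min (φ' τ) (φ τ + r)),
    le_max_of_le_right (le_min (φ' τ).2.1 (add_nonneg (φ τ).2.1 r.2.1)),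
    max_le (by linarith [(φ τ).2.2, r.2.1]) (min_le_of_left_le (φ' τ).2.2)⟩
  continuous_toFun := by fun_prop
  source' := Subtype.ext (by
    have := r.2.1
    simp [this])
  target' := Subtype.ext (by
    have := r.2.1
    simp [this])

theorem clampPath_zero (φ φ' : Path a b) : clampPath φ φ' 0 = φ := by
  ext τ
  simp [clampPath]

theorem clampPath_eq {φ φ' : Path a b} {r : I} (h : ∀ τ, |(φ τ : ℝ) - φ' τ| ≤ r) :
    clampPath φ φ' r = φ' := by
  ext τ
  have := abs_le.1 (h τ)
  change max ((φ τ : ℝ) - r) (min (φ' τ) (φ τ + r)) = φ' τ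
  rw [min_eq_left (by linarith), max_eq_right (by linarith)]

theorem continuous_clampPath {A : Type*} [TopologicalSpace A] {φ φ' : A → Path a b} {r : A → I}
    (hφ : Continuous φ) (hφ' : Continuous φ') (hr : Continuous r) :
    Continuous fun q => clampPath (φ q) (φ' q) (r q) := by
  refine Path.continuous_uncurry_iff.1 (Continuous.subtype_mk
    (f := fun q : A × I => max ((φ q.1 q.2 : ℝ) - r q.1)
      (min (φ' q.1 q.2 : ℝ) (φ q.1 q.2 + r q.1))) ?_ _)
  fun_prop

theorem continuous_eval_homotopy {φ φ' : Path a b} (Φ : φ.Homotopy φ') :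
    Continuous fun t => Φ.eval t :=
  Path.continuous_uncurry_iff.1 Φ.continuous

end Label

section Labelled

variable {H : Type v} [Group H] {k : ℕ} (ρ : H →* O k) {EH : Type w} [MulAction H EH]
  {X : Type u} [TopologicalSpace X] {pt : X} (act : O k → X → X)

/-- Equivariant families `z` of loops on `B^k × EH` that are, over the boundary, the loops `γ` run
through according to `φ`. The label `φ` is itself a path in the unit interval. -/
structure IsLabelled (γ : Ball k × EH → Path pt pt) {a b : I} (z : Ball k × EH → Path pt pt)
    (φ : Path a b) : Prop where
  smul : ∀ h x e τ, z (ρ h • x, h • e) τ = act (ρ h) (z (x, e) τ)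
  boundary : ∀ x e τ, ‖x.1‖ = 1 → z (x, e) τ = γ (x, e) (φ τ)

section Basic

variable {ρ act} {γ : Ball k × EH → Path pt pt} {a b c : I} {z w : Ball k × EH → Path pt pt}
  {φ : Path a b}

theorem IsLabelled.congr {γ' : Ball k × EH → Path pt pt} (h : IsLabelled ρ act γ z φ)
    (hγ : ∀ x e, ‖x.1‖ = 1 → γ (x, e) = γ' (x, e)) : IsLabelled ρ act γ' z φ :=
  ⟨h.smul, fun x e τ hx => by rw [h.boundary x e τ hx, hγ x e hx]⟩

theorem IsLabelled.trans {ψ : Path b c}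
    (hz : IsLabelled ρ act γ z φ) (hw : IsLabelled ρ act γ w ψ) :
    IsLabelled ρ act γ (fun p => (z p).trans (w p)) (φ.trans ψ) := by
  refine ⟨fun g x e τ => ?_, fun x e τ hx => ?_⟩
  · rw [Path.trans_apply, Path.trans_apply]
    split_ifs
    · exact hz.smul g x e _
    · exact hw.smul g x e _
  · rw [Path.trans_apply, Path.trans_apply]
    split_ifs
    · exact hz.boundary x e _ hx
    · exact hw.boundary x e _ hx

theorem IsLabelled.symm (hz : IsLabelled ρ act γ z φ) :
    IsLabelled ρ act γ (fun p => (z p).symm) φ.symm :=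
  ⟨fun g x e τ => hz.smul g x e (σ τ), fun x e τ hx => hz.boundary x e (σ τ) hx⟩

end Basic

variable [TopologicalSpace EH]

/-- Homotopy through labelled families of loops. Since all homotopies of labels with given ends are
homotopic, only the ends matter: see `LoopHomotopic.exists_relabel`. -/
def LoopHomotopic (γ : Ball k × EH → Path pt pt) {a b : I} (z : C(Ball k × EH, Path pt pt))
    (φ : Path a b) (z' : C(Ball k × EH, Path pt pt)) (φ' : Path a b) : Prop :=
  ∃ (V : z.Homotopy z') (Φ : φ.Homotopy φ'),
    ∀ t, IsLabelled ρ act γ (fun p => V (t, p)) (Φ.eval t)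

variable {ρ act} {γ : Ball k × EH → Path pt pt} {a b c : I}
  {z z' z'' w w' : C(Ball k × EH, Path pt pt)} {φ φ' φ'' : Path a b}

theorem LoopHomotopic.mk (V : I → Ball k × EH → Path pt pt)
    (hV : Continuous fun q : I × Ball k × EH => V q.1 q.2) (Φ : φ.Homotopy φ')
    (h : ∀ t, IsLabelled ρ act γ (V t) (Φ.eval t)) (h0 : ∀ p, V 0 p = z p)
    (h1 : ∀ p, V 1 p = z' p) : LoopHomotopic ρ act γ z φ z' φ' :=
  ⟨⟨⟨_, hV⟩, h0, h1⟩, Φ, h⟩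

theorem LoopHomotopic.symm (h : LoopHomotopic ρ act γ z φ z' φ') :
    LoopHomotopic ρ act γ z' φ' z φ := by
  obtain ⟨V, Φ, h⟩ := h
  refine ⟨V.symm, Φ.symm, fun t => ⟨fun g x e τ => ?_, fun x e τ hx => ?_⟩⟩
  · exact (h (σ t)).smul g x e τ
  · exact (h (σ t)).boundary x e τ hx

theorem LoopHomotopic.trans (h : LoopHomotopic ρ act γ z φ z' φ')
    (h' : LoopHomotopic ρ act γ z' φ' z'' φ'') : LoopHomotopic ρ act γ z φ z'' φ'' := by
  obtain ⟨V, Φ, h⟩ := h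
  obtain ⟨V', Φ', h'⟩ := h'
  refine ⟨V.trans V', Φ.trans Φ', fun t => ⟨fun g x e τ => ?_, fun x e τ hx => ?_⟩⟩
  · rw [ContinuousMap.Homotopy.trans_apply, ContinuousMap.Homotopy.trans_apply]
    split_ifs with ht
    · exact (h _).smul g x e τ
    · exact (h' _).smul g x e τ
  · change _ = γ (x, e) ((Φ.trans Φ') (t, τ))
    rw [ContinuousMap.Homotopy.trans_apply, Path.Homotopy.trans_apply]
    split_ifs with ht
    · exact (h _).boundary x e τ hx
    · exact (h' _).boundary x e τ hx

theorem LoopHomotopic.refl (h : IsLabelled ρ act γ z φ) : LoopHomotopic ρ act γ z φ z φ :=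
  .mk (fun _ => z) (by fun_prop) (Path.Homotopy.refl φ) (fun t => by
    have : (Path.Homotopy.refl φ).eval t = φ := rfl
    rwa [this]) (fun _ => rfl) fun _ => rfl

theorem LoopHomotopic.left (h : LoopHomotopic ρ act γ z φ z' φ') : IsLabelled ρ act γ z φ := by
  obtain ⟨V, Φ, h⟩ := h
  simpa using h 0

theorem LoopHomotopic.right (h : LoopHomotopic ρ act γ z φ z' φ') : IsLabelled ρ act γ z' φ' :=
  h.symm.left

theorem LoopHomotopic.congr {γ' : Ball k × EH → Path pt pt}
    (h : LoopHomotopic ρ act γ z φ z' φ')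
    (hγ : ∀ x e, ‖x.1‖ = 1 → γ (x, e) = γ' (x, e)) : LoopHomotopic ρ act γ' z φ z' φ' := by
  obtain ⟨V, Φ, h⟩ := h
  exact ⟨V, Φ, fun t => (h t).congr hγ⟩

theorem loopAdd_apply (z w : C(Ball k × EH, Path pt pt)) (p : Ball k × EH) :
    loopAdd z w p = (z p).trans (w p) := rfl

theorem IsLabelled.loopAdd {ψ : Path b c} (hz : IsLabelled ρ act γ z φ)
    (hw : IsLabelled ρ act γ w ψ) : IsLabelled ρ act γ (loopAdd z w) (φ.trans ψ) :=
  hz.trans hw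

theorem IsLabelled.loopNeg (hz : IsLabelled ρ act γ z φ) :
    IsLabelled ρ act γ (loopNeg z) φ.symm :=
  hz.symm

theorem LoopHomotopic.loopAdd {ψ ψ' : Path b c} (hz : LoopHomotopic ρ act γ z φ z' φ')
    (hw : LoopHomotopic ρ act γ w ψ w' ψ') :
    LoopHomotopic ρ act γ (loopAdd z w) (φ.trans ψ) (loopAdd z' w') (φ'.trans ψ') := by
  obtain ⟨V, Φ, hV⟩ := hz
  obtain ⟨W, Ψ, hW⟩ := hw
  have hVW : Continuous fun q : I × Ball k × EH => (V q).trans (W q) := by fun_prop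
  refine .mk (fun t p => (V (t, p)).trans (W (t, p))) hVW (Φ.hcomp Ψ)
    (fun t => ?_) (fun p => by simp [loopAdd_apply]) (fun p => by simp [loopAdd_apply])
  exact (hV t).trans (hW t)

/-- Precomposition of all loops with a homotopy of maps of the unit interval that is constant on the
ends. -/
theorem LoopHomotopic.of_reparam {a' b' : I} {χ χ' : Path a' b'} (hz : IsLabelled ρ act γ z φ)
    (Ψ : C(I × I, I)) (h0 : ∀ t, Ψ (t, 0) = Ψ (0, 0)) (h1 : ∀ t, Ψ (t, 1) = Ψ (0, 1))
    (e0 : Ψ (0, 0) = 0 ∨ Ψ (0, 0) = 1) (e1 : Ψ (0, 1) = 0 ∨ Ψ (0, 1) = 1)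
    (hw : ∀ p τ, w p τ = z p (Ψ (0, τ))) (hw' : ∀ p τ, w' p τ = z p (Ψ (1, τ)))
    (hχ : ∀ τ, χ τ = φ (Ψ (0, τ))) (hχ' : ∀ τ, χ' τ = φ (Ψ (1, τ))) :
    LoopHomotopic ρ act γ w χ w' χ' := by
  have hend : ∀ p (j : I), j = 0 ∨ j = 1 → z p j = pt := by
    rintro p j (rfl | rfl) <;> simp
  refine .mk (fun t p =>
    { toFun := fun τ => z p (Ψ (t, τ))
      continuous_toFun := by fun_prop
      source' := by rw [h0]; exact hend p _ e0
      target' := by rw [h1]; exact hend p _ e1 }) ?_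
    { toFun := fun q => φ (Ψ q)
      continuous_toFun := by fun_prop
      map_zero_left := fun τ => (hχ τ).symm
      map_one_left := fun τ => (hχ' τ).symm
      prop' := ?_ } (fun t => ⟨fun g x e τ => hz.smul g x e _, fun x e τ hx =>
        hz.boundary x e _ hx⟩) (fun p => Path.ext (funext fun τ => (hw p τ).symm))
        (fun p => Path.ext (funext fun τ => (hw' p τ).symm))
  · refine Path.continuous_uncurry_iff.1 ?_
    change Continuous fun q : (I × Ball k × EH) × I => z q.1.2 (Ψ (q.1.1, q.2))
    fun_prop
  · rintro t τ (rfl | rfl)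
    · change φ (Ψ (t, 0)) = χ 0
      rw [hχ, h0]
    · change φ (Ψ (t, 1)) = χ 1
      rw [hχ, h1]

theorem LoopHomotopic.reparam (hz : IsLabelled ρ act γ z φ) {f : I → I} (hf : Continuous f)
    (f0 : f 0 = 0) (f1 : f 1 = 1) {χ : Path a b} (hw : ∀ p, w p = (z p).reparam f hf f0 f1)
    (hχ : χ = φ.reparam f hf f0 f1) : LoopHomotopic ρ act γ w χ z φ := by
  let Ψ : C(I × I, I) := ⟨fun p => ⟨(1 - (p.1 : ℝ)) * f p.2 + p.1 * p.2,
      (convex_Icc (0 : ℝ) 1) (f p.2).2 p.2.2 (by linarith [p.1.2.2]) p.1.2.1 (by ring)⟩,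
      by fun_prop⟩
  have h0 : ∀ t, Ψ (t, 0) = 0 := fun t => Subtype.ext (by simp [Ψ, f0])
  have h1 : ∀ t, Ψ (t, 1) = 1 := fun t => Subtype.ext (by simp [Ψ, f1])
  have hΨ0 : ∀ τ, Ψ (0, τ) = f τ := fun τ => Subtype.ext (by simp [Ψ])
  have hΨ1 : ∀ τ, Ψ (1, τ) = τ := fun τ => Subtype.ext (by simp [Ψ])
  refine .of_reparam hz Ψ (fun t => by rw [h0, h0]) (fun t => by rw [h1, h1]) (.inl (h0 0))
    (.inr (h1 0)) (fun p τ => ?_) (fun p τ => ?_) (fun τ => ?_) (fun τ => ?_)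
  · rw [hw, hΨ0]
    rfl
  · rw [hΨ1]
  · rw [hχ, hΨ0]
    rfl
  · rw [hΨ1]

theorem LoopHomotopic.add_assoc {d : I} {ψ : Path b c} {χ : Path c d}
    {z₁ z₂ z₃ : C(Ball k × EH, Path pt pt)} (h₁ : IsLabelled ρ act γ z₁ φ)
    (h₂ : IsLabelled ρ act γ z₂ ψ) (h₃ : IsLabelled ρ act γ z₃ χ) :
    LoopHomotopic ρ act γ (ThomTorsor.loopAdd (ThomTorsor.loopAdd z₁ z₂) z₃)
      ((φ.trans ψ).trans χ) (ThomTorsor.loopAdd z₁ (ThomTorsor.loopAdd z₂ z₃))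
      (φ.trans (ψ.trans χ)) :=
  .reparam (h₁.loopAdd (h₂.loopAdd h₃)) _ _ _
    (fun p => Path.Homotopy.trans_assoc_reparam (z₁ p) (z₂ p) (z₃ p))
    (Path.Homotopy.trans_assoc_reparam _ _ _)

theorem LoopHomotopic.add_zero (h : IsLabelled ρ act γ z φ) :
    LoopHomotopic ρ act γ
      (ThomTorsor.loopAdd z (ContinuousMap.const _ (Path.refl pt))) (φ.trans (Path.refl b)) z φ :=
  .reparam h _ _ _ (fun p => Path.Homotopy.trans_refl_reparam (z p))
    (Path.Homotopy.trans_refl_reparam _)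

theorem LoopHomotopic.add_neg (h : IsLabelled ρ act γ z φ) :
    LoopHomotopic ρ act γ (ThomTorsor.loopAdd z (ThomTorsor.loopNeg z)) (φ.trans φ.symm)
      (ContinuousMap.const _ (Path.refl pt)) (Path.refl a) := by
  refine LoopHomotopic.symm (.of_reparam h ⟨fun p => ⟨Path.Homotopy.reflTransSymmAux p,
    Path.Homotopy.reflTransSymmAux_mem_I p⟩, by fun_prop⟩ (fun t => ?_) (fun t => ?_)
    (.inl ?_) (.inl ?_) (fun p τ => ?_) (fun p τ => ?_) (fun τ => ?_) fun τ => ?_)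
  · apply Subtype.ext
    simp [Path.Homotopy.reflTransSymmAux]
  · apply Subtype.ext
    norm_num [Path.Homotopy.reflTransSymmAux]
  · apply Subtype.ext
    simp [Path.Homotopy.reflTransSymmAux]
  · apply Subtype.ext
    norm_num [Path.Homotopy.reflTransSymmAux]
  · exact ((Path.Homotopy.reflTransSymm (z p)).apply_zero τ).symm
  · exact ((Path.Homotopy.reflTransSymm (z p)).apply_one τ).symm
  · exact ((Path.Homotopy.reflTransSymm φ).apply_zero τ).symm
  · exact ((Path.Homotopy.reflTransSymm φ).apply_one τ).symm

theorem LoopHomotopic.neg_add (h : IsLabelled ρ act γ z φ) :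
    LoopHomotopic ρ act γ (ThomTorsor.loopAdd (ThomTorsor.loopNeg z) z) (φ.symm.trans φ)
      (ContinuousMap.const _ (Path.refl pt)) (Path.refl b) := by
  have h1 := LoopHomotopic.add_neg h.loopNeg
  have h2 : ThomTorsor.loopNeg (ThomTorsor.loopNeg z) = z := by
    ext1 p
    exact Path.symm_symm _
  rwa [h2, Path.symm_symm] at h1

/-- A homotopy of labelled families of loops can be modified near the boundary so as to follow any
other homotopy of labels with the same ends. The modification takes place in a collar whose width
at a time `t` is the distance of the two labels at that time, so that the ends stay the same. -/
theorem LoopHomotopic.exists_relabel (hγ : Continuous γ)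
    (hγs : ∀ h x e τ, γ (ρ h • x, h • e) τ = act (ρ h) (γ (x, e) τ))
    (ha : a = 0 ∨ a = 1) (hb : b = 0 ∨ b = 1) (h : LoopHomotopic ρ act γ z φ z' φ')
    (Φ' : φ.Homotopy φ') :
    ∃ V : z.Homotopy z', ∀ t, IsLabelled ρ act γ (fun p => V (t, p)) (Φ'.eval t) := by
  obtain ⟨V, Φ, hV⟩ := h
  have hΦ := continuous_eval_homotopy Φ
  have hΦ' := continuous_eval_homotopy Φ'
  let l : I → I := fun t =>
    Set.projIcc 0 1 zero_le_one (dist (Φ.eval t).toContinuousMap (Φ'.eval t).toContinuousMap)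
  have hl : Continuous l := continuous_projIcc.comp
    (Continuous.dist (continuous_induced_dom.comp hΦ) (continuous_induced_dom.comp hΦ'))
  have hl0 : l 0 = 0 := by simp [l]
  have hl1 : l 1 = 0 := by simp [l]
  have hle : ∀ t τ, |(Φ.eval t τ : ℝ) - Φ'.eval t τ| ≤ l t := fun t τ => by
    have h1 := ContinuousMap.dist_apply_le_dist (f := (Φ.eval t).toContinuousMap)
      (g := (Φ'.eval t).toContinuousMap) τ
    rw [Subtype.dist_eq, Real.dist_eq] at h1
    have h2 : |(Φ.eval t τ : ℝ) - Φ'.eval t τ| ≤ 1 :=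
      abs_sub_le_iff.2 ⟨by linarith [(Φ.eval t τ).2.2, (Φ'.eval t τ).2.1],
        by linarith [(Φ.eval t τ).2.1, (Φ'.eval t τ).2.2]⟩
    refine le_trans (le_min h2 h1) ?_
    rw [Set.coe_projIcc]
    exact le_max_right _ _
  let b' : I → EH → I → Ball k → Path pt pt := fun t e r x =>
    relabel (γ (x, e)) (clampPath (Φ.eval t) (Φ'.eval t) r) ha hb
  have hb0 : ∀ t e x, ‖x.1‖ = 1 → b' t e 0 x = V (t, (x, e)) := fun t e x hx => by
    ext τ
    change γ (x, e) (clampPath (Φ.eval t) (Φ'.eval t) 0 τ) = _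
    rw [clampPath_zero, (hV t).boundary x e τ hx]
  let V' : I × Ball k × EH → Path pt pt := fun q =>
    withCollar (l q.1) (fun x => V (q.1, (x, q.2.2))) (b' q.1 q.2.2) q.2.1
  have hV' : Continuous V' := by
    refine continuous_withCollar (hl.comp continuous_fst) continuous_snd.fst ?_ ?_ fun q x hx =>
      hb0 q.1 q.2.2 x hx
    · exact V.continuous.comp (f := fun q : (I × Ball k × EH) × Ball k =>
        (q.1.1, (q.2, q.1.2.2))) (by fun_prop)
    · refine continuous_relabel ha hb (hγ.comp (f := fun q : (I × Ball k × EH) × I × Ball k =>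
        (q.2.2, q.1.2.2)) (by fun_prop)) (continuous_clampPath
          (hΦ.comp (f := fun q : (I × Ball k × EH) × I × Ball k => q.1.1) (by fun_prop))
          (hΦ'.comp (f := fun q : (I × Ball k × EH) × I × Ball k => q.1.1) (by fun_prop))
          (by fun_prop))
  refine ⟨⟨⟨V', hV'⟩, fun p => ?_, fun p => ?_⟩, fun t => ⟨fun g x e τ => ?_, fun x e τ hx => ?_⟩⟩
  · change V' (0, p) = _
    simp only [V', hl0, withCollar_zero]
    exact V.map_zero_left p
  · change V' (1, p) = _
    simp only [V', hl1, withCollar_zero]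
    exact V.map_one_left p
  · change (withCollar (l t) (fun x => V (t, (x, g • e))) (b' t (g • e)) (ρ g • x)) τ =
      act (ρ g) ((withCollar (l t) (fun x => V (t, (x, e))) (b' t e) x) τ)
    rw [map_withCollar (l t) (fun δ : Path pt pt => δ τ),
      map_withCollar (l t) (fun δ : Path pt pt => δ τ)]
    refine withCollar_smul (l t) (f := fun x => V (t, (x, e)) τ) (b := fun r x => b' t e r x τ)
      (ρ g) (act (ρ g)) (fun x => (hV t).smul g x e τ) (fun r x => hγs g x e _) x
  · refine (congrArg (fun δ : Path pt pt => δ τ)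
      (withCollar_of_norm_eq_one (l t) (hb0 t e) hx)).trans ?_
    change γ (x, e) (clampPath (Φ.eval t) (Φ'.eval t) (l t) τ) = _
    rw [clampPath_eq (hle t)]

/-- Homotopies of labels extend to labelled families of loops. -/
theorem LoopHomotopic.exists_of_label (hγ : Continuous γ)
    (hγs : ∀ h x e τ, γ (ρ h • x, h • e) τ = act (ρ h) (γ (x, e) τ))
    (ha : a = 0 ∨ a = 1) (hb : b = 0 ∨ b = 1) (h : IsLabelled ρ act γ z φ) (Φ : φ.Homotopy φ') :
    ∃ z' : C(Ball k × EH, Path pt pt), LoopHomotopic ρ act γ z φ z' φ' := by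
  have hΦ := continuous_eval_homotopy Φ
  let b' : EH → I → Ball k → Path pt pt := fun e r x => relabel (γ (x, e)) (Φ.eval r) ha hb
  have hb0 : ∀ e x, ‖x.1‖ = 1 → b' e 0 x = z (x, e) := fun e x hx => by
    ext τ
    change γ (x, e) (Φ.eval 0 τ) = _
    rw [Path.Homotopy.eval_zero, h.boundary x e τ hx]
  let V : I × Ball k × EH → Path pt pt := fun q =>
    withCollar q.1 (fun x => z (x, q.2.2)) (b' q.2.2) q.2.1
  have hV : Continuous V := by
    refine continuous_withCollar continuous_fst continuous_snd.fst ?_ ?_ fun q x hx =>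
      hb0 q.2.2 x hx
    · exact z.continuous.comp (f := fun q : (I × Ball k × EH) × Ball k =>
        (q.2, q.1.2.2)) (by fun_prop)
    · exact continuous_relabel ha hb (hγ.comp (f := fun q : (I × Ball k × EH) × I × Ball k =>
        (q.2.2, q.1.2.2)) (by fun_prop))
          (hΦ.comp (f := fun q : (I × Ball k × EH) × I × Ball k => q.2.1) (by fun_prop))
  refine ⟨⟨fun p => V (1, p), by fun_prop⟩, .mk (fun t p => V (t, p)) hV Φ
    (fun t => ⟨fun g x e τ => ?_, fun x e τ hx => ?_⟩) (fun p => ?_) fun p => rfl⟩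
  · change (withCollar t (fun x => z (x, g • e)) (b' (g • e)) (ρ g • x)) τ =
      act (ρ g) ((withCollar t (fun x => z (x, e)) (b' e) x) τ)
    rw [map_withCollar t (fun δ : Path pt pt => δ τ),
      map_withCollar t (fun δ : Path pt pt => δ τ)]
    exact withCollar_smul t (f := fun x => z (x, e) τ) (b := fun r x => b' e r x τ)
      (ρ g) (act (ρ g)) (fun x => h.smul g x e τ) (fun r x => hγs g x e _) x
  · exact congrArg (fun δ : Path pt pt => δ τ) (withCollar_of_norm_eq_one t (hb0 e) hx)
  · exact withCollar_zero _ _ _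

end Labelled

/-! ### Addition of sections by means of loops -/

section LoopSum

variable (Θ : OrthogonalSpectrum.{u}) (q k : ℕ)

/-- The adjoint structure map, as a map of spaces with an action of `O(k)`. -/
def loopMap : C(Θ.Twisted q k, Θ.LoopTwisted q k) := Θ.adjoint (q + k)

/-- The action of `O(k)` on `Θ_{q+k+1}` that induces the one on `ΩΘ_{q+k+1}`. -/
def loopAct (g : O k) (x : Θ.space (q + k + 1)) : Θ.space (q + k + 1) :=
  blockSum (q + k) 1 (blockSum q k (1, g), 1) • x

theorem str_smul (n : ℕ) (A : O n) (x : Θ.space n) (z : OnePoint ℝ) :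
    Θ.str n (A • x, z) = blockSum n 1 (A, 1) • Θ.str n (x, z) := by
  induction z using OnePoint.rec with
  | infty => rw [Θ.str_infty, Θ.str_infty, Θ.smul_pt]
  | coe y =>
    have h := Θ.iter_smul n 1 A 1 x (fun _ => y)
    have h1 : (1 : O 1).1.mulVec (fun _ : Fin 1 => y) = fun _ => y := by simp
    rw [h1] at h
    exact h

theorem loopMap_smul (g : O k) (y : Θ.Twisted q k) :
    loopMap Θ q k (g • y) = g • loopMap Θ q k y :=
  Path.ext (funext fun t => str_smul Θ (q + k) (blockSum q k (1, g)) y (collapseI t))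

variable {Θ q k} {H : Type v} [Group H] {ρ : H →* O k} {EH : Type w} [MulAction H EH]
  [TopologicalSpace EH]

/-- The loops that are adjoint to a map into `Θ_{q+k}`. -/
def loops (f : C(Ball k × EH, Θ.Twisted q k)) : C(Ball k × EH, Θ.Loops (q + k + 1)) :=
  (loopMap Θ q k).comp f

theorem loops_apply (f : C(Ball k × EH, Θ.Twisted q k)) (p : Ball k × EH) :
    loops f p = Θ.adjoint (q + k) (f p) := rfl

theorem adjoint_pt (n : ℕ) : Θ.adjoint n (Θ.pt n) = Path.refl (Θ.pt (n + 1)) :=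
  Path.ext (funext fun _ => Θ.str_pt n _)

/-- The function that is constant at the base point. -/
def vacuum (Θ : OrthogonalSpectrum.{u}) (q k : ℕ) (EH : Type w) : Ball k × EH → Θ.Twisted q k :=
  fun _ => Θ.pt (q + k)

section Bridge

variable {a b : I} {φ : Path a b} {γ : Ball k × EH → Θ.Loops (q + k + 1)}
  {s f g : C(Ball k × EH, Θ.LoopTwisted q k)}

theorem RelHomotopic.loopHomotopic {s : Ball k × EH → Θ.LoopTwisted q k}
    (hs : ∀ x e τ, ‖x.1‖ = 1 → (show Θ.Loops (q + k + 1) from s (x, e)) τ = γ (x, e) (φ τ))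
    (h : RelHomotopic ρ s f g) :
    LoopHomotopic (pt := Θ.pt (q + k + 1)) ρ (loopAct Θ q k) γ f φ g φ := by
  obtain ⟨F, hF, hFs, hF0, hF1⟩ := h.exists
  refine .mk (pt := Θ.pt (q + k + 1)) F hF (Path.Homotopy.refl φ)
    (fun t => ⟨fun h x e τ => ?_, fun x e τ hx => ?_⟩) hF0 hF1
  · have h1 := (hFs t).smul h x e
    exact congrArg (fun δ : Θ.Loops (q + k + 1) => δ τ) h1
  · have h1 := (hFs t).boundary x e hx
    exact (congrArg (fun δ : Θ.Loops (q + k + 1) => δ τ) h1).trans (hs x e τ hx)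

theorem LoopHomotopic.relHomotopic {s : Ball k × EH → Θ.LoopTwisted q k} (hγ : Continuous γ)
    (hγs : ∀ h x e τ, γ (ρ h • x, h • e) τ = loopAct Θ q k (ρ h) (γ (x, e) τ))
    (ha : a = 0 ∨ a = 1) (hb : b = 0 ∨ b = 1)
    (hs : ∀ x e τ, ‖x.1‖ = 1 → (show Θ.Loops (q + k + 1) from s (x, e)) τ = γ (x, e) (φ τ))
    (h : LoopHomotopic (pt := Θ.pt (q + k + 1)) ρ (loopAct Θ q k) γ f φ g φ) :
    RelHomotopic ρ s f g := by
  obtain ⟨V, hV⟩ := h.exists_relabel hγ hγs ha hb (Path.Homotopy.refl φ)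
  refine .mk (fun t p => V.toFun (t, p)) V.continuous (fun t => ⟨fun h x e => ?_, fun x e hx => ?_⟩)
    V.map_zero_left V.map_one_left
  · exact Path.ext (funext fun τ => (hV t).smul h x e τ)
  · exact Path.ext (funext fun τ => ((hV t).boundary x e τ hx).trans (hs x e τ hx).symm)

end Bridge

variable {α α' β δ s s' s'' t t' : C(Ball k × EH, Θ.Twisted q k)}

theorem IsExtension.isLabelled (h : IsExtension ρ s t) :
    IsLabelled ρ (loopAct Θ q k) (loops s) (loops t) Path.id := by
  refine ⟨fun g x e τ => ?_, fun x e τ hx => ?_⟩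
  · rw [loops_apply, h.smul]
    exact congrArg (fun δ : Θ.Loops (q + k + 1) => δ τ) (loopMap_smul Θ q k (ρ g) (t (x, e)))
  · rw [loops_apply, h.boundary x e hx]
    rfl

theorem IsExtension.isLabelled_refl (h : IsExtension ρ (vacuum Θ q k EH) α)
    (γ : Ball k × EH → Θ.Loops (q + k + 1)) :
    IsLabelled ρ (loopAct Θ q k) γ (loops α) (Path.refl 0) := by
  refine ⟨fun g x e τ => ?_, fun x e τ hx => ?_⟩
  · rw [loops_apply, h.smul]
    exact congrArg (fun δ : Θ.Loops (q + k + 1) => δ τ) (loopMap_smul Θ q k (ρ g) (α (x, e)))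
  · rw [loops_apply, h.boundary x e hx]
    refine (congrArg (fun δ : Θ.Loops (q + k + 1) => δ τ) (adjoint_pt (q + k))).trans ?_
    simp

variable (ρ) in
/-- `s'` is a loop sum `α + s`, stated in terms of labels: this is the relation `IsLoopSum`, with the
particular homotopy over the boundary left open. -/
def LoopSum (α s s' : C(Ball k × EH, Θ.Twisted q k)) : Prop :=
  LoopHomotopic ρ (loopAct Θ q k) (loops s) (loopAdd (loops α) (loops s))
    ((Path.refl 0).trans Path.id) (loops s') Path.id

theorem RelHomotopic.right {Y : Type*} [MulAction (O k) Y] [TopologicalSpace Y]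
    {s : Ball k × EH → Y} {f g : C(Ball k × EH, Y)}
    (h : RelHomotopic ρ s f g) : IsExtension ρ s g :=
  h.symm.left

theorem RelHomotopic.loops_id (h : RelHomotopic ρ s t t') :
    LoopHomotopic ρ (loopAct Θ q k) (loops s) (loops t) Path.id (loops t') Path.id :=
  (h.comp (loopMap Θ q k) (loopMap_smul Θ q k)).loopHomotopic fun _ _ _ _ => rfl

theorem RelHomotopic.loops_refl (h : RelHomotopic ρ (vacuum Θ q k EH) α α')
    (γ : Ball k × EH → Θ.Loops (q + k + 1)) :
    LoopHomotopic ρ (loopAct Θ q k) γ (loops α) (Path.refl 0) (loops α') (Path.refl 0) :=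
  (h.comp (loopMap Θ q k) (loopMap_smul Θ q k)).loopHomotopic fun x e τ _ =>
    (congrArg (fun δ : Θ.Loops (q + k + 1) => δ τ) (adjoint_pt (q + k))).trans (by simp)

section Lift

variable (𝓔 : EquivariantInverse EH ρ (loopMap Θ q k))
include 𝓔

theorem EquivariantInverse.relHomotopic_of_loops_id (hs : IsExtension ρ s s)
    (ht : IsExtension ρ s t) (ht' : IsExtension ρ s t')
    (h : LoopHomotopic ρ (loopAct Θ q k) (loops s) (loops t) Path.id (loops t') Path.id) :
    RelHomotopic ρ s t t' :=
  𝓔.relHomotopic_of_comp ht ht' (LoopHomotopic.relHomotopic (loops s).continuous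
    hs.isLabelled.smul (.inl rfl) (.inr rfl) (fun _ _ _ _ => rfl) h)

theorem EquivariantInverse.relHomotopic_of_loops_refl (hs : IsExtension ρ s s)
    (hα : IsExtension ρ (vacuum Θ q k EH) α) (hα' : IsExtension ρ (vacuum Θ q k EH) α')
    (h : LoopHomotopic ρ (loopAct Θ q k) (loops s) (loops α) (Path.refl 0) (loops α')
      (Path.refl 0)) : RelHomotopic ρ (vacuum Θ q k EH) α α' := by
  refine 𝓔.relHomotopic_of_comp (s := ⟨vacuum Θ q k EH, continuous_const⟩) hα hα'
    (LoopHomotopic.relHomotopic (loops s).continuous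
    hs.isLabelled.smul (.inl rfl) (.inl rfl) (fun x e τ _ => ?_) h)
  exact (congrArg (fun δ : Θ.Loops (q + k + 1) => δ τ) (adjoint_pt (q + k))).trans (by simp)

/-- Loop sums exist: over the boundary the sum of loops has the label `0 * id`, which is deformed into
`id`; then the loops lift through the adjoint structure map. -/
theorem EquivariantInverse.exists_loopSum (hα : IsExtension ρ (vacuum Θ q k EH) α)
    (hs : IsExtension ρ s s) :
    ∃ s' : C(Ball k × EH, Θ.Twisted q k), IsExtension ρ s s' ∧ LoopSum ρ α s s' := by
  obtain ⟨z, hz⟩ := LoopHomotopic.exists_of_label (loops s).continuous hs.isLabelled.smul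
    (.inl rfl) (.inr rfl) ((hα.isLabelled_refl (loops s)).loopAdd hs.isLabelled)
    (Path.Homotopy.reflTrans Path.id)
  have hzl := hz.right
  obtain ⟨s', hs', h⟩ := 𝓔.exists_lift (z := z) hs
    ⟨fun h x e => Path.ext (funext fun τ => hzl.smul h x e τ),
      fun x e hx => Path.ext (funext fun τ => hzl.boundary x e τ hx)⟩
  exact ⟨s', hs', hz.trans (LoopHomotopic.symm (h.loopHomotopic fun _ _ _ _ => rfl))⟩

theorem EquivariantInverse.loopSum_unique (hs : IsExtension ρ s s) (hs' : IsExtension ρ s s')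
    (hs'' : IsExtension ρ s s'') (h : LoopSum ρ α s s') (h' : LoopSum ρ α s s'') :
    RelHomotopic ρ s s' s'' :=
  𝓔.relHomotopic_of_loops_id hs hs' hs'' (h.symm.trans h')

/-- Sections with the same boundary values have a difference, which is the base point over the
boundary. -/
theorem EquivariantInverse.exists_difference (hs : IsExtension ρ s s) (hs' : IsExtension ρ s s') :
    ∃ α : C(Ball k × EH, Θ.Twisted q k),
      IsExtension ρ (vacuum Θ q k EH) α ∧ LoopSum ρ α s s' := by
  -- `α` lifts `s' - s`, whose label `id * id⁻¹` is deformed into the constant one.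
  have h1 := hs'.isLabelled.loopAdd hs.isLabelled.loopNeg
  obtain ⟨z, hz⟩ := LoopHomotopic.exists_of_label (loops s).continuous hs.isLabelled.smul
    (.inl rfl) (.inl rfl) h1 (Path.Homotopy.reflTransSymm Path.id).symm
  have hzl := hz.right
  have hv : IsExtension ρ (vacuum Θ q k EH) (vacuum Θ q k EH) :=
    ⟨fun h x e => (twisted_smul_pt Θ q (ρ h)).symm, fun _ _ _ => rfl⟩
  have hloop : ∀ τ, (Θ.adjoint (q + k) (Θ.pt (q + k))) τ = Θ.pt (q + k + 1) := fun τ =>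
    congrArg (fun δ : Θ.Loops (q + k + 1) => δ τ) (adjoint_pt (q + k))
  obtain ⟨α, hα, h⟩ := 𝓔.exists_lift (s := ⟨vacuum Θ q k EH, continuous_const⟩) (z := z) hv
    ⟨fun h x e => Path.ext (funext fun τ => hzl.smul h x e τ),
      fun x e hx => Path.ext (funext fun τ => (hzl.boundary x e τ hx).trans (by
        refine Eq.trans ?_ (hloop τ).symm
        simp))⟩
  have h2 : LoopHomotopic ρ (loopAct Θ q k) (loops s) (loops α) (Path.refl 0) z (Path.refl 0) :=
    h.loopHomotopic fun x e τ _ => (hloop τ).trans (by simp)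
  refine ⟨α, hα, ?_⟩
  have h3 := (h2.trans hz.symm).loopAdd (.refl hs.isLabelled)
  have h4 := h3.trans (.add_assoc hs'.isLabelled hs.isLabelled.loopNeg hs.isLabelled)
  have h5 := h4.trans ((LoopHomotopic.refl hs'.isLabelled).loopAdd (.neg_add hs.isLabelled))
  exact h5.trans (.add_zero hs'.isLabelled)

/-- The difference of sections is unique up to homotopy: `α` is homotopic to `(α + s) - s`. -/
theorem EquivariantInverse.difference_unique (hs : IsExtension ρ s s)
    (hα : IsExtension ρ (vacuum Θ q k EH) α) (hα' : IsExtension ρ (vacuum Θ q k EH) α')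
    (h : LoopSum ρ α s s') (h' : LoopSum ρ α' s s') :
    RelHomotopic ρ (vacuum Θ q k EH) α α' := by
  have key : ∀ {α : C(Ball k × EH, Θ.Twisted q k)}, IsExtension ρ (vacuum Θ q k EH) α →
      LoopHomotopic ρ (loopAct Θ q k) (loops s)
        (loopAdd (loopAdd (loops α) (loops s)) (loopNeg (loops s)))
        (((Path.refl 0).trans Path.id).trans Path.id.symm) (loops α) (Path.refl 0) := by
    intro α hα
    have h1 := hα.isLabelled_refl (loops s)
    have h2 := LoopHomotopic.add_assoc h1 hs.isLabelled hs.isLabelled.loopNeg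
    exact (h2.trans ((LoopHomotopic.refl h1).loopAdd (.add_neg hs.isLabelled))).trans
      (.add_zero h1)
  exact 𝓔.relHomotopic_of_loops_refl hs hα hα' (((key hα).symm.trans
    ((h.trans h'.symm).loopAdd (.refl hs.isLabelled.loopNeg))).trans (key hα'))

end Lift

theorem LoopSum.congr (h : LoopSum ρ α s s') (hα : RelHomotopic ρ (vacuum Θ q k EH) α α')
    (hs : RelHomotopic ρ s s t) (hs' : RelHomotopic ρ s s' t') : LoopSum ρ α' t t' := by
  have h1 := (hα.loops_refl (loops s)).loopAdd hs.loops_id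
  refine LoopHomotopic.congr (γ := loops s) ((h1.symm.trans h).trans hs'.loops_id)
    fun x e hx => ?_
  rw [loops_apply, loops_apply, hs.right.boundary x e hx]

/-- Reparametrizations of a constant loop are all equal, so that over a vacuum boundary labels may be
replaced by the constant one. -/
theorem LoopHomotopic.refl_of_vacuum {γ : Ball k × EH → Θ.Loops (q + k + 1)} {a b : I}
    {φ φ' : Path a b} {z z' : C(Ball k × EH, Θ.Loops (q + k + 1))}
    (hβ : IsExtension ρ (vacuum Θ q k EH) β)
    (h : LoopHomotopic ρ (loopAct Θ q k) (loops β) z φ z' φ') :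
    LoopHomotopic ρ (loopAct Θ q k) γ z (Path.refl 0) z' (Path.refl 0) := by
  obtain ⟨V, Φ, hV⟩ := h
  refine ⟨V, Path.Homotopy.refl _, fun t => ⟨(hV t).smul, fun x e τ hx => ?_⟩⟩
  rw [(hV t).boundary x e τ hx, loops_apply, hβ.boundary x e hx]
  refine (congrArg (fun δ : Θ.Loops (q + k + 1) => δ _) (adjoint_pt (q + k))).trans ?_
  change _ = γ (x, e) 0
  simp

/-- If `δ = α + β`, then `δ + s = α + (β + s)`. -/
theorem LoopSum.assoc (hα : IsExtension ρ (vacuum Θ q k EH) α)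
    (hβ : IsExtension ρ (vacuum Θ q k EH) β) (hs : IsExtension ρ s s) (hs' : IsExtension ρ s s')
    (h : LoopSum ρ α β δ) (h' : LoopSum ρ β s s') (h'' : LoopSum ρ α s' s'') :
    LoopSum ρ δ s s'' := by
  have h1 : LoopHomotopic ρ (loopAct Θ q k) (loops s) (loopAdd (loops α) (loops β)) (Path.refl 0)
      (loops δ) (Path.refl 0) := h.refl_of_vacuum hβ
  have hα' := hα.isLabelled_refl (loops s)
  have h2 := LoopHomotopic.add_assoc hα' (hβ.isLabelled_refl (loops s)) hs.isLabelled
  rw [Path.refl_trans_refl] at h2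
  have h3 : LoopHomotopic ρ (loopAct Θ q k) (loops s) (loopAdd (loops α) (loops s'))
      ((Path.refl 0).trans Path.id) (loops s'') Path.id :=
    LoopHomotopic.congr h'' fun x e hx => by
      rw [loops_apply, loops_apply, hs'.boundary x e hx]
  exact (((h1.loopAdd (.refl hs.isLabelled)).symm.trans h2).trans
    ((LoopHomotopic.refl hα').loopAdd h')).trans h3

theorem reflTrans_apply_comp {X : Type*} [TopologicalSpace X] {x : X} (γ : Path x x) (t τ : I) :
    Path.Homotopy.reflTrans γ (t, τ) = γ (Path.Homotopy.reflTrans Path.id (t, τ)) := by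
  rfl

end LoopSum

/-! ### Homotopies of sections and loop sums in the standard frame -/

section Standard

variable {H : Type v} [Group H] [TopologicalSpace H] {k : ℕ} {ρ : H →* O k} {EH : Type w}
  [TopologicalSpace EH] [MulAction H EH] [ContinuousConstSMul H EH]

section Map

variable {Y : Type u} [MulAction (O k) Y] [TopologicalSpace Y] [ContinuousSMul (O k) Y]
  (hE : IsNumerable H EH) (hρ : Continuous ρ)

/-- A section in the standard frame, as a continuous map. -/
def StateSection.stdMap (s : StateSection ρ EH Y) : C(Ball k × EH, Y) :=
  ⟨s.std, (StateSection.continuous_std hE hρ (T := Unit) (fun _ => s)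
    (s.1.continuous.comp continuous_snd)).comp (Continuous.prodMk_right ())⟩

omit [ContinuousConstSMul H EH] in
theorem StateSection.isExtension_stdMap {s s₀ : StateSection ρ EH Y}
    (h : s.restrict = s₀.restrict) : IsExtension ρ (s₀.stdMap hE hρ) (s.stdMap hE hρ) :=
  s.isExtension_std s₀ (StateSection.restrict_eq_iff.1 h)

/-- Sections are homotopic relative to the boundary if and only if they are so in the standard
frame. -/
theorem Extension.toClass_eq_iff {s₀ : BoundarySection ρ EH Y} (t s s' : Extension s₀) :
    s.toClass = s'.toClass ↔
      RelHomotopic ρ (t.1.stdMap hE hρ) (s.1.stdMap hE hρ) (s'.1.stdMap hE hρ) := by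
  constructor
  · intro h
    obtain ⟨F⟩ : ContinuousMap.HomotopicWith s.1.1 s'.1.1 _ := Quotient.exact h
    choose S hS using F.prop'
    have hval : ∀ τ b, (S τ).1.1 b = F (τ, b) := fun τ b =>
      congrArg (fun f : C(BallQuotient ρ EH, StateBundle ρ EH Y) => f b) (hS τ)
    have h0 : (S 0).1 = s.1 := Subtype.ext (ContinuousMap.ext fun b =>
      (hval 0 b).trans (F.map_zero_left b))
    have h1 : (S 1).1 = s'.1 := Subtype.ext (ContinuousMap.ext fun b =>
      (hval 1 b).trans (F.map_one_left b))
    refine .mk (fun τ => (S τ).1.std)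
      (StateSection.continuous_std hE hρ (fun τ => (S τ).1)
        (F.continuous.congr fun z => (hval z.1 z.2).symm)) (fun τ => (S τ).1.isExtension_std t.1
        (StateSection.restrict_eq_iff.1 ((S τ).2.trans t.2.symm)))
      (fun p => by rw [h0]; rfl) fun p => by rw [h1]; rfl
  · intro h
    obtain ⟨F, hF, hFs, h0, h1⟩ := h.exists
    have hc := StateSection.continuous_ofStd (ρ := ρ) F hF fun τ => (hFs τ).smul
    have hFτ : ∀ τ, Continuous (F τ) := fun τ => by fun_prop
    have hend : ∀ (τ : I) (s : StateSection ρ EH Y), (∀ p, F τ p = s.std p) →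
        StateSection.ofStd (F τ) (hFτ τ) (hFs τ).smul = s := fun τ s hs =>
      StateSection.eq_of_std_eq ((StateSection.std_ofStd _ _ _).trans (funext hs))
    refine Quotient.sound ⟨⟨⟨⟨_, hc⟩, fun b => ?_, fun b => ?_⟩, fun τ => ?_⟩⟩
    · change (StateSection.ofStd (F 0) (hFτ 0) (hFs 0).smul).1 b = _
      rw [hend 0 s.1 h0]
    · change (StateSection.ofStd (F 1) (hFτ 1) (hFs 1).smul).1 b = _
      rw [hend 1 s'.1 h1]
    · refine ⟨⟨StateSection.ofStd (F τ) (hFτ τ) (hFs τ).smul, ?_⟩, rfl⟩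
      refine (StateSection.restrict_eq_iff.2 fun x e hx => ?_).trans t.2
      rw [StateSection.std_ofStd, (hFs τ).boundary x e hx]
      rfl

omit [ContinuousConstSMul H EH] in
/-- Every equivariant map with the boundary values of a section is a section in the standard
frame. -/
theorem Extension.exists_stdMap_eq {s₀ : BoundarySection ρ EH Y} (t : Extension s₀)
    {f : C(Ball k × EH, Y)} (hf : IsExtension ρ (t.1.stdMap hE hρ) f) :
    ∃ s : Extension s₀, s.1.stdMap hE hρ = f := by
  refine ⟨⟨StateSection.ofStd f f.continuous hf.smul, ?_⟩, ?_⟩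
  · refine (StateSection.restrict_eq_iff.2 fun x e hx => ?_).trans t.2
    rw [StateSection.std_ofStd, hf.boundary x e hx]
    rfl
  · exact ContinuousMap.ext fun p =>
      congrFun (StateSection.std_ofStd (ρ := ρ) f f.continuous hf.smul) p

end Map

variable {Θ : OrthogonalSpectrum.{u}} {q : ℕ} (hE : IsNumerable H EH) (hρ : Continuous ρ)

omit [TopologicalSpace H] [TopologicalSpace EH] [ContinuousConstSMul H EH] in
theorem adjoint_smul_apply (u : O k) (y : Θ.Twisted q k) (τ : I) :
    Θ.adjoint (q + k) (u • y : Θ.Twisted q k) τ = loopAct Θ q k u (Θ.adjoint (q + k) y τ) :=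
  congrArg (fun δ : Θ.Loops (q + k + 1) => δ τ) (loopMap_smul Θ q k u y)

instance : ContinuousSMul (O k) (Θ.LoopTwisted q k) where
  continuous_smul := by
    have h1 := continuous_blockSum q k
    have h2 := continuous_blockSum (q + k) 1
    have h3 : Continuous fun z : (O k × Θ.Loops (q + k + 1)) × I =>
        blockSum (q + k) 1 (blockSum q k (1, z.1.1), 1) • z.1.2 z.2 := by fun_prop
    exact Path.continuous_uncurry_iff.1 h3

omit [ContinuousConstSMul H EH] [TopologicalSpace H] in
/-- The values of a section of loops in all frames are known from those in the standard frame. -/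
theorem isLoopSum_iff_std (α s s' : StateSection ρ EH (Θ.Twisted q k)) :
    IsLoopSum α s s' ↔ ∃ K : I → StateSection ρ EH (Θ.LoopTwisted q k),
      Continuous (fun z : I × BallQuotient ρ EH => (K z.1).1 z.2) ∧
      (∀ p, (K 0).std p =
        (Θ.adjoint (q + k) (α.std p)).trans (Θ.adjoint (q + k) (s.std p))) ∧
      (∀ p, (K 1).std p = Θ.adjoint (q + k) (s'.std p)) ∧
      ∀ t x e, ‖x.1‖ = 1 → (K t).std (x, e) =
        (Path.Homotopy.reflTrans (Θ.adjoint (q + k) (s.std (x, e)))).eval t := by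
  constructor
  · rintro ⟨K, hK, h0, h1, hb⟩
    exact ⟨K, hK, fun p => h0 _, fun p => h1 _,
      fun t x e hx => hb t _ (mk_mem_boundary_iff.2 hx)⟩
  · rintro ⟨K, hK, h0, h1, hb⟩
    refine ⟨K, hK, ?_, ?_, ?_⟩
    · rintro ⟨x, u, e⟩
      change (K 0).value (Quotient.mk _ (x, u, e)) =
        (Θ.adjoint (q + k) (α.value (Quotient.mk _ (x, u, e)))).trans
          (Θ.adjoint (q + k) (s.value (Quotient.mk _ (x, u, e))))
      rw [StateSection.value_mk, StateSection.value_mk, StateSection.value_mk, h0]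
      refine Path.ext (funext fun τ => ?_)
      change loopAct Θ q k u (Path.trans _ _ τ) = _
      rw [Path.trans_apply, Path.trans_apply]
      split_ifs <;> exact (adjoint_smul_apply u _ _).symm
    · rintro ⟨x, u, e⟩
      change (K 1).value (Quotient.mk _ (x, u, e)) =
        Θ.adjoint (q + k) (s'.value (Quotient.mk _ (x, u, e)))
      rw [StateSection.value_mk, StateSection.value_mk, h1]
      exact (loopMap_smul Θ q k u _).symm
    · rintro t ⟨x, u, e⟩ hp
      have hx : ‖x.1‖ = 1 := mk_mem_boundary_iff.1 hp
      change (K t).value (Quotient.mk _ (x, u, e)) =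
        (Path.Homotopy.reflTrans (Θ.adjoint (q + k) (s.value (Quotient.mk _ (x, u, e))))).eval t
      rw [StateSection.value_mk, StateSection.value_mk, hb t x e hx]
      refine Path.ext (funext fun τ => ?_)
      change loopAct Θ q k u (Path.Homotopy.reflTrans (Θ.adjoint (q + k) (s.std (x, e))) (t, τ)) =
        Path.Homotopy.reflTrans (Θ.adjoint (q + k) (u • s.std (x, e) : Θ.Twisted q k)) (t, τ)
      rw [reflTrans_apply_comp, reflTrans_apply_comp]
      exact (adjoint_smul_apply u _ _).symm

/-- Loop sums of sections are loop sums in the standard frame. -/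
theorem isLoopSum_iff {α s s' : StateSection ρ EH (Θ.Twisted q k)} :
    IsLoopSum α s s' ↔
      LoopSum ρ (α.stdMap hE hρ) (s.stdMap hE hρ) (s'.stdMap hE hρ) := by
  rw [isLoopSum_iff_std]
  constructor
  · rintro ⟨K, hK, h0, h1, hb⟩
    refine .mk (fun t => (K t).std) (StateSection.continuous_std hE hρ K hK)
      (Path.Homotopy.reflTrans Path.id) (fun t => ⟨fun g x e τ => ?_, fun x e τ hx => ?_⟩) h0 h1
    · exact congrArg (fun δ : Θ.Loops (q + k + 1) => δ τ) ((K t).std_smul g x e)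
    · rw [hb t x e hx]
      exact reflTrans_apply_comp (Θ.adjoint (q + k) (s.std (x, e))) t τ
  · intro h
    have hs : IsExtension ρ (s.stdMap hE hρ) (s.stdMap hE hρ) :=
      StateSection.isExtension_stdMap hE hρ rfl
    obtain ⟨V, hV⟩ := h.exists_relabel (loops _).continuous hs.isLabelled.smul (.inl rfl) (.inr rfl)
      (Path.Homotopy.reflTrans Path.id)
    let W : I → Ball k × EH → Θ.LoopTwisted q k := fun t p => V.toFun (t, p)
    have hW : Continuous fun z : I × Ball k × EH => W z.1 z.2 := V.continuous
    have hWs : ∀ t g x e, W t (ρ g • x, g • e) = ρ g • W t (x, e) := fun t g x e =>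
      Path.ext (funext fun τ => (hV t).smul g x e τ)
    refine ⟨fun t => StateSection.ofStd (W t) (by fun_prop) (hWs t),
      StateSection.continuous_ofStd W hW hWs, fun p => ?_, fun p => ?_, fun t x e hx => ?_⟩
    · refine (congrFun (StateSection.std_ofStd _ _ (hWs 0)) p).trans ?_
      exact V.map_zero_left p
    · refine (congrFun (StateSection.std_ofStd _ _ (hWs 1)) p).trans ?_
      exact V.map_one_left p
    · refine (congrFun (StateSection.std_ofStd _ _ (hWs t)) (x, e)).trans ?_
      exact Path.ext (funext fun τ => ((hV t).boundary x e τ hx).trans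
        (reflTrans_apply_comp (Θ.adjoint (q + k) (s.std (x, e))) t τ).symm)

end Standard

section Zero

variable {Θ : OrthogonalSpectrum.{u}} {q k : ℕ} {H : Type v} [Group H] {ρ : H →* O k}
  {EH : Type w} [MulAction H EH] [TopologicalSpace EH] {α s : C(Ball k × EH, Θ.Twisted q k)}

/-- The map that is constant at the base point. -/
def vacuumMap (Θ : OrthogonalSpectrum.{u}) (q k : ℕ) (EH : Type w) [TopologicalSpace EH] :
    C(Ball k × EH, Θ.Twisted q k) := ⟨vacuum Θ q k EH, continuous_const⟩

theorem loops_vacuumMap :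
    loops (vacuumMap Θ q k EH) = ContinuousMap.const _ (Path.refl _) :=
  ContinuousMap.ext fun _ => adjoint_pt (q + k)

theorem LoopSum.vacuum_left (hs : IsExtension ρ s s) : LoopSum ρ (vacuumMap Θ q k EH) s s := by
  unfold LoopSum
  rw [loops_vacuumMap]
  refine .mk (fun t p => (Path.Homotopy.reflTrans (loops s p)).eval t) ?_
    (Path.Homotopy.reflTrans Path.id) (fun t => ⟨fun g x e τ => ?_, fun x e τ hx => rfl⟩)
    (fun p => Path.Homotopy.eval_zero _) fun p => Path.Homotopy.eval_one _
  · refine Path.continuous_uncurry_iff.1 ?_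
    have : Continuous fun z : (I × Ball k × EH) × I =>
      loops s z.1.2 (Path.Homotopy.reflTrans Path.id (z.1.1, z.2)) := by fun_prop
    exact this
  · exact hs.isLabelled.smul g x e _

theorem LoopSum.vacuum_right (hα : IsExtension ρ (vacuum Θ q k EH) α) :
    LoopSum ρ α (vacuumMap Θ q k EH) α := by
  have h := LoopHomotopic.add_zero (hα.isLabelled_refl (loops (vacuumMap Θ q k EH)))
  obtain ⟨V, Φ, hV⟩ := h
  unfold LoopSum
  rw [loops_vacuumMap] at hV ⊢
  refine ⟨V, Path.Homotopy.reflTrans Path.id, fun t => ⟨(hV t).smul, fun x e τ hx => ?_⟩⟩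
  rw [(hV t).boundary x e τ hx]
  rfl

end Zero

/-! ### The sphere as a quotient of the ball and of the cylinder -/

section Collapse

/-- A map `φ` to a vector space, defined where `r > 0` and with norm at least `1/r - 1`, extends
continuously by the point at infinity. -/
theorem continuous_ite_infty {K V : Type*} [TopologicalSpace K] [NormedAddCommGroup V]
    [NormedSpace ℝ V] [ProperSpace V] {r : K → ℝ} {φ : K → V} (hr : Continuous r)
    (h0 : ∀ x, 0 ≤ r x) (hφ : ∀ x, 0 < r x → ContinuousAt φ x)
    (h : ∀ x, 0 < r x → (r x)⁻¹ ≤ 1 + ‖φ x‖) :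
    Continuous fun x => if 0 < r x then (φ x : OnePoint V) else OnePoint.infty := by
  rw [continuous_iff_continuousAt]
  intro x
  rcases (h0 x).lt_or_eq with hx | hx
  · have hev : ∀ᶠ y in 𝓝 x, 0 < r y := hr.continuousAt.eventually (lt_mem_nhds hx)
    have h1 : ContinuousAt (fun y => (φ y : OnePoint V)) x :=
      (OnePoint.continuous_coe.tendsto _).comp (hφ x hx)
    exact h1.congr (hev.mono fun y hy => (if_pos hy).symm)
  · rw [ContinuousAt, if_neg hx.not_lt]
    refine Filter.Tendsto.if ?_ (tendsto_const_nhds.mono_left inf_le_left)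
    refine OnePoint.tendsto_coe_infty.comp ?_
    rw [Filter.coclosedCompact_eq_cocompact, ← Metric.cobounded_eq_cocompact,
      ← tendsto_norm_atTop_iff_cobounded]
    have h1 : Filter.Tendsto r (𝓝 x ⊓ Filter.principal {y | 0 < r y}) (𝓝[>] 0) := by
      refine tendsto_nhdsWithin_iff.2 ⟨?_, Filter.mem_inf_of_right (Filter.mem_principal_self _)⟩
      have := hr.continuousAt (x := x)
      rw [ContinuousAt, ← hx] at this
      exact this.mono_left inf_le_left
    refine Filter.tendsto_atTop_mono' _ ?_
      (Filter.tendsto_atTop_add_const_right _ (-1) (tendsto_inv_nhdsGT_zero.comp h1))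
    filter_upwards [Filter.mem_inf_of_right (Filter.mem_principal_self _)] with y hy
    have := h y hy
    change (r y)⁻¹ + -1 ≤ _
    linarith

/-! The collapse maps are given on the open unit ball by the homeomorphism `y ↦ (1 - ‖y‖)⁻¹ • y` to
the vector space. -/

section Ratio

variable {V : Type*} [NormedAddCommGroup V] [NormedSpace ℝ V]

theorem inv_eq_one_add_norm_ratio {y : V} (hy : ‖y‖ < 1) :
    (1 - ‖y‖)⁻¹ = 1 + ‖(1 - ‖y‖)⁻¹ • y‖ := by
  have h : 0 < 1 - ‖y‖ := sub_pos.2 hy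
  rw [norm_smul, norm_inv, Real.norm_of_nonneg h.le]
  field_simp
  ring

theorem eq_of_ratio_eq {y y' : V} (hy : ‖y‖ < 1) (hy' : ‖y'‖ < 1)
    (h : (1 - ‖y‖)⁻¹ • y = (1 - ‖y'‖)⁻¹ • y') : y = y' := by
  have h1 : (1 - ‖y‖)⁻¹ = (1 - ‖y'‖)⁻¹ := by
    rw [inv_eq_one_add_norm_ratio hy, inv_eq_one_add_norm_ratio hy', h]
  rw [h1] at h
  exact smul_right_injective V (inv_ne_zero (sub_pos.2 hy').ne') h

theorem exists_ratio_eq (v : V) : ∃ y : V, ‖y‖ < 1 ∧ (1 - ‖y‖)⁻¹ • y = v := by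
  have h : 0 < 1 + ‖v‖ := by positivity
  have hn : ‖(1 + ‖v‖)⁻¹ • v‖ = ‖v‖ / (1 + ‖v‖) := by
    rw [norm_smul, norm_inv, Real.norm_of_nonneg h.le, inv_mul_eq_div]
  have h2 : 1 - ‖v‖ / (1 + ‖v‖) = (1 + ‖v‖)⁻¹ := by
    field_simp
    ring
  refine ⟨(1 + ‖v‖)⁻¹ • v, ?_, ?_⟩
  · rw [hn, div_lt_one h]
    linarith
  · rw [hn, h2, inv_inv, smul_smul, mul_inv_cancel₀ h.ne', one_smul]

end Ratio

theorem continuous_collapse (k : ℕ) : Continuous (collapse k) := by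
  have hn : Continuous fun x : Ball k => 1 - ‖x.1‖ := by fun_prop
  have := continuous_ite_infty (K := Ball k) (r := fun x => 1 - ‖x.1‖)
    (φ := fun x => (1 - ‖x.1‖)⁻¹ • x.1) hn
    (fun x => sub_nonneg.2 (mem_closedBall_zero_iff.1 x.2))
    (fun x hx => (hn.continuousAt.inv₀ hx.ne').smul continuous_subtype_val.continuousAt)
    fun x hx => (inv_eq_one_add_norm_ratio (sub_pos.1 hx)).le
  refine this.congr fun x => ?_
  simp only [sub_pos]
  rfl

/-- The dimension has to be positive: for `k = 0` the ball has no boundary, and `∞` is not attained. -/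
theorem collapse_surjective (k : ℕ) : Function.Surjective (collapse (k + 1)) := by
  intro z
  induction z using OnePoint.rec with
  | coe v =>
    obtain ⟨y, hy, rfl⟩ := exists_ratio_eq v
    exact ⟨⟨y, mem_closedBall_zero_iff.2 hy.le⟩, if_pos hy⟩
  | infty =>
    have h : ‖EuclideanSpace.single (0 : Fin (k + 1)) (1 : ℝ)‖ = 1 := by simp
    exact ⟨⟨_, mem_closedBall_zero_iff.2 h.le⟩, if_neg h.not_lt⟩

theorem collapse_eq_infty_iff {k : ℕ} {x : Ball k} :
    collapse k x = OnePoint.infty ↔ ‖x.1‖ = 1 := by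
  unfold collapse
  have := mem_closedBall_zero_iff.1 x.2
  split_ifs with h
  · simp [h.ne]
  · simp [le_antisymm this (not_lt.1 h)]

theorem eq_of_collapse_eq {k : ℕ} {x y : Ball k} (h : collapse k x = collapse k y)
    (hx : ‖x.1‖ ≠ 1) : x = y := by
  have hy : ‖y.1‖ ≠ 1 := fun h1 =>
    hx (collapse_eq_infty_iff.1 (h.trans (collapse_eq_infty_iff.2 h1)))
  have hx' := lt_of_le_of_ne (mem_closedBall_zero_iff.1 x.2) hx
  have hy' := lt_of_le_of_ne (mem_closedBall_zero_iff.1 y.2) hy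
  rw [collapse, collapse, if_pos hx', if_pos hy', OnePoint.coe_eq_coe] at h
  exact Subtype.ext (eq_of_ratio_eq hx' hy' h)

/-- A point of the unit interval, as a point of the interval `[-1,1]`. -/
def centered (t : I) : ℝ := 2 * (t : ℝ) - 1

theorem continuous_centered : Continuous centered := by
  unfold centered
  fun_prop

theorem abs_centered_le (t : I) : ‖centered t‖ ≤ 1 := by
  rw [Real.norm_eq_abs, centered, abs_le]
  constructor <;> linarith [t.2.1, t.2.2]

theorem abs_centered_eq_one_iff {t : I} : ‖centered t‖ = 1 ↔ t = 0 ∨ t = 1 := by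
  rw [Real.norm_eq_abs, centered, abs_eq zero_le_one, or_comm]
  refine or_congr ⟨fun h => Subtype.ext ?_, fun h => ?_⟩ ⟨fun h => Subtype.ext ?_, fun h => ?_⟩
  · change (t : ℝ) = 0
    linarith
  · simp [h]
  · change (t : ℝ) = 1
    linarith
  · rw [h]
    norm_num

theorem collapseI_def (t : I) : collapseI t =
    if ‖centered t‖ < 1 then (((1 - ‖centered t‖)⁻¹ • centered t : ℝ) : OnePoint ℝ)
    else OnePoint.infty := rfl

/-- The collapse map `B^k × [0,1] → (B^k × [0,1])/∂ ≅ S^k ∧ S^1 = S^{k+1}`. -/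
def cylinderCollapse (k : ℕ) (p : Ball k × I) : OnePoint (EuclideanSpace ℝ (Fin (k + 1))) :=
  if 0 < min (1 - ‖p.1.1‖) (1 - ‖centered p.2‖) then
    ((WithLp.toLp 2 (Fin.snoc (α := fun _ => ℝ) ((1 - ‖p.1.1‖)⁻¹ • p.1.1).ofLp
      ((1 - ‖centered p.2‖)⁻¹ • centered p.2)) : EuclideanSpace ℝ (Fin (k + 1))) : OnePoint _)
  else OnePoint.infty

theorem norm_snoc_sq {k : ℕ} (v : EuclideanSpace ℝ (Fin k)) (w : ℝ) :
    ‖(WithLp.toLp 2 (Fin.snoc (α := fun _ => ℝ) v.ofLp w) : EuclideanSpace ℝ (Fin (k + 1)))‖ ^ 2 =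
      ‖v‖ ^ 2 + ‖w‖ ^ 2 := by
  rw [EuclideanSpace.norm_sq_eq, EuclideanSpace.norm_sq_eq, Fin.sum_univ_castSucc]
  simp

theorem continuous_cylinderCollapse (k : ℕ) : Continuous (cylinderCollapse k) := by
  have hx : Continuous fun p : Ball k × I => 1 - ‖p.1.1‖ := by fun_prop
  have ht : Continuous fun p : Ball k × I => 1 - ‖centered p.2‖ :=
    continuous_const.sub (continuous_centered.comp continuous_snd).norm
  refine continuous_ite_infty (hx.min ht) (fun p => le_min
    (sub_nonneg.2 (mem_closedBall_zero_iff.1 p.1.2)) (sub_nonneg.2 (abs_centered_le p.2)))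
    (fun p hp => ?_) fun p hp => ?_
  · have h1 : ContinuousAt (fun p : Ball k × I => (1 - ‖p.1.1‖)⁻¹ • p.1.1) p :=
      (hx.continuousAt.inv₀ (lt_min_iff.1 hp).1.ne').smul (by fun_prop)
    have h2 : ContinuousAt (fun p : Ball k × I => (1 - ‖centered p.2‖)⁻¹ • centered p.2) p :=
      (ht.continuousAt.inv₀ (lt_min_iff.1 hp).2.ne').smul
        (continuous_centered.comp continuous_snd).continuousAt
    refine (PiLp.continuous_toLp 2 _).continuousAt.comp (continuousAt_pi.2 fun i => ?_)
    induction i using Fin.lastCases with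
    | last => simpa using h2
    | cast i =>
      have h3 : ContinuousAt (fun p : Ball k × I => ((1 - ‖p.1.1‖)⁻¹ • p.1.1) i) p :=
        (EuclideanSpace.proj (𝕜 := ℝ) i).continuous.continuousAt.comp h1
      simpa using h3
  · obtain ⟨h1, h2⟩ := lt_min_iff.1 hp
    have hsq := norm_snoc_sq ((1 - ‖p.1.1‖)⁻¹ • p.1.1) ((1 - ‖centered p.2‖)⁻¹ • centered p.2)
    rcases min_choice (1 - ‖p.1.1‖) (1 - ‖centered p.2‖) with h | h
    · rw [h]
      refine (inv_eq_one_add_norm_ratio (sub_pos.1 h1)).le.trans (add_le_add_right ?_ 1)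
      refine le_of_sq_le_sq ?_ (norm_nonneg _)
      rw [hsq]
      exact le_add_of_nonneg_right (sq_nonneg _)
    · rw [h]
      refine (inv_eq_one_add_norm_ratio (sub_pos.1 h2)).le.trans (add_le_add_right ?_ 1)
      refine le_of_sq_le_sq ?_ (norm_nonneg _)
      rw [hsq]
      exact le_add_of_nonneg_left (sq_nonneg _)

/-- The boundary of the cylinder. -/
def IsCylinderBoundary {k : ℕ} (p : Ball k × I) : Prop := ‖p.1.1‖ = 1 ∨ p.2 = 0 ∨ p.2 = 1

theorem lt_min_of_not_isCylinderBoundary {k : ℕ} {p : Ball k × I} (hp : ¬ IsCylinderBoundary p) :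
    0 < min (1 - ‖p.1.1‖) (1 - ‖centered p.2‖) := by
  rw [IsCylinderBoundary, not_or, ← abs_centered_eq_one_iff] at hp
  exact lt_min (sub_pos.2 (lt_of_le_of_ne (mem_closedBall_zero_iff.1 p.1.2) hp.1))
    (sub_pos.2 (lt_of_le_of_ne (abs_centered_le p.2) hp.2))

theorem cylinderCollapse_eq_infty_iff {k : ℕ} {p : Ball k × I} :
    cylinderCollapse k p = OnePoint.infty ↔ IsCylinderBoundary p := by
  refine ⟨fun h => ?_, fun h => if_neg fun h' => ?_⟩
  · by_contra hp
    rw [cylinderCollapse, if_pos (lt_min_of_not_isCylinderBoundary hp)] at h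
    exact OnePoint.coe_ne_infty _ h
  · obtain ⟨h1, h2⟩ := lt_min_iff.1 h'
    rw [IsCylinderBoundary, ← abs_centered_eq_one_iff] at h
    rcases h with h | h <;> linarith

theorem eq_of_cylinderCollapse_eq {k : ℕ} {p p' : Ball k × I}
    (h : cylinderCollapse k p = cylinderCollapse k p') (hp : ¬ IsCylinderBoundary p) : p = p' := by
  have hp' : ¬ IsCylinderBoundary p' := fun h1 =>
    hp (cylinderCollapse_eq_infty_iff.1 (h.trans (cylinderCollapse_eq_infty_iff.2 h1)))
  have h1 := lt_min_of_not_isCylinderBoundary hp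
  have h2 := lt_min_of_not_isCylinderBoundary hp'
  rw [cylinderCollapse, cylinderCollapse, if_pos h1, if_pos h2, OnePoint.coe_eq_coe] at h
  obtain ⟨h3, h4⟩ := Fin.snoc_inj.1 ((WithLp.toLp_injective 2) h)
  rw [lt_min_iff, sub_pos, sub_pos] at h1 h2
  refine Prod.ext (Subtype.ext (eq_of_ratio_eq h1.1 h2.1 ((WithLp.ofLp_injective 2) h3)))
    (Subtype.ext ?_)
  have := eq_of_ratio_eq h1.2 h2.2 h4
  rw [centered, centered] at this
  linarith

theorem cylinderCollapse_surjective (k : ℕ) : Function.Surjective (cylinderCollapse k) := by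
  intro z
  induction z using OnePoint.rec with
  | coe v =>
    obtain ⟨y, hy, hv⟩ := exists_ratio_eq (WithLp.toLp 2 (Fin.init v.ofLp) :
      EuclideanSpace ℝ (Fin k))
    obtain ⟨s, hs, hw⟩ := exists_ratio_eq (v.ofLp (Fin.last k))
    have hs' := abs_lt.1 (Real.norm_eq_abs s ▸ hs)
    have hc : centered ⟨(s + 1) / 2, by linarith, by linarith⟩ = s := by
      simp only [centered]
      ring
    refine ⟨(⟨y, mem_closedBall_zero_iff.2 hy.le⟩, ⟨(s + 1) / 2, by linarith, by linarith⟩), ?_⟩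
    simp only [cylinderCollapse]
    rw [hc, if_pos (lt_min (sub_pos.2 hy) (sub_pos.2 hs)), hw, hv]
    simp only [Fin.snoc_init_self]
  | infty => exact ⟨(⟨0, by simp⟩, 0), cylinderCollapse_eq_infty_iff.2 (.inr (.inl rfl))⟩

/-- Maps that are constant on the fibres of a surjection of compact Hausdorff spaces descend, also
in the presence of a parameter. -/
theorem exists_descend {K S T X : Type*} [TopologicalSpace K] [CompactSpace K]
    [TopologicalSpace S] [T2Space S] [TopologicalSpace T] [TopologicalSpace X] {c : K → S}
    (hc : Continuous c) (hsurj : Function.Surjective c) (g : C(T × K, X))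
    (hg : ∀ t x y, c x = c y → g (t, x) = g (t, y)) :
    ∃ h : C(T × S, X), ∀ t x, h (t, c x) = g (t, x) := by
  have hq : Topology.IsQuotientMap (Prod.map (id : T → T) c) :=
    ((isProperMap_id.prodMap hc.isProperMap).isClosedMap).isQuotientMap
      (continuous_id.prodMap hc) (Function.surjective_id.prodMap hsurj)
  choose r hr using hsurj
  have key : ∀ t x, g (t, r (c x)) = g (t, x) := fun t x => hg t _ _ (hr (c x))
  refine ⟨⟨fun z => g (z.1, r z.2), ?_⟩, key⟩
  exact hq.continuous_iff.2 (g.continuous.congr fun z => (key z.1 z.2).symm)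

end Collapse

/-! ### The Thom map without a group action -/

section Suspension

/-- The trivial action of the trivial group. -/
@[reducible] def trivialAction (T : Type*) : MulAction Unit T where
  smul _ t := t
  one_smul _ := rfl
  mul_smul _ _ _ := rfl

attribute [local instance] trivialAction

/-- Results for equivariant maps apply to all maps, with the trivial group in place of `H`. -/
theorem isNumerable_trivialAction (T : Type w) [TopologicalSpace T] : IsNumerable Unit T := by
  refine ⟨PUnit, ⟨fun _ => 1, locallyFinite_of_finite _, fun _ _ => zero_le_one, fun x _ => ?_,
    fun x => ?_⟩, fun _ => ⟨fun _ => (), continuousOn_const, fun _ _ _ => rfl⟩⟩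
  · exact (finsum_unique _).trans rfl
  · exact ((finsum_unique _).trans rfl).le

section Transfer

variable {T X : Type*} [TopologicalSpace T] [TopologicalSpace X] {k : ℕ} {x₀ : X}

/-- A family of maps that are constant on the boundary of the ball descends to the sphere. -/
theorem exists_sphere_of_ball (G : C(T × Ball (k + 1), X))
    (hG : ∀ t x, ‖x.1‖ = 1 → G (t, x) = x₀) :
    ∃ h : C(T × OnePoint (EuclideanSpace ℝ (Fin (k + 1))), X),
      (∀ t, h (t, OnePoint.infty) = x₀) ∧ ∀ t x, h (t, collapse (k + 1) x) = G (t, x) := by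
  obtain ⟨h, hh⟩ := exists_descend (continuous_collapse (k + 1)) (collapse_surjective k) G
    fun t x y hxy => by
      by_cases hx : ‖x.1‖ = 1
      · have hy : ‖y.1‖ = 1 :=
          collapse_eq_infty_iff.1 (hxy.symm.trans (collapse_eq_infty_iff.2 hx))
        rw [hG t x hx, hG t y hy]
      · rw [eq_of_collapse_eq hxy hx]
  refine ⟨h, fun t => ?_, hh⟩
  obtain ⟨x, hx⟩ := collapse_surjective k OnePoint.infty
  rw [← hx, hh, hG t x (collapse_eq_infty_iff.1 hx)]

/-- A family of maps that are constant on the boundary of the cylinder descends to the sphere. -/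
theorem exists_sphere_of_cylinder (G : C(T × (Ball k × I), X))
    (hG : ∀ t p, IsCylinderBoundary p → G (t, p) = x₀) :
    ∃ h : C(T × OnePoint (EuclideanSpace ℝ (Fin (k + 1))), X),
      (∀ t, h (t, OnePoint.infty) = x₀) ∧ ∀ t p, h (t, cylinderCollapse k p) = G (t, p) := by
  obtain ⟨h, hh⟩ := exists_descend (continuous_cylinderCollapse k) (cylinderCollapse_surjective k) G
    fun t x y hxy => by
      by_cases hx : IsCylinderBoundary x
      · have hy : IsCylinderBoundary y := cylinderCollapse_eq_infty_iff.1
          (hxy.symm.trans (cylinderCollapse_eq_infty_iff.2 hx))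
        rw [hG t x hx, hG t y hy]
      · rw [eq_of_cylinderCollapse_eq hxy hx]
  refine ⟨h, fun t => ?_, hh⟩
  obtain ⟨x, hx⟩ := cylinderCollapse_surjective k OnePoint.infty
  rw [← hx, hh, hG t x (cylinderCollapse_eq_infty_iff.1 hx)]

end Transfer

theorem RelHomotopic.of_trivialAction {T Y : Type*} [TopologicalSpace T] [TopologicalSpace Y]
    {k : ℕ} [MulAction (O k) Y] {s : Ball k × T → Y} {f g : C(Ball k × T, Y)}
    (F : I → Ball k × T → Y) (hF : Continuous fun z : I × Ball k × T => F z.1 z.2)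
    (hs : ∀ t x e, ‖x.1‖ = 1 → F t (x, e) = s (x, e)) (h0 : ∀ p, F 0 p = f p)
    (h1 : ∀ p, F 1 p = g p) : RelHomotopic (1 : Unit →* O k) s f g :=
  .mk F hF (fun t => ⟨fun h x e => by
    have h1 : (1 : Unit →* O k) h = 1 := rfl
    rw [h1, one_smul (O k), one_smul (O k)]
    rfl, hs t⟩) h0 h1

variable {Θ : OrthogonalSpectrum.{u}} {q k : ℕ}

/-- The map `(x, t) ↦ a(t) ∧ x`. -/
def thomMap (Θ : OrthogonalSpectrum.{u}) {T : Type*} [TopologicalSpace T] (q k : ℕ)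
    (a : C(T, Θ.space q)) : C(Ball k × T, Θ.Twisted q k) :=
  ⟨fun p => Θ.sphereMap q k (a p.2) (collapse k p.1),
    (continuous_sphereMap_collapse Θ q k).comp (f := fun p : Ball k × T => (a p.2, p.1))
      ((a.continuous.comp continuous_snd).prodMk continuous_fst)⟩

/-- The loop adjoint to `a ∧ c(x)` is `a` smashed with the collapse map of the cylinder. -/
theorem str_sphereMap (a : Θ.space q) (x : Ball k) (t : I) :
    Θ.str (q + k) (Θ.sphereMap q k a (collapse k x), collapseI t) =
      Θ.sphereMap q (k + 1) a (cylinderCollapse k (x, t)) := by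
  by_cases h : IsCylinderBoundary (x, t)
  · rw [cylinderCollapse_eq_infty_iff.2 h]
    change _ = Θ.pt (q + k + 1)
    rw [IsCylinderBoundary, ← abs_centered_eq_one_iff] at h
    rcases h with h | h
    · rw [collapse_eq_infty_iff.2 h]
      exact Θ.str_pt _ _
    · rw [collapseI_def, if_neg h.not_lt, Θ.str_infty]
  · have h' := lt_min_of_not_isCylinderBoundary h
    obtain ⟨h1, h2⟩ := lt_min_iff.1 h'
    rw [cylinderCollapse, if_pos h', collapse, if_pos (sub_pos.1 h1), collapseI_def,
      if_pos (sub_pos.1 h2)]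
    change _ = Θ.str (q + k) (iter _ q k a _, _)
    congr 2
    · change iter _ q k a _ = _
      congr 1
      funext i
      simp
    · simp

theorem adjoint_pt_apply (n : ℕ) (τ : I) : Θ.adjoint n (Θ.pt n) τ = Θ.pt (n + 1) :=
  Θ.str_pt n _

/-- Homotopies of maps from `B^{k+1}` correspond to homotopies of maps from `B^k` to loops, since both
amount to homotopies of maps from `S^{k+1}`. -/
theorem relHomotopic_ball_iff_cylinder {T : Type*} [TopologicalSpace T]
    {h h' : T → OnePoint (EuclideanSpace ℝ (Fin (k + 1))) → Θ.space (q + k + 1)}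
    {f f' : C(Ball (k + 1) × T, Θ.Twisted q (k + 1))} {z z' : C(Ball k × T, Θ.LoopTwisted q k)}
    (hf : ∀ x t, f (x, t) = h t (collapse (k + 1) x))
    (hf' : ∀ x t, f' (x, t) = h' t (collapse (k + 1) x))
    (hz : ∀ x t τ, (show Θ.Loops (q + k + 1) from z (x, t)) τ = h t (cylinderCollapse k (x, τ)))
    (hz' : ∀ x t τ, (show Θ.Loops (q + k + 1) from z' (x, t)) τ =
      h' t (cylinderCollapse k (x, τ))) :
    RelHomotopic (1 : Unit →* O (k + 1)) (vacuum Θ q (k + 1) T) f f' ↔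
      RelHomotopic (1 : Unit →* O k) (fun p => loopMap Θ q k (vacuum Θ q k T p)) z z' := by
  constructor
  · intro hr
    obtain ⟨F, hF, hFs, h0, h1⟩ := hr.exists
    let F' : I → Ball (k + 1) × T → Θ.space (q + k + 1) := F
    have hF' : Continuous fun y : I × Ball (k + 1) × T => F' y.1 y.2 := hF
    obtain ⟨g, hg, hgF⟩ := exists_sphere_of_ball (T := I × T) (x₀ := Θ.pt (q + k + 1))
      ⟨fun p => F' p.1.1 (p.2, p.1.2), hF'.comp
        (f := fun p : (I × T) × Ball (k + 1) => (p.1.1, p.2, p.1.2)) (by fun_prop)⟩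
      fun t x hx => (hFs t.1).boundary x t.2 hx
    have hc := continuous_cylinderCollapse k
    let W : I → Ball k × T → Θ.Loops (q + k + 1) := fun s p =>
      { toFun := fun τ => g ((s, p.2), cylinderCollapse k (p.1, τ))
        continuous_toFun := g.continuous.comp (continuous_const.prodMk
          (hc.comp (continuous_const.prodMk continuous_id)))
        source' := by rw [cylinderCollapse_eq_infty_iff.2 (.inr (.inl rfl)), hg]
        target' := by rw [cylinderCollapse_eq_infty_iff.2 (.inr (.inr rfl)), hg] }
    have hW : Continuous fun y : I × Ball k × T => W y.1 y.2 := by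
      refine Path.continuous_uncurry_iff.1 ?_
      change Continuous fun y : (I × Ball k × T) × I =>
        g ((y.1.1, y.1.2.2), cylinderCollapse k (y.1.2.1, y.2))
      exact g.continuous.comp (Continuous.prodMk (by fun_prop)
        (hc.comp (f := fun y : (I × Ball k × T) × I => (y.1.2.1, y.2)) (by fun_prop)))
    refine .of_trivialAction (Y := Θ.LoopTwisted q k) W hW (fun s x t hx => ?_) (fun p => ?_)
      fun p => ?_
    · refine Path.ext (funext fun τ => ?_)
      change g ((s, t), cylinderCollapse k (x, τ)) = Θ.adjoint (q + k) (Θ.pt (q + k)) τ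
      rw [cylinderCollapse_eq_infty_iff (p := (x, τ)) |>.2 (.inl hx), hg]
      exact (adjoint_pt_apply _ _).symm
    · refine Path.ext (funext fun τ => (?_ : _ = _).trans (hz p.1 p.2 τ).symm)
      obtain ⟨x, hx⟩ := collapse_surjective k (cylinderCollapse k (p.1, τ))
      change g ((0, p.2), cylinderCollapse k (p.1, τ)) = _
      rw [← hx, hgF, ← hf]
      exact h0 _
    · refine Path.ext (funext fun τ => (?_ : _ = _).trans (hz' p.1 p.2 τ).symm)
      obtain ⟨x, hx⟩ := collapse_surjective k (cylinderCollapse k (p.1, τ))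
      change g ((1, p.2), cylinderCollapse k (p.1, τ)) = _
      rw [← hx, hgF, ← hf']
      exact h1 _
  · intro hr
    obtain ⟨F, hF, hFs, h0, h1⟩ := hr.exists
    let F' : I → Ball k × T → Θ.Loops (q + k + 1) := F
    have hF' : Continuous fun y : I × Ball k × T => F' y.1 y.2 := hF
    obtain ⟨g, hg, hgF⟩ := exists_sphere_of_cylinder (T := I × T) (x₀ := Θ.pt (q + k + 1))
      ⟨fun p => F' p.1.1 (p.2.1, p.1.2) p.2.2, by fun_prop⟩ fun t p hp => by
        rcases hp with hp | hp | hp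
        · refine (congrArg (fun γ : Θ.Loops (q + k + 1) => γ p.2)
            ((hFs t.1).boundary p.1 t.2 hp)).trans ?_
          change Θ.adjoint (q + k) (Θ.pt (q + k)) p.2 = _
          rw [adjoint_pt]
          rfl
        · change F' t.1 (p.1, t.2) p.2 = _
          rw [hp, Path.source]
        · change F' t.1 (p.1, t.2) p.2 = _
          rw [hp, Path.target]
    have hc := continuous_collapse (k + 1)
    refine .of_trivialAction (fun s p => g ((s, p.2), collapse (k + 1) p.1))
      (g.continuous.comp (Continuous.prodMk (by fun_prop)
        (hc.comp (f := fun y : I × Ball (k + 1) × T => y.2.1) (by fun_prop))))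
      (fun s x t hx => ?_) (fun p => ?_) fun p => ?_
    · change g ((s, t), collapse (k + 1) x) = _
      rw [collapse_eq_infty_iff.2 hx, hg]
      rfl
    · refine (?_ : _ = _).trans (hf p.1 p.2).symm
      obtain ⟨y, hy⟩ := cylinderCollapse_surjective k (collapse (k + 1) p.1)
      rw [← hy, hgF, ← hz]
      exact congrArg (fun γ : Θ.Loops (q + k + 1) => γ y.2) (h0 (y.1, p.2))
    · refine (?_ : _ = _).trans (hf' p.1 p.2).symm
      obtain ⟨y, hy⟩ := cylinderCollapse_surjective k (collapse (k + 1) p.1)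
      rw [← hy, hgF, ← hz']
      exact congrArg (fun γ : Θ.Loops (q + k + 1) => γ y.2) (h1 (y.1, p.2))

theorem nonempty_equivariantInverse_loopMap (Θ : OrthogonalOmegaSpectrum.{u}) (q k : ℕ)
    (T : Type w) [TopologicalSpace T] :
    Nonempty (EquivariantInverse T (1 : Unit →* O k) (loopMap Θ.toOrthogonalSpectrum q k)) :=
  nonempty_equivariantInverse (isNumerable_trivialAction T) continuous_const _
    (loopMap_smul Θ.toOrthogonalSpectrum q k) (Θ.omega (q + k))

/-- Up to homotopy, every family of maps from `B^k/∂B^k` comes from a map to `Θ_q`. -/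
theorem exists_relHomotopic_thomMap (Θ : OrthogonalOmegaSpectrum.{u}) (q k : ℕ) {T : Type u}
    [TopologicalSpace T] (f : C(Ball k × T, Θ.Twisted q k))
    (hf : ∀ x t, ‖x.1‖ = 1 → f (x, t) = Θ.pt (q + k)) :
    ∃ a : C(T, Θ.space q), RelHomotopic (1 : Unit →* O k)
      (vacuum Θ.toOrthogonalSpectrum q k T) f (thomMap Θ.toOrthogonalSpectrum q k a) := by
  induction k with
  | zero =>
    have h0 : ∀ x : Ball 0, x = 0 := fun x => Subtype.ext (Subsingleton.elim _ _)
    let a : C(T, Θ.space q) := ⟨fun t => f (0, t), f.continuous.comp (Continuous.prodMk_right 0)⟩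
    refine ⟨a, .of_trivialAction (fun _ => f) (f.continuous.comp continuous_snd) (fun _ => hf)
      (fun _ => rfl) ?_⟩
    rintro ⟨x, t⟩
    rw [h0 x]
    change f (0, t) = Θ.sphereMap q 0 (a t) (collapse 0 0)
    rw [collapse, if_pos (by simp)]
    rfl
  | succ k ih =>
    obtain ⟨𝓔⟩ := nonempty_equivariantInverse_loopMap Θ q k T
    have hc := continuous_cylinderCollapse k
    let f' : C(Ball (k + 1) × T, Θ.space (q + k + 1)) := f
    obtain ⟨g, hg, hgf⟩ := exists_sphere_of_ball (T := T) (x₀ := Θ.pt (q + k + 1))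
      (f'.comp ⟨Prod.swap, continuous_swap⟩) fun t x hx => hf x t hx
    let z : C(Ball k × T, Θ.Loops (q + k + 1)) :=
      ⟨fun p =>
        { toFun := fun τ => g (p.2, cylinderCollapse k (p.1, τ))
          continuous_toFun := g.continuous.comp (continuous_const.prodMk
            (hc.comp (continuous_const.prodMk continuous_id)))
          source' := by rw [cylinderCollapse_eq_infty_iff.2 (.inr (.inl rfl)), hg]
          target' := by rw [cylinderCollapse_eq_infty_iff.2 (.inr (.inr rfl)), hg] }, by
        refine Path.continuous_uncurry_iff.1 ?_
        change Continuous fun y : (Ball k × T) × I => g (y.1.2, cylinderCollapse k (y.1.1, y.2))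
        exact g.continuous.comp (Continuous.prodMk (by fun_prop)
          (hc.comp (f := fun y : (Ball k × T) × I => (y.1.1, y.2)) (by fun_prop)))⟩
    have hv : IsExtension (1 : Unit →* O k) (vacuumMap Θ.toOrthogonalSpectrum q k T)
        (vacuumMap Θ.toOrthogonalSpectrum q k T) :=
      (RelHomotopic.of_trivialAction (fun _ => vacuumMap Θ.toOrthogonalSpectrum q k T)
        (by fun_prop) (fun _ _ _ _ => rfl) (fun _ => rfl) fun _ => rfl).left
    have hz : RelHomotopic (Y := Θ.LoopTwisted q k) (1 : Unit →* O k)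
        (fun p => loopMap Θ.toOrthogonalSpectrum q k (vacuumMap Θ.toOrthogonalSpectrum q k T p))
        z z :=
      .of_trivialAction (fun _ => z) (z.continuous.comp continuous_snd) (fun _ x t hx => by
        refine Path.ext (funext fun τ => ?_)
        change g (t, cylinderCollapse k (x, τ)) = Θ.adjoint (q + k) (Θ.pt (q + k)) τ
        rw [cylinderCollapse_eq_infty_iff (p := (x, τ)) |>.2 (.inl hx), hg]
        exact (adjoint_pt_apply _ _).symm) (fun _ => rfl) fun _ => rfl
    -- `f`, viewed as a family `z` of loops over `B^k`, lifts through `η` to `y`.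
    obtain ⟨y, hy, hyz⟩ := 𝓔.exists_lift hv hz.left
    obtain ⟨a, ha⟩ := ih y hy.boundary
    refine ⟨a, (relHomotopic_ball_iff_cylinder
      (h := fun t s => g (t, s)) (h' := fun t s => Θ.sphereMap q (k + 1) (a t) s)
      (fun x t => (hgf t x).symm) (fun x t => rfl) (fun x t τ => rfl) fun x t τ => ?_).2
      (hyz.symm.trans (ha.comp (loopMap Θ.toOrthogonalSpectrum q k) (loopMap_smul _ q k)))⟩
    exact str_sphereMap (a t) x τ

/-- The Thom map detects homotopy. -/
theorem homotopic_of_relHomotopic_thomMap (Θ : OrthogonalOmegaSpectrum.{u}) (q k : ℕ) {T : Type u}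
    [TopologicalSpace T] {a b : C(T, Θ.space q)}
    (h : RelHomotopic (1 : Unit →* O k) (vacuum Θ.toOrthogonalSpectrum q k T)
      (thomMap Θ.toOrthogonalSpectrum q k a) (thomMap Θ.toOrthogonalSpectrum q k b)) :
    a.Homotopic b := by
  induction k with
  | zero =>
    obtain ⟨F, hF, -, h0, h1⟩ := h.exists
    have hθ : ∀ (c : C(T, Θ.space q)) t, thomMap Θ.toOrthogonalSpectrum q 0 c (0, t) = c t :=
      fun c t => by
        change Θ.sphereMap q 0 (c t) (collapse 0 0) = c t
        rw [collapse, if_pos (by simp)]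
        rfl
    exact ⟨⟨⟨fun p => F p.1 (0, p.2), hF.comp
      (f := fun p : I × T => (p.1, (0 : Ball 0), p.2)) (by fun_prop)⟩,
      fun t => (h0 _).trans (hθ a t), fun t => (h1 _).trans (hθ b t)⟩⟩
  | succ k ih =>
    obtain ⟨𝓔⟩ := nonempty_equivariantInverse_loopMap Θ q k T
    have hc : ∀ c : C(T, Θ.space q), IsExtension (1 : Unit →* O k)
        (vacuumMap Θ.toOrthogonalSpectrum q k T) (thomMap Θ.toOrthogonalSpectrum q k c) :=
      fun c => (RelHomotopic.of_trivialAction (fun _ => thomMap Θ.toOrthogonalSpectrum q k c)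
        (by fun_prop) (fun _ x t hx => by
          change Θ.sphereMap q k (c t) (collapse k x) = _
          rw [collapse_eq_infty_iff.2 hx]
          rfl) (fun _ => rfl) fun _ => rfl).left
    refine ih (𝓔.relHomotopic_of_comp (hc a) (hc b) ((relHomotopic_ball_iff_cylinder
      (h := fun t s => Θ.sphereMap q (k + 1) (a t) s)
      (h' := fun t s => Θ.sphereMap q (k + 1) (b t) s)
      (fun x t => rfl) (fun x t => rfl) (fun x t τ => ?_) fun x t τ => ?_).1 h))
    · exact str_sphereMap (a t) x τ
    · exact str_sphereMap (b t) x τ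

end Suspension

/-! ### The Thom isomorphism -/

section ThomIsomorphism

/-- The space of maps `(B^k, ∂B^k) → (Θ_{q+k}, pt)`, on which `O(k)` acts by conjugation. -/
def BoundaryMaps (Θ : OrthogonalSpectrum.{u}) (q k : ℕ) : Type u :=
  {f : C(Ball k, Θ.Twisted q k) // ∀ x, ‖x.1‖ = 1 → f x = Θ.pt (q + k)}

/-- The space `Θ_q` with the trivial action of `O(k)`. -/
def Untwisted (Θ : OrthogonalSpectrum.{u}) (q _k : ℕ) : Type u := Θ.space q

variable {Θ : OrthogonalSpectrum.{u}} {q k : ℕ}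

instance : TopologicalSpace (BoundaryMaps Θ q k) := instTopologicalSpaceSubtype

instance : TopologicalSpace (Untwisted Θ q k) := inferInstanceAs (TopologicalSpace (Θ.space q))

instance : MulAction (O k) (Untwisted Θ q k) where
  smul _ x := x
  one_smul _ := rfl
  mul_smul _ _ _ := rfl

instance : ContinuousSMul (O k) (Untwisted Θ q k) := ⟨continuous_snd⟩

instance (k : ℕ) : ContinuousSMul (O k) (Ball k) := ⟨by
  refine Continuous.subtype_mk (f := fun p : O k × Ball k =>
    WithLp.toLp 2 (p.1.1.mulVec p.2.1.ofLp)) ?_ _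
  fun_prop⟩

/-- A family of maps that are the base point on the boundary. -/
def BoundaryMaps.ofFamily {P : Type*} [TopologicalSpace P] (F : C(P × Ball k, Θ.Twisted q k))
    (hF : ∀ p x, ‖x.1‖ = 1 → F (p, x) = Θ.pt (q + k)) : C(P, BoundaryMaps Θ q k) :=
  ⟨fun p => ⟨F.curry p, hF p⟩, F.curry.continuous.subtype_mk _⟩

theorem BoundaryMaps.ext {f g : BoundaryMaps Θ q k} (h : ∀ x, f.1 x = g.1 x) : f = g :=
  Subtype.ext (ContinuousMap.ext h)

theorem BoundaryMaps.continuous_eval :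
    Continuous fun p : BoundaryMaps Θ q k × Ball k => p.1.1 p.2 :=
  ContinuousEval.continuous_eval.comp
    ((continuous_subtype_val.comp continuous_fst).prodMk continuous_snd)

instance : MulAction (O k) (BoundaryMaps Θ q k) where
  smul g f := ⟨⟨fun x => g • f.1 (g⁻¹ • x), by fun_prop⟩, fun x hx => by
    change g • f.1 (g⁻¹ • x) = _
    rw [f.2 _ ((norm_smul_ball _ x).trans hx)]
    exact twisted_smul_pt Θ q g⟩
  one_smul f := BoundaryMaps.ext fun x => by
    change (1 : O k) • f.1 ((1 : O k)⁻¹ • x) = f.1 x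
    rw [inv_one, one_smul, one_smul]
  mul_smul g g' f := BoundaryMaps.ext fun x => by
    change (g * g') • f.1 ((g * g')⁻¹ • x) = g • g' • f.1 (g'⁻¹ • g⁻¹ • x)
    rw [mul_inv_rev, mul_smul, mul_smul]

theorem BoundaryMaps.smul_apply (g : O k) (f : BoundaryMaps Θ q k) (x : Ball k) :
    (g • f).1 x = g • f.1 (g⁻¹ • x) := rfl

instance : ContinuousSMul (O k) (BoundaryMaps Θ q k) := ⟨by
  have h : Continuous fun p : (O k × BoundaryMaps Θ q k) × Ball k =>
      p.1.1 • p.1.2.1 (p.1.1⁻¹ • p.2) := by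
    have h1 : Continuous fun p : (O k × BoundaryMaps Θ q k) × Ball k =>
        p.1.2.1 (p.1.1⁻¹ • p.2) :=
      BoundaryMaps.continuous_eval.comp
        (f := fun p : (O k × BoundaryMaps Θ q k) × Ball k => (p.1.2, p.1.1⁻¹ • p.2)) (by fun_prop)
    fun_prop
  exact (BoundaryMaps.ofFamily ⟨_, h⟩ fun p x hx => (p.1 • p.2).2 x hx).continuous⟩

/-- The map that sends `a` in `Θ_q` to `x ↦ a ∧ x`. -/
def thomFamily (Θ : OrthogonalSpectrum.{u}) (q k : ℕ) : C(Untwisted Θ q k, BoundaryMaps Θ q k) :=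
  BoundaryMaps.ofFamily (P := Untwisted Θ q k)
    ⟨fun p => Θ.sphereMap q k p.1 (collapse k p.2), continuous_sphereMap_collapse Θ q k⟩
    fun p x hx => by
      change Θ.sphereMap q k p (collapse k x) = _
      rw [collapse_eq_infty_iff.2 hx]
      rfl

theorem thomFamily_smul (g : O k) (a : Untwisted Θ q k) :
    thomFamily Θ q k (g • a) = g • thomFamily Θ q k a := by
  refine BoundaryMaps.ext fun x => ?_
  have := sphereMap_smul Θ q (show Θ.space q from a) g (g⁻¹ • x)
  rw [smul_inv_smul] at this
  exact this

/-- The Thom map `Θ_q → Map((B^k, ∂B^k), (Θ_{q+k}, pt))` is a homotopy equivalence: families over an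
arbitrary space `T` are classified by maps to `Θ_q`, and the homotopy inverse is the map that
classifies the universal family, `T = BoundaryMaps Θ q k`. -/
theorem exists_homotopyEquiv_thomFamily (Θ : OrthogonalOmegaSpectrum.{u}) (q k : ℕ) :
    ∃ e : ContinuousMap.HomotopyEquiv (Untwisted Θ.toOrthogonalSpectrum q k)
      (BoundaryMaps Θ.toOrthogonalSpectrum q k),
      e.toFun = thomFamily Θ.toOrthogonalSpectrum q k := by
  let Θ' := Θ.toOrthogonalSpectrum
  obtain ⟨b, hb⟩ := exists_relHomotopic_thomMap Θ q k (T := BoundaryMaps Θ' q k)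
    ⟨fun p => p.2.1 p.1, BoundaryMaps.continuous_eval.comp continuous_swap⟩ fun x f hx => f.2 x hx
  obtain ⟨F, hF, hFs, h0, h1⟩ := hb.exists
  let b' : C(BoundaryMaps Θ' q k, Untwisted Θ' q k) := b
  refine ⟨⟨thomFamily Θ' q k, b', ?_, ?_⟩, rfl⟩
  · let A : C(Θ.space q, BoundaryMaps Θ' q k) := thomFamily Θ' q k
    have hA := homotopic_of_relHomotopic_thomMap Θ q k (T := Θ.space q) (a := .id _)
      (b := b.comp A) (.of_trivialAction (fun t p => F t (p.1, A p.2)) (hF.comp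
        (f := fun z : I × Ball k × Θ.space q => (z.1, z.2.1, A z.2.2)) (by fun_prop))
        (fun t x e hx => (hFs t).boundary x _ hx) (fun p => h0 _) fun p => h1 _)
    exact hA.symm
  · let G : C(I × BoundaryMaps Θ' q k, BoundaryMaps Θ' q k) :=
      BoundaryMaps.ofFamily ⟨fun p => F p.1.1 (p.2, p.1.2), hF.comp
        (f := fun z : (I × BoundaryMaps Θ' q k) × Ball k => (z.1.1, z.2, z.1.2)) (by fun_prop)⟩
        fun p x hx => (hFs p.1).boundary x _ hx
    exact ContinuousMap.Homotopic.symm ⟨⟨G, fun f => BoundaryMaps.ext fun x => h0 (x, f),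
      fun f => BoundaryMaps.ext fun x => h1 (x, f)⟩⟩

section Classifying

variable {H : Type v} [Group H] {EH : Type w} [TopologicalSpace EH] [MulAction H EH]

/-- The projection `EH → BH`. -/
def classifyingMap (H : Type v) [Group H] (EH : Type w) [TopologicalSpace EH] [MulAction H EH] :
    C(EH, ClassifyingSpace H EH) :=
  ⟨fun e => Quotient.mk _ e, continuous_quotient_mk'⟩

theorem classifyingMap_smul (h : H) (e : EH) :
    classifyingMap H EH (h • e) = classifyingMap H EH e :=
  Quotient.sound ⟨h, rfl⟩

/-- Invariant maps descend to `BH`, also in the presence of a parameter. -/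
theorem exists_classifying_descend [ContinuousConstSMul H EH] {P X : Type*} [TopologicalSpace P]
    [TopologicalSpace X] (f : C(P × EH, X)) (hf : ∀ p (h : H) e, f (p, h • e) = f (p, e)) :
    ∃ g : C(P × ClassifyingSpace H EH, X), ∀ p e, g (p, classifyingMap H EH e) = f (p, e) := by
  have hq : IsOpenQuotientMap (classifyingMap H EH) :=
    ⟨Quotient.mk_surjective, (classifyingMap H EH).continuous, isOpenMap_quotient_mk'_mul⟩
  refine ⟨⟨fun z => Quotient.lift (s := MulAction.orbitRel H EH) (fun e => f (z.1, e))
    (fun e e' he => ?_) z.2, ?_⟩, fun p e => rfl⟩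
  · obtain ⟨h, rfl⟩ := he
    exact hf z.1 h e'
  · exact (IsOpenQuotientMap.id.prodMap hq).isQuotientMap.continuous_iff.2 f.continuous

variable {ρ : H →* O k} {a b : C(ClassifyingSpace H EH, Θ.space q)}

/-- The Thom section, in the standard frame. -/
def thomStd (k : ℕ) (a : C(ClassifyingSpace H EH, Θ.space q)) : C(Ball k × EH, Θ.Twisted q k) :=
  thomMap Θ q k (a.comp (classifyingMap H EH))

theorem thomStd_apply (a : C(ClassifyingSpace H EH, Θ.space q)) (x : Ball k) (e : EH) :
    thomStd k a (x, e) = (thomFamily Θ q k (a (classifyingMap H EH e))).1 x := rfl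

theorem isExtension_thomStd (a : C(ClassifyingSpace H EH, Θ.space q)) :
    IsExtension ρ (vacuum Θ q k EH) (thomStd k a) := by
  refine ⟨fun h x e => ?_, fun x e hx => (thomFamily Θ q k _).2 x hx⟩
  rw [thomStd_apply, thomStd_apply, classifyingMap_smul]
  exact sphereMap_smul Θ q _ (ρ h) x

theorem relHomotopic_thomStd (h : a.Homotopic b) :
    RelHomotopic ρ (vacuum Θ q k EH) (thomStd k a) (thomStd k b) := by
  obtain ⟨F⟩ := h
  let c : I → C(ClassifyingSpace H EH, Θ.space q) := F.curry
  refine .mk (fun t => thomStd k (c t)) ?_ (fun t => isExtension_thomStd (c t)) (fun p => ?_)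
    fun p => ?_
  · exact (continuous_sphereMap_collapse Θ q k).comp (f := fun z : I × Ball k × EH =>
      (F (z.1, classifyingMap H EH z.2.2), z.2.1)) (by fun_prop)
  · congr 1
    congr 1
    ext x
    exact F.map_zero_left x
  · congr 1
    congr 1
    ext x
    exact F.map_one_left x

variable [ContinuousConstSMul H EH] (𝓣 : EquivariantInverse EH ρ (thomFamily Θ q k))
include 𝓣

/-- An equivariant map that is the vacuum on the boundary is, up to homotopy, the Thom section of a
map `BH → Θ_q`. Such a map is an equivariant map `EH → BoundaryMaps Θ q k`; composed with the
inverse of `thomFamily`, it is invariant and descends to `BH`. -/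
theorem EquivariantInverse.exists_thomStd {f : C(Ball k × EH, Θ.Twisted q k)}
    (hf : IsExtension ρ (vacuum Θ q k EH) f) :
    ∃ a : C(ClassifyingSpace H EH, Θ.space q),
      RelHomotopic ρ (vacuum Θ q k EH) f (thomStd k a) := by
  let G : C(EH, BoundaryMaps Θ q k) := BoundaryMaps.ofFamily
    (f.comp ⟨Prod.swap, continuous_swap⟩) fun e x hx => hf.boundary x e hx
  have hG : ∀ (h : H) e, G (h • e) = ρ h • G e := fun h e => BoundaryMaps.ext fun x => by
    rw [BoundaryMaps.smul_apply]
    refine Eq.trans ?_ (hf.smul h ((ρ h)⁻¹ • x) e)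
    rw [smul_inv_smul]
    rfl
  obtain ⟨a, ha⟩ := exists_classifying_descend (H := H) (P := Unit) (X := Untwisted Θ q k)
    ⟨fun p : Unit × EH => 𝓣.inv p.2 (G p.2), 𝓣.continuous_inv.comp
      (f := fun p : Unit × EH => (p.2, G p.2)) (by fun_prop)⟩ fun p h e => by
        change 𝓣.inv (h • e) (G (h • e)) = 𝓣.inv e (G e)
        rw [hG, 𝓣.inv_smul]
        rfl
  let a' : C(ClassifyingSpace H EH, Θ.space q) :=
    (show C(Unit × ClassifyingSpace H EH, Θ.space q) from a).comp ⟨_, Continuous.prodMk_right ()⟩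
  have ha' : ∀ e, a' (classifyingMap H EH e) = 𝓣.inv e (G e) := ha ()
  refine ⟨a', .mk (fun t p => (𝓣.counit t p.2 (G p.2)).1 p.1) ?_ (fun t => ⟨fun h x e => ?_,
    fun x e hx => (𝓣.counit t e (G e)).2 x hx⟩) (fun p => ?_) fun p => ?_⟩
  · exact BoundaryMaps.continuous_eval.comp ((𝓣.continuous_counit.comp
      (f := fun z : I × Ball k × EH => (z.1, z.2.2, G z.2.2)) (by fun_prop)).prodMk
        continuous_snd.fst)
  · change (𝓣.counit t (h • e) (G (h • e))).1 (ρ h • x) = _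
    rw [hG, 𝓣.counit_smul, BoundaryMaps.smul_apply, inv_smul_smul]
  · rw [𝓣.counit_zero]
    rfl
  · change (𝓣.counit 1 p.2 (G p.2)).1 p.1 = thomStd k a' (p.1, p.2)
    rw [𝓣.counit_one, thomStd_apply, ha']

/-- Maps `BH → Θ_q` with homotopic Thom sections are homotopic: `unit` deforms a map `a` into the
inverse of `thomFamily` applied to the Thom section of `a`. -/
theorem EquivariantInverse.homotopic_of_thomStd
    (h : RelHomotopic ρ (vacuum Θ q k EH) (thomStd k a) (thomStd k b)) : a.Homotopic b := by
  have hunit : ∀ c : C(ClassifyingSpace H EH, Θ.space q),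
      ∃ F : C(I × ClassifyingSpace H EH, Θ.space q), (∀ x, F (0, x) = c x) ∧
        ∀ e, F (1, classifyingMap H EH e) =
          𝓣.inv e (thomFamily Θ q k (c (classifyingMap H EH e))) := by
    intro c
    let c' : C(ClassifyingSpace H EH, Untwisted Θ q k) := c
    obtain ⟨F, hF⟩ := exists_classifying_descend (H := H) (P := I) (X := Untwisted Θ q k)
      ⟨fun p : I × EH => 𝓣.unit p.1 p.2 (c' (classifyingMap H EH p.2)), 𝓣.continuous_unit.comp
        (f := fun p : I × EH => (p.1, p.2, c' (classifyingMap H EH p.2))) (by fun_prop)⟩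
      fun t h e => by
        change 𝓣.unit t (h • e) (c' (classifyingMap H EH (h • e))) =
          𝓣.unit t e (c' (classifyingMap H EH e))
        rw [classifyingMap_smul]
        exact 𝓣.unit_smul t h e _
    refine ⟨F, fun x => ?_, fun e => ?_⟩
    · obtain ⟨e, rfl⟩ := Quotient.mk_surjective x
      exact (hF 0 e).trans (𝓣.unit_zero _ _)
    · exact (hF 1 e).trans (𝓣.unit_one _ _)
  obtain ⟨Fa, ha0, ha1⟩ := hunit a
  obtain ⟨Fb, hb0, hb1⟩ := hunit b
  obtain ⟨F, hF, hFs, h0, h1⟩ := h.exists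
  let G : C(I × EH, BoundaryMaps Θ q k) := BoundaryMaps.ofFamily
    ⟨fun p => F p.1.1 (p.2, p.1.2), hF.comp
      (f := fun z : (I × EH) × Ball k => (z.1.1, z.2, z.1.2)) (by fun_prop)⟩
    fun p x hx => (hFs p.1).boundary x _ hx
  have hG : ∀ t (h : H) e, G (t, h • e) = ρ h • G (t, e) := fun t h e =>
    BoundaryMaps.ext fun x => by
      rw [BoundaryMaps.smul_apply]
      refine Eq.trans ?_ ((hFs t).smul h ((ρ h)⁻¹ • x) e)
      rw [smul_inv_smul]
      rfl
  obtain ⟨W, hW⟩ := exists_classifying_descend (H := H) (P := I) (X := Untwisted Θ q k)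
    ⟨fun p : I × EH => 𝓣.inv p.2 (G p), 𝓣.continuous_inv.comp
      (f := fun p : I × EH => (p.2, G p)) (by fun_prop)⟩ fun t h e => by
        change 𝓣.inv (h • e) (G (t, h • e)) = 𝓣.inv e (G (t, e))
        rw [hG, 𝓣.inv_smul]
        rfl
  have hG0 : ∀ e, G (0, e) = thomFamily Θ q k (a (classifyingMap H EH e)) := fun e =>
    BoundaryMaps.ext fun x => h0 (x, e)
  have hG1 : ∀ e, G (1, e) = thomFamily Θ q k (b (classifyingMap H EH e)) := fun e =>
    BoundaryMaps.ext fun x => h1 (x, e)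
  let a' : C(ClassifyingSpace H EH, Θ.space q) := ⟨fun x => Fa (1, x), by fun_prop⟩
  let b' : C(ClassifyingSpace H EH, Θ.space q) := ⟨fun x => Fb (1, x), by fun_prop⟩
  have e1 : a.Homotopic a' := ⟨⟨Fa, ha0, fun x => rfl⟩⟩
  have e2 : b.Homotopic b' := ⟨⟨Fb, hb0, fun x => rfl⟩⟩
  refine (e1.trans ⟨⟨W, fun x => ?_, fun x => ?_⟩⟩).trans e2.symm
  · obtain ⟨e, rfl⟩ := Quotient.mk_surjective x
    refine ((hW 0 e).trans ?_).trans (ha1 e).symm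
    change 𝓣.inv e (G (0, e)) = _
    rw [hG0]
  · obtain ⟨e, rfl⟩ := Quotient.mk_surjective x
    refine ((hW 1 e).trans ?_).trans (hb1 e).symm
    change 𝓣.inv e (G (1, e)) = _
    rw [hG1]

end Classifying

end ThomIsomorphism

/-! ### The Thom map is additive -/

section Shuffle

theorem blockSum_mulVec {n k : ℕ} (A : O n) (B : O k) (v : Fin (n + k) → ℝ) :
    (blockSum n k (A, B)).1.mulVec v = Fin.append (A.1.mulVec fun i => v (Fin.castAdd k i))
      (B.1.mulVec fun j => v (Fin.natAdd n j)) := by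
  change (Matrix.reindex finSumFinEquiv finSumFinEquiv
    (Matrix.fromBlocks A.1 0 0 B.1)).mulVec v = _
  rw [Matrix.reindex_apply, Matrix.submatrix_mulVec_equiv, Matrix.fromBlocks_mulVec]
  funext i
  induction i using Fin.addCases with
  | left i => simp [Function.comp_def]
  | right i => simp [Function.comp_def]

/-- The orthogonal transformation `(t, y) ↦ (y, t)` of `ℝ × ℝ^k`. -/
def rotation (k : ℕ) : O (k + 1) :=
  ⟨(finRotate (k + 1)).permMatrix ℝ, by
    rw [Matrix.mem_orthogonalGroup_iff]
    rw [Matrix.transpose_permMatrix, ← Matrix.permMatrix_mul, inv_mul_cancel,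
      Matrix.permMatrix_one]⟩

theorem rotation_mulVec (k : ℕ) (v : Fin (k + 1) → ℝ) (i : Fin (k + 1)) :
    (rotation k).1.mulVec v i = v (finRotate (k + 1) i) := by
  change ((finRotate (k + 1)).permMatrix ℝ).mulVec v i = _
  rw [Matrix.permMatrix_mulVec]
  rfl

/-- The orthogonal transformation `(x, t, y) ↦ (x, y, t)` of `ℝ^q × ℝ × ℝ^k`. -/
def shuffle (q k : ℕ) : O (q + k + 1) := blockSum q (k + 1) (1, rotation k)

/-- The identification of `O(n)` and `O(m)` for `n = m`. -/
def castO {n m : ℕ} (h : n = m) (A : O n) : O m := h ▸ A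

theorem castO_mulVec {n m : ℕ} (h : n = m) (A : O n) (v : Fin m → ℝ) (i : Fin m) :
    (castO h A).1.mulVec v i = A.1.mulVec (fun j => v (Fin.cast h j)) (Fin.cast h.symm i) := by
  subst h
  rfl

section Entries

variable {n m : ℕ} (A : O n) (B : O m) (v : Fin (n + m) → ℝ)

theorem blockSum_mulVec_left (i : Fin n) : (blockSum n m (A, B)).1.mulVec v (Fin.castAdd m i) =
    A.1.mulVec (fun j => v (Fin.castAdd m j)) i := by
  rw [blockSum_mulVec, Fin.append_left]

theorem blockSum_mulVec_right (i : Fin m) : (blockSum n m (A, B)).1.mulVec v (Fin.natAdd n i) =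
    B.1.mulVec (fun j => v (Fin.natAdd n j)) i := by
  rw [blockSum_mulVec, Fin.append_right]

theorem one_mulVec_apply {n : ℕ} (v : Fin n → ℝ) (i : Fin n) : (1 : O n).1.mulVec v i = v i :=
  congrFun (Matrix.one_mulVec v) i

end Entries

section ShuffleEntries

variable (q k : ℕ) (v : Fin (q + k + 1) → ℝ)

theorem shuffle_mulVec_left (i : Fin q) :
    (shuffle q k).1.mulVec v (Fin.castAdd 1 (Fin.castAdd k i)) = v ⟨i, by omega⟩ :=
  (blockSum_mulVec_left 1 (rotation k) v i).trans (one_mulVec_apply _ i)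

theorem shuffle_mulVec_mid (j : Fin k) :
    (shuffle q k).1.mulVec v (Fin.castAdd 1 (Fin.natAdd q j)) = v ⟨q + 1 + j, by omega⟩ := by
  refine (blockSum_mulVec_right 1 (rotation k) v j.castSucc).trans ?_
  rw [rotation_mulVec]
  refine congrArg v (Fin.ext ?_)
  simp
  omega

theorem shuffle_mulVec_last :
    (shuffle q k).1.mulVec v (Fin.natAdd (q + k) 0) = v ⟨q, by omega⟩ := by
  refine (blockSum_mulVec_right 1 (rotation k) v (Fin.last k)).trans ?_
  rw [rotation_mulVec]
  refine congrArg v (Fin.ext ?_)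
  simp

end ShuffleEntries

/-- Conjugation with the shuffle exchanges the actions of `O(k)` on the last `k` of the coordinates
`(x, t, y)` and on the middle ones of `(x, y, t)`. -/
theorem shuffle_mul (q k : ℕ) (g : O k) :
    shuffle q k * castO (Nat.add_right_comm q 1 k) (blockSum (q + 1) k (1, g)) =
      blockSum (q + k) 1 (blockSum q k (1, g), 1) * shuffle q k := by
  apply Subtype.ext
  refine Matrix.mulVec_injective (funext fun v => funext fun i => ?_)
  change ((shuffle q k).1 * (castO _ _).1).mulVec v i =
    ((blockSum (q + k) 1 _).1 * (shuffle q k).1).mulVec v i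
  rw [← Matrix.mulVec_mulVec, ← Matrix.mulVec_mulVec]
  induction i using Fin.addCases with
  | left i =>
    rw [blockSum_mulVec_left]
    induction i using Fin.addCases with
    | left i =>
      rw [blockSum_mulVec_left, one_mulVec_apply, shuffle_mulVec_left, shuffle_mulVec_left,
        castO_mulVec]
      exact (blockSum_mulVec_left 1 g _ (Fin.castAdd 1 i)).trans (one_mulVec_apply _ _)
    | right j =>
      rw [blockSum_mulVec_right, shuffle_mulVec_mid, castO_mulVec]
      refine (blockSum_mulVec_right 1 g _ j).trans ?_
      congr 1
      funext l
      exact (shuffle_mulVec_mid q k v l).symm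
  | right i =>
    obtain rfl : i = 0 := Subsingleton.elim _ _
    rw [blockSum_mulVec_right, one_mulVec_apply, shuffle_mulVec_last, shuffle_mulVec_last,
      castO_mulVec]
    exact (blockSum_mulVec_left 1 g _ (Fin.last q)).trans (one_mulVec_apply _ _)

end Shuffle

section Suspension

variable (Θ : OrthogonalSpectrum.{u})

/-- The identification of `Θ_n` and `Θ_m` for `n = m`. -/
def castSpace {n m : ℕ} (h : n = m) (x : Θ.space n) : Θ.space m := h ▸ x

variable {Θ}

theorem continuous_castSpace {n m : ℕ} (h : n = m) : Continuous (castSpace Θ h) := by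
  subst h
  exact continuous_id

theorem castSpace_smul {n m : ℕ} (h : n = m) (A : O n) (x : Θ.space n) :
    castSpace Θ h (A • x) = castO h A • castSpace Θ h x := by
  subst h
  rfl

theorem castSpace_pt {n m : ℕ} (h : n = m) : castSpace Θ h (Θ.pt n) = Θ.pt m := by
  subst h
  rfl

theorem castSpace_str {n m : ℕ} (h : n = m) (x : Θ.space n) (z : OnePoint ℝ) :
    castSpace Θ (congrArg (· + 1) h) (Θ.str n (x, z)) = Θ.str m (castSpace Θ h x, z) := by
  subst h
  rfl

/-- The iterated structure map, with its first instead of its last step split off. -/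
theorem iter_cons (q k : ℕ) (x : Θ.space q) (t : OnePoint ℝ) (z : Fin k → OnePoint ℝ) :
    castSpace Θ (Nat.add_right_comm q 1 k)
      (iter (fun n => Θ.str n) (q + 1) k (Θ.str q (x, t)) z) =
      iter (fun n => Θ.str n) q (k + 1) x (Fin.cons t z) := by
  induction k with
  | zero => rfl
  | succ k ih =>
    change castSpace Θ _ (Θ.str (q + 1 + k) (iter _ (q + 1) k _ (fun i => z i.castSucc),
      z (Fin.last k))) = Θ.str (q + (k + 1)) (iter _ q (k + 1) x
        (fun i => (Fin.cons t z : Fin (k + 2) → OnePoint ℝ) i.castSucc),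
        (Fin.cons t z : Fin (k + 2) → OnePoint ℝ) (Fin.last (k + 1)))
    have h1 : (fun i : Fin (k + 1) => (Fin.cons t z : Fin (k + 2) → OnePoint ℝ) i.castSucc) =
        Fin.cons t fun i => z i.castSucc := by
      funext i
      induction i using Fin.cases with
      | zero => rfl
      | succ i => rfl
    rw [h1, ← ih, ← Fin.succ_last, Fin.cons_succ]
    exact castSpace_str (Nat.add_right_comm q 1 k) _ _

/-- The map `(w, x) ↦ w ∧ x` on `Θ_{q+1} × B^k`, followed by the transformation that moves the
last coordinate of `Θ_{q+1}` to the end. -/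
def endSmash (q k : ℕ) (w : Θ.space (q + 1)) (x : Ball k) : Θ.space (q + k + 1) :=
  shuffle q k • castSpace Θ (Nat.add_right_comm q 1 k) (Θ.sphereMap (q + 1) k w (collapse k x))

theorem continuous_endSmash (q k : ℕ) :
    Continuous fun p : Θ.space (q + 1) × Ball k => endSmash q k p.1 p.2 :=
  ((continuous_castSpace _).comp (continuous_sphereMap_collapse Θ (q + 1) k)).const_smul _

theorem sphereMap_pt (n k : ℕ) (z : OnePoint (EuclideanSpace ℝ (Fin k))) :
    Θ.sphereMap n k (Θ.pt n) z = Θ.pt (n + k) := by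
  induction z using OnePoint.rec with
  | infty => rfl
  | coe v => exact Θ.iter_pt n k _

theorem endSmash_pt (q k : ℕ) (x : Ball k) : endSmash q k (Θ.pt (q + 1)) x = Θ.pt (q + k + 1) := by
  rw [endSmash, sphereMap_pt, castSpace_pt, Θ.smul_pt]

theorem endSmash_boundary (q k : ℕ) (w : Θ.space (q + 1)) {x : Ball k} (hx : ‖x.1‖ = 1) :
    endSmash q k w x = Θ.pt (q + k + 1) := by
  rw [endSmash, collapse_eq_infty_iff.2 hx]
  change shuffle q k • castSpace Θ _ (Θ.pt (q + 1 + k)) = _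
  rw [castSpace_pt, Θ.smul_pt]

theorem endSmash_smul (q k : ℕ) (w : Θ.space (q + 1)) (g : O k) (x : Ball k) :
    endSmash q k w (g • x) = loopAct Θ q k g (endSmash q k w x) := by
  have h := sphereMap_smul Θ (q + 1) w g x
  rw [endSmash, h, Θ.twisted_smul_def, castSpace_smul, ← mul_smul, shuffle_mul, mul_smul]
  rfl

/-- On elements `a ∧ t`, the coordinate `t` is moved behind `x`: `a ∧ t ∧ x` becomes `a ∧ x ∧ t`. -/
theorem endSmash_str (q k : ℕ) (a : Θ.space q) (t : I) (x : Ball k) :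
    endSmash q k (Θ.str q (a, collapseI t)) x =
      Θ.str (q + k) (Θ.sphereMap q k a (collapse k x), collapseI t) := by
  rw [collapseI_def]
  split_ifs with ht
  · by_cases hx : ‖x.1‖ < 1
    · let s : ℝ := (1 - ‖centered t‖)⁻¹ • centered t
      let y : Fin k → ℝ := ((1 - ‖x.1‖)⁻¹ • x.1).ofLp
      have h := Θ.iter_smul q (k + 1) 1 (rotation k) a (Fin.cons s y)
      have h1 : (fun i => ((Fin.cons s y : Fin (k + 1) → ℝ) i : OnePoint ℝ)) =
          Fin.cons (s : OnePoint ℝ) fun i => (y i : OnePoint ℝ) := by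
        funext i
        induction i using Fin.cases with
        | zero => rfl
        | succ i => rfl
      have h2 : (fun i => (((rotation k).1.mulVec (Fin.cons s y : Fin (k + 1) → ℝ) i : ℝ) :
          OnePoint ℝ)) = Fin.snoc (α := fun _ => OnePoint ℝ) (fun i => (y i : OnePoint ℝ)) s := by
        funext i
        rw [rotation_mulVec]
        induction i using Fin.lastCases with
        | last => simp
        | cast i => simp
      rw [one_smul, h1, h2, ← iter_cons] at h
      rw [endSmash, collapse, if_pos hx]
      refine Eq.trans h.symm ?_
      change Θ.str (q + k) (iter _ q k a _, _) = Θ.str (q + k) (iter _ q k a _, _)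
      simp only [Fin.snoc_castSucc, Fin.snoc_last]
      rfl
    · have hx : ‖x.1‖ = 1 := le_antisymm (mem_closedBall_zero_iff.1 x.2) (not_lt.1 hx)
      rw [endSmash_boundary q k _ hx, collapse_eq_infty_iff.2 hx]
      exact (Θ.str_pt _ _).symm
  · rw [Θ.str_infty, Θ.str_infty, endSmash_pt]

end Suspension

section Additivity

variable {Θ : OrthogonalSpectrum.{u}} {q k : ℕ} {H : Type v} [Group H] {EH : Type w}
  [TopologicalSpace EH] [MulAction H EH] {ρ : H →* O k} {a b c : C(ClassifyingSpace H EH, Θ.space q)}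

/-- The loop in `Θ_{q+k+1}` that is obtained from a loop in `Θ_{q+1}` by smashing it with a point of
the ball. -/
def smashLoop (γ : Θ.Loops (q + 1)) (x : Ball k) : Θ.Loops (q + k + 1) where
  toFun τ := endSmash q k (γ τ) x
  continuous_toFun := (continuous_endSmash q k).comp (f := fun τ => (γ τ, x))
    (γ.continuous.prodMk continuous_const)
  source' := by rw [γ.source, endSmash_pt]
  target' := by rw [γ.target, endSmash_pt]

theorem smashLoop_apply (γ : Θ.Loops (q + 1)) (x : Ball k) (τ : I) :
    smashLoop γ x τ = endSmash q k (γ τ) x := rfl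

theorem continuous_smashLoop :
    Continuous fun p : Θ.Loops (q + 1) × Ball k => smashLoop p.1 p.2 := by
  refine Path.continuous_uncurry_iff.1 ?_
  exact (continuous_endSmash q k).comp
    (f := fun z : (Θ.Loops (q + 1) × Ball k) × I => (z.1.1 z.2, z.1.2)) (by fun_prop)

theorem smashLoop_trans (γ δ : Θ.Loops (q + 1)) (x : Ball k) :
    smashLoop (γ.trans δ) x = (smashLoop γ x).trans (smashLoop δ x) := by
  refine Path.ext (funext fun τ => ?_)
  rw [smashLoop_apply, Path.trans_apply, Path.trans_apply]
  split_ifs <;> rfl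

theorem smashLoop_adjoint (y : Θ.space q) (x : Ball k) :
    smashLoop (Θ.adjoint q y) x = Θ.adjoint (q + k) (Θ.sphereMap q k y (collapse k x)) :=
  Path.ext (funext fun τ => endSmash_str q k y τ x)

/-- The Thom map sends sums of loops to loop sums of sections: a loop in `Θ_{q+1}`, smashed with a
point of the ball, is a loop in `Θ_{q+k+1}`. -/
theorem loopSum_thomStd (h : ContinuousMap.Homotopic
    (loopAdd ((Θ.adjoint q).comp a) ((Θ.adjoint q).comp b)) ((Θ.adjoint q).comp c)) :
    LoopSum ρ (thomStd k a) (thomStd k b) (thomStd k c) := by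
  obtain ⟨F⟩ := h
  refine .mk (fun t p => smashLoop (F (t, classifyingMap H EH p.2)) p.1)
    (continuous_smashLoop.comp (f := fun z : I × Ball k × EH =>
      (F (z.1, classifyingMap H EH z.2.2), z.2.1)) (by fun_prop))
    (Path.Homotopy.reflTrans Path.id)
    (fun t => ⟨fun h x e τ => ?_, fun x e τ hx => ?_⟩) (fun p => ?_) fun p => ?_
  · rw [smashLoop_apply, classifyingMap_smul, endSmash_smul]
    rfl
  · refine (endSmash_boundary q k _ hx).trans (Eq.symm ?_)
    rw [loops_apply, (isExtension_thomStd (ρ := ρ) b).boundary x e hx]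
    exact adjoint_pt_apply _ _
  · rw [F.apply_zero]
    exact (smashLoop_trans _ _ _).trans
      (congrArg₂ Path.trans (smashLoop_adjoint _ _) (smashLoop_adjoint _ _))
  · rw [F.apply_one]
    exact smashLoop_adjoint _ _

theorem thomStd_const : thomStd (H := H) (EH := EH) k (ContinuousMap.const _ (Θ.pt q)) =
    vacuumMap Θ q k EH :=
  ContinuousMap.ext fun _ => sphereMap_pt q k _

variable [TopologicalSpace H]

theorem stdMap_thomSection (hE : IsNumerable H EH) (hρ : Continuous ρ) :
    (thomSection Θ ρ EH q a).stdMap hE hρ = thomStd k a :=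
  ContinuousMap.ext fun _ => one_smul (O k) _

theorem stdMap_vacuumSection (hE : IsNumerable H EH) (hρ : Continuous ρ) :
    (vacuumSection Θ ρ EH q).stdMap hE hρ = vacuumMap Θ q k EH :=
  ContinuousMap.ext fun _ => one_smul (O k) _

end Additivity

/-! ### The torsor -/

section Torsor

/-- A relation that is the graph of a free and transitive action defines a torsor. -/
theorem exists_addTorsor {G E : Type*} [AddGroup G] [Nonempty E] (R : G → E → E → Prop)
    (h₁ : ∀ g x, ∃! y, R g x y) (h₂ : ∀ x y, ∃! g, R g x y) (h_zero : ∀ x, R 0 x x)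
    (h_add : ∀ g g' x y z, R g' x y → R g y z → R (g + g') x z) :
    ∃ T : AddTorsor G E, (∀ g x y, T.vadd g x = y ↔ R g x y) ∧
      ∀ x, Function.Bijective fun g => T.vadd g x := by
  choose f hf hf' using h₁
  choose d hd hd' using h₂
  have hf_iff : ∀ g x y, f g x = y ↔ R g x y := fun g x y =>
    ⟨fun h => h ▸ hf g x, fun h => (hf' g x y h).symm⟩
  refine ⟨{ vadd := f, vsub := fun x y => d y x, zero_vadd := fun x => ?_,
            add_vadd := fun g g' x => ?_, vsub_vadd' := fun x y => ?_,
            vadd_vsub' := fun g x => ?_ }, hf_iff, fun x => ⟨fun g g' h => ?_, fun y => ?_⟩⟩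
  · exact (hf_iff _ _ _).2 (h_add g g' x _ _ (hf g' x) (hf g (f g' x)))
  · exact (hf_iff 0 x x).2 (h_zero x)
  · exact (hf_iff _ _ _).2 (hd y x)
  · exact (hd' x (f g x) g (hf g x)).symm
  · exact (hd' x (f g' x) g ((hf_iff _ _ _).1 h)).trans (hd' x (f g' x) g' (hf g' x)).symm
  · exact ⟨d x y, (hf_iff _ _ _).2 (hd x y)⟩

variable {Θ : OrthogonalOmegaSpectrum.{u}} {q : ℕ} {B : Type v} [TopologicalSpace B]

/-- Addition in `[B, Θ_q]` is concatenation of loops. -/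
theorem cohomology_add_eq_iff {a b c : C(B, Θ.space q)} {x y z : Θ.Cohomology q B}
    (hx : HomotopyClasses.mk a = x) (hy : HomotopyClasses.mk b = y)
    (hz : HomotopyClasses.mk c = z) :
    x + y = z ↔
      ContinuousMap.Homotopic (loopAdd ((Θ.adjoint q).comp a) ((Θ.adjoint q).comp b))
        ((Θ.adjoint q).comp c) := by
  subst hx hy hz
  change (HomotopyClasses.congr B (Θ.adjoint q) (Θ.omega q)).symm _ = _ ↔ _
  rw [Equiv.symm_apply_eq]
  exact Quotient.eq

theorem zero_eq_mk :
    (0 : Θ.Cohomology q B) = HomotopyClasses.mk (ContinuousMap.const B (Θ.pt q)) := by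
  change (HomotopyClasses.congr B (Θ.adjoint q) (Θ.omega q)).symm 0 = _
  rw [Equiv.symm_apply_eq]
  refine congrArg (Quotient.mk _) (ContinuousMap.ext fun _ => ?_)
  exact (adjoint_pt q).symm

variable {H : Type v} [Group H] [TopologicalSpace H] {EH : Type w} [TopologicalSpace EH]
  [MulAction H EH] [ContinuousConstSMul H EH] {k : ℕ} {ρ : H →* O k}

/-- The sections with given boundary values form a torsor, whose action is the addition of Thom
sections. -/
theorem exists_extension_addTorsor (hE : IsNumerable H EH) (hρ : Continuous ρ)
    (s₀ : BoundarySection ρ EH (Θ.Twisted q k)) (hs₀ : Nonempty (Extension s₀)) :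
    ∃ T : AddTorsor (Θ.Cohomology q (ClassifyingSpace H EH)) (ExtensionClasses s₀),
      (∀ (a : C(ClassifyingSpace H EH, Θ.space q)) (s s' : Extension s₀),
        T.vadd (HomotopyClasses.mk a) s.toClass = s'.toClass ↔
          IsLoopSum (thomSection Θ.toOrthogonalSpectrum ρ EH q a) s.1 s'.1) ∧
      ∀ x, Function.Bijective fun c => T.vadd c x := by
  let Θ' := Θ.toOrthogonalSpectrum
  -- `𝓔` governs sums and differences of sections, `𝓣` compares differences with maps `BH → Θ_q`.
  obtain ⟨𝓔⟩ := nonempty_equivariantInverse hE hρ (loopMap Θ' q k) (loopMap_smul Θ' q k)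
    (Θ.omega (q + k))
  obtain ⟨𝓣⟩ := nonempty_equivariantInverse hE hρ (thomFamily Θ' q k) thomFamily_smul
    (exists_homotopyEquiv_thomFamily Θ q k)
  have : Nonempty (ExtensionClasses s₀) := hs₀.map Extension.toClass
  let sum (a : C(ClassifyingSpace H EH, Θ.space q)) (s s' : Extension s₀) : Prop :=
    LoopSum ρ (thomStd k a) (s.1.stdMap hE hρ) (s'.1.stdMap hE hρ)
  have hsum : ∀ a s s', IsLoopSum (thomSection Θ' ρ EH q a) s.1 s'.1 ↔ sum a s s' :=
    fun a s s' => by rw [isLoopSum_iff hE hρ, stdMap_thomSection]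
  have hext : ∀ s s' : Extension s₀, IsExtension ρ (s.1.stdMap hE hρ) (s'.1.stdMap hE hρ) :=
    fun s s' => StateSection.isExtension_stdMap hE hρ (s'.2.trans s.2.symm)
  let R (g : Θ.Cohomology q (ClassifyingSpace H EH)) (x y : ExtensionClasses s₀) : Prop :=
    ∃ a s s', HomotopyClasses.mk a = g ∧ Extension.toClass s = x ∧ Extension.toClass s' = y ∧
      sum a s s'
  have hR : ∀ a s s', R (HomotopyClasses.mk a) (Extension.toClass s) (Extension.toClass s') ↔
      sum a s s' := by
    refine fun a s s' => ⟨?_, fun h => ⟨a, s, s', rfl, rfl, rfl, h⟩⟩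
    rintro ⟨b, t, t', ha, hs, hs', h⟩
    exact h.congr (relHomotopic_thomStd (Quotient.exact ha))
      ((Extension.toClass_eq_iff hE hρ t t s).1 hs) ((Extension.toClass_eq_iff hE hρ t t' s').1 hs')
  have h₁ : ∀ g x, ∃! y, R g x y := by
    rintro ⟨a⟩ ⟨s⟩
    obtain ⟨f, hf, hsf⟩ := 𝓔.exists_loopSum (isExtension_thomStd a) (hext s s)
    obtain ⟨s', rfl⟩ := s.exists_stdMap_eq hE hρ hf
    refine ⟨s'.toClass, (hR a s s').2 hsf, ?_⟩
    rintro ⟨s''⟩ h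
    exact (Extension.toClass_eq_iff hE hρ s s'' s').2
      (𝓔.loopSum_unique (hext s s) (hext s s'') (hext s s') ((hR a s s'').1 h) hsf)
  have h₂ : ∀ x y, ∃! g, R g x y := by
    rintro ⟨s⟩ ⟨s'⟩
    obtain ⟨α, hα, hsα⟩ := 𝓔.exists_difference (hext s s) (hext s s')
    obtain ⟨a, ha⟩ := 𝓣.exists_thomStd hα
    have hsa : sum a s s' := hsα.congr ha (.refl (hext s s)) (.refl (hext s s'))
    refine ⟨HomotopyClasses.mk a, (hR a s s').2 hsa, ?_⟩
    rintro ⟨b⟩ h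
    exact Quotient.sound (𝓣.homotopic_of_thomStd (𝓔.difference_unique (hext s s)
      (isExtension_thomStd b) (isExtension_thomStd a) ((hR b s s').1 h) hsa))
  have h_zero : ∀ x, R 0 x x := by
    rintro ⟨s⟩
    rw [zero_eq_mk]
    refine (hR _ s s).2 ?_
    change LoopSum ρ _ _ _
    rw [thomStd_const]
    exact .vacuum_left (hext s s)
  have h_add : ∀ g g' x y z, R g' x y → R g y z → R (g + g') x z := by
    intro g g' x y z h h'
    obtain ⟨a, ha⟩ := Quotient.exists_rep g
    obtain ⟨b, hb⟩ := Quotient.exists_rep g'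
    obtain ⟨c, hc⟩ := Quotient.exists_rep (g + g')
    obtain ⟨s, rfl⟩ := Quotient.exists_rep x
    obtain ⟨s', rfl⟩ := Quotient.exists_rep y
    obtain ⟨s'', rfl⟩ := Quotient.exists_rep z
    have h1 := (cohomology_add_eq_iff ha hb hc).1 rfl
    subst ha hb
    rw [← hc]
    exact (hR c s s'').2 (LoopSum.assoc (isExtension_thomStd a) (isExtension_thomStd b)
      (hext s s) (hext s s') (loopSum_thomStd h1) ((hR b s s').1 h) ((hR a s' s'').1 h'))
  obtain ⟨T, hT, hT'⟩ := exists_addTorsor R h₁ h₂ h_zero h_add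
  exact ⟨T, fun a s s' => (hT _ _ _).trans ((hR a s s').trans (hsum a s s').symm), hT'⟩

end Torsor

end ThomTorsor

end

theorem lemma2 (Θ : OrthogonalOmegaSpectrum.{u}) {H : Type v} [Group H] [TopologicalSpace H]
    [IsTopologicalGroup H] {EH : Type w} [TopologicalSpace EH] [MulAction H EH]
    [ContinuousSMul H EH] (hEH : IsUniversalBundle H EH) (k q : ℕ) (ρ : H →* O k)
    (hρ : Continuous ρ) :
    ∃ T : ∀ s₀ : BoundarySection ρ EH (Θ.Twisted q k), Nonempty (Extension s₀) →
        AddTorsor (Θ.Cohomology q (ClassifyingSpace H EH)) (ExtensionClasses s₀),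
      -- the action of `[a]` is the addition of the Thom section of `a`
      (∀ (s₀ : BoundarySection ρ EH (Θ.Twisted q k)) (hs₀ : Nonempty (Extension s₀))
        (a : C(ClassifyingSpace H EH, Θ.space q)) (s s' : Extension s₀),
        (T s₀ hs₀).vadd (HomotopyClasses.mk a) s.toClass = s'.toClass ↔
          IsLoopSum (thomSection Θ.toOrthogonalSpectrum ρ EH q a) s.1 s'.1) ∧
      -- for a constant boundary value, the class of the constant section is an identity element
      (∀ (θ : Θ.Twisted q k) (hθ : ∀ h, ρ h • θ = θ),
        Function.Bijective fun c : Θ.Cohomology q (ClassifyingSpace H EH) =>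
          (T _ ⟨constExtension Θ.toOrthogonalSpectrum ρ EH q θ hθ⟩).vadd c
            (constExtension Θ.toOrthogonalSpectrum ρ EH q θ hθ).toClass) ∧
      -- for the vacuum, the resulting bijection is the Thom isomorphism
      ∀ a : C(ClassifyingSpace H EH, Θ.space q),
        (T _ ⟨vacuumExtension Θ.toOrthogonalSpectrum ρ EH q⟩).vadd (HomotopyClasses.mk a)
            (vacuumExtension Θ.toOrthogonalSpectrum ρ EH q).toClass =
          (thomExtension Θ.toOrthogonalSpectrum ρ EH q a).toClass := by
  have hE : IsNumerable H EH := hEH.numerable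
  choose T hT hT' using exists_extension_addTorsor (Θ := Θ) (q := q) hE hρ
  refine ⟨T, hT, fun θ hθ => hT' _ _ _, fun a => (hT _ _ _ _ _).2 ?_⟩
  refine (isLoopSum_iff hE hρ).2 ?_
  change LoopSum ρ ((thomSection _ ρ EH q a).stdMap hE hρ)
    ((vacuumSection _ ρ EH q).stdMap hE hρ) ((thomSection _ ρ EH q a).stdMap hE hρ)
  rw [stdMap_thomSection, stdMap_vacuumSection]
  exact .vacuum_right (isExtension_thomStd a)
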